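/- A split graph is a finite simple graph $G$ whose vertex set has a split partition $C\uplus I$, that is, a partition into a clique $C$ and an independent set $I$ (either may be empty). A unit interval graph is a graph whose vertices can be assigned closed intervals of one common positive length on the real line so that two distinct vertices are adjacent if and only if their intervals intersect. In the split $\to$ unit interval vertex deletion problem one is given a split graph $G$ (only the graph, by its adjacency matrix) on $n$ vertices and is asked for a set $V_-\subseteq V(G)$ of minimum cardinality such that $G-V_-$ is a unit interval graph. In its decision version the input is a graph $G$ and a number $k\in\mathbb{N}$, and it is asked whether $G$ is a split graph that has a set $V_-$ of at most $k$ vertices such that $G-V_-$ is a unit interval graph. Theorem. The split $\to$ unit interval vertex deletion problem is solvable in polynomial time. More precisely: 1. There is a polynomial-time algorithm that, given any split graph $G$, outputs a minimum set $V_-\subseteq V(G)$ such that $G-V_-$ is a unit interval graph. 2. The decision version is in P. 3. There is a polynomial-time oracle algorithm (a call to the oracle being charged the length of the question and of the answer) that, with any oracle returning a minimum vertex cover of every bipartite graph it is asked about, solves the problem of item 1 on every split graph with $n$ vertices using $O((n+1)^3)$ oracle calls. 4. If a connected split graph $G$ with split partition $C\uplus I$ is a unit interval graph, then $|I|\le 3$.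 Here algorithms are programs of a random access machine over natural numbers with addition, truncated subtraction, indirect addressing, branching and loops, every operation costing one step; this machine is polynomially equivalent to Turing machines. -/

import Mathlib

namespace SplitUIG

/-! ### Graph classes -/

/-- `C ⊎ I` is a split partition of `G`: a clique and an independent set, either possibly empty,
that partition the vertex set. -/
def IsSplitPartition {V : Type*} (G : SimpleGraph V) (C I : Set V) : Prop :=
  IsCompl C I ∧ G.IsClique C ∧ G.IsIndepSet I

/-- Split graphs. -/
def IsSplit {V : Type*} (G : SimpleGraph V) : Prop :=
  ∃ C I : Set V, IsSplitPartition G C I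

/-- Unit interval graphs: intersection graphs of closed intervals `[a v, a v + L]` on the real
line, all of the same length `L`. -/
def IsUnitInterval {V : Type*} (G : SimpleGraph V) : Prop :=
  ∃ (L : ℝ) (a : V → ℝ), 0 < L ∧ ∀ u v : V, u ≠ v →
    (G.Adj u v ↔ (Set.Icc (a u) (a u + L) ∩ Set.Icc (a v) (a v + L)).Nonempty)

/-- `S` is a solution: the graph `G - S` is a unit interval graph. -/
def IsSolution {V : Type*} (G : SimpleGraph V) (S : Finset V) : Prop :=
  IsUnitInterval (G.induce {v | v ∉ S})

/-- `S` is a solution of minimum cardinality. -/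
def IsMinSolution {V : Type*} (G : SimpleGraph V) (S : Finset V) : Prop :=
  IsSolution G S ∧ ∀ T : Finset V, IsSolution G T → S.card ≤ T.card

/-- `X` is a vertex cover of minimum cardinality. -/
def IsMinVertexCover {V : Type*} (G : SimpleGraph V) (X : Finset V) : Prop :=
  G.IsVertexCover (X : Set V) ∧
    ∀ Y : Finset V, G.IsVertexCover (Y : Set V) → X.card ≤ Y.card

/-! ### A random access machine with a step count

Programs are structured programs over registers and an addressable memory, both holding natural
numbers. The arithmetic operations are addition and truncated subtraction only, at unit cost, so
that `t` steps produce only numbers with at most `t` bits more than those in the program and in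
the input, and the machine is polynomially equivalent to a Turing machine. -/

/-- Configurations: the contents of the registers and of the memory. -/
structure Config where
  reg : ℕ → ℕ
  mem : ℕ → ℕ

/-- Programs. Register names are the natural numbers; a program mentions only finitely many. -/
inductive Prog where
  /-- do nothing -/
  | skip
  /-- `reg r := k` -/
  | const (r k : ℕ)
  /-- `reg r := reg a + reg b` -/
  | add (r a b : ℕ)
  /-- `reg r := reg a - reg b` (truncated) -/
  | sub (r a b : ℕ)
  /-- `reg r := mem (reg a)` -/
  | load (r a : ℕ)
  /-- `mem (reg a) := reg r` -/
  | store (a r : ℕ)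
  /-- ask the oracle the word stored at address `reg a`; the answer is put at address `reg b` -/
  | call (a b : ℕ)
  /-- run `p`, then `q` -/
  | seq (p q : Prog)
  /-- if `reg r ≠ 0` run `p`, otherwise `q` -/
  | ite (r : ℕ) (p q : Prog)
  /-- while `reg r ≠ 0` run `p` -/
  | loop (r : ℕ) (p : Prog)

/-- A word `w` is stored at address `a` when `mem a` is its length and the following cells hold
its letters (zero for `false`, nonzero for `true`). This reads the word stored at `a`. -/
def readWord (m : ℕ → ℕ) (a : ℕ) : List Bool :=
  (List.range (m a)).map fun i => decide (m (a + 1 + i) ≠ 0)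

/-- Store the word `w` at address `a`, leaving all other cells as they are. -/
def writeWord (m : ℕ → ℕ) (a : ℕ) (w : List Bool) : ℕ → ℕ := fun i =>
  if i = a then w.length
  else if a < i ∧ i ≤ a + w.length then (w.getD (i - a - 1) false).toNat
  else m i

/-- The initial configuration on input `w`: the input is stored at address `0`, everything else
is zero. -/
def init (w : List Bool) : Config :=
  ⟨fun _ => 0, writeWord (fun _ => 0) 0 w⟩

/-- The output in a configuration: the word stored at address `0`. -/
def Config.output (s : Config) : List Bool := readWord s.mem 0

/-- Assign a register. -/
def Config.set (s : Config) (r x : ℕ) : Config :=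
  ⟨Function.update s.reg r x, s.mem⟩

/-- `Exec O p s s' t c`: with oracle `O`, the program `p` started in `s` halts in `s'` after
exactly `t` steps, of which `c` are oracle calls. Every elementary operation and every
test of a condition costs one step; an oracle call is charged, in addition, the lengths of the
question and of the answer. -/
inductive Exec (O : List Bool → List Bool) : Prog → Config → Config → ℕ → ℕ → Prop where
  | skip (s : Config) : Exec O .skip s s 1 0
  | const (r k : ℕ) (s : Config) : Exec O (.const r k) s (s.set r k) 1 0
  | add (r a b : ℕ) (s : Config) :
      Exec O (.add r a b) s (s.set r (s.reg a + s.reg b)) 1 0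
  | sub (r a b : ℕ) (s : Config) :
      Exec O (.sub r a b) s (s.set r (s.reg a - s.reg b)) 1 0
  | load (r a : ℕ) (s : Config) :
      Exec O (.load r a) s (s.set r (s.mem (s.reg a))) 1 0
  | store (a r : ℕ) (s : Config) :
      Exec O (.store a r) s ⟨s.reg, Function.update s.mem (s.reg a) (s.reg r)⟩ 1 0
  | call (a b : ℕ) (s : Config) :
      Exec O (.call a b) s
        ⟨s.reg, writeWord s.mem (s.reg b) (O (readWord s.mem (s.reg a)))⟩
        (1 + (readWord s.mem (s.reg a)).length + (O (readWord s.mem (s.reg a))).length) 1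
  | seq {p q : Prog} {s s' s'' : Config} {t t' c c' : ℕ} :
      Exec O p s s' t c → Exec O q s' s'' t' c' →
      Exec O (.seq p q) s s'' (t + t') (c + c')
  | ite_true {r : ℕ} {p q : Prog} {s s' : Config} {t c : ℕ} :
      s.reg r ≠ 0 → Exec O p s s' t c → Exec O (.ite r p q) s s' (1 + t) c
  | ite_false {r : ℕ} {p q : Prog} {s s' : Config} {t c : ℕ} :
      s.reg r = 0 → Exec O q s s' t c → Exec O (.ite r p q) s s' (1 + t) c
  | loop_stop {r : ℕ} {p : Prog} {s : Config} :
      s.reg r = 0 → Exec O (.loop r p) s s 1 0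
  | loop_step {r : ℕ} {p : Prog} {s s' s'' : Config} {t t' c c' : ℕ} :
      s.reg r ≠ 0 → Exec O p s s' t c → Exec O (.loop r p) s' s'' t' c' →
      Exec O (.loop r p) s s'' (1 + t + t') (c + c')

/-- With oracle `O`, the program `p` on input `w` halts with output `v` within `T` steps,
at most `N` of which are oracle calls. -/
def Outputs (O : List Bool → List Bool) (p : Prog) (w v : List Bool) (T N : ℕ) : Prop :=
  ∃ (s : Config) (t c : ℕ), Exec O p (init w) s t c ∧ s.output = v ∧ t ≤ T ∧ c ≤ N

/-- Without oracle: no oracle call is ever executed, so that the oracle mentioned here does not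
matter. -/
def OutputsPlain (p : Prog) (w v : List Bool) (T : ℕ) : Prop :=
  Outputs (fun _ => []) p w v T 0

open Classical in
/-- The complexity class P: languages over the binary alphabet that are decided in time
polynomial in the length of the input. -/
def InP (A : Set (List Bool)) : Prop :=
  ∃ (p : Prog) (P : Polynomial ℕ), ∀ w : List Bool,
    OutputsPlain p w [decide (w ∈ A)] (P.eval w.length)

/-! ### Encodings -/

open Classical in
/-- A graph on the vertices `0, …, n - 1` as a binary word: `n` in unary, ended by `false`, then
the adjacency matrix row by row. -/
noncomputable def codeGraph {n : ℕ} (G : SimpleGraph (Fin n)) : List Bool :=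
  List.replicate n true ++ false ::
    (List.finRange n).flatMap fun i => (List.finRange n).map fun j => decide (G.Adj i j)

/-- A set of vertices as a binary word: its characteristic vector. -/
def codeSet {n : ℕ} (S : Finset (Fin n)) : List Bool :=
  (List.finRange n).map fun v => decide (v ∈ S)

/-- The decision version: given a split graph `G` and a number `k` (in binary, after the
code of `G`), is there a solution with at most `k` vertices? -/
def decisionLanguage : Set (List Bool) :=
  {w | ∃ (n : ℕ) (G : SimpleGraph (Fin n)) (k : ℕ), w = codeGraph G ++ k.bits ∧
    IsSplit G ∧ ∃ S : Finset (Fin n), S.card ≤ k ∧ IsSolution G S}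

/-- `O` solves bipartite vertex cover: asked a bipartite graph, it answers a minimum vertex cover
(which one, and what it answers to other questions, is left open). -/
def SolvesBipartiteVertexCover (O : List Bool → List Bool) : Prop :=
  ∀ (m : ℕ) (H : SimpleGraph (Fin m)), H.IsBipartite →
    ∃ X : Finset (Fin m), IsMinVertexCover H X ∧ O (codeGraph H) = codeSet X

end SplitUIG

/-! Combinatorial core. In a unit interval representation of a split graph, all intervals of the
clique contain a common point x, namely the largest of their left endpoints. The intervals of the
independent side are pairwise disjoint, and those with a neighbour meet an interval of the clique.
Hence at most one of them lies to the left of x, at most one contains x and at most one lies to the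
right (`exists_left_mid_right`); this also bounds the independent side in the connected case
(`ncard_right_le_three`).

So a solution T leaves at most three independent vertices a, b, c that are not isolated, and there
are O(n^3) ways to guess them. If the middle vertex b exists, every kept clique vertex is adjacent
to b, and none is adjacent to both a and c, since b fits between them and the gap exceeds the common
length. If b does not exist, either no kept clique vertex is adjacent to both outer vertices, or
some is; then the gap is at most the common length and every kept clique vertex meets at least one
of them. Each case forces certain clique vertices into T. Besides these, T has to destroy all edges
between unguessed independent vertices and clique vertices, which is a vertex cover problem in a
bipartite graph. `exists_guess` proves that every solution obeys the constraints of some guess,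
`isSolution_of_guess` that conversely forced vertices plus any vertex cover form a solution, and
`card_le_of_guess` that a minimum cover makes the candidate no larger than any solution fitting the
guess. The best candidate over all guesses is therefore a minimum solution.

Minimum vertex covers come from the oracle or from an auction. Free bidders repeatedly bid for a
cheapest object they want, raising its price by one. Once no bid is possible, a price level that
does not occur separates expensive objects from cheap ones, and the expensive objects together with
the bidders that want a cheap one form a cover no larger than the matching given by ownership
(`AuctionInv.isMinVertexCover`). As only the graph is given, a split partition is computed first,
adding vertices one at a time and correcting at most one vertex on each side
(`PrefixOK.exists_toggle`).

Machine model. Algorithms are written in a small language of expressions and commands whose loops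
are all bounded by a number B, and are compiled to the random access machine. `Ex.exec_comp` and
`Cmd.exec_comp` prove, once for all programs, that the compiled code has the intended effect, makes
the counted oracle calls and takes time polynomial in B. As B is the input length plus two, only the
meaning of the commands has to be analysed afterwards. -/

namespace SplitUIG

/-! ### Polynomially bounded functions -/

/-- `T` is bounded by a polynomial. -/
def PolyBounded (T : ℕ → ℕ) : Prop :=
  ∃ P : Polynomial ℕ, ∀ b, T b ≤ P.eval b

theorem PolyBounded.const (k : ℕ) : PolyBounded fun _ => k :=
  ⟨Polynomial.C k, fun b => by simp⟩

theorem PolyBounded.id : PolyBounded fun b => b :=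
  ⟨Polynomial.X, fun b => by simp⟩

theorem PolyBounded.add {S T : ℕ → ℕ} (hS : PolyBounded S) (hT : PolyBounded T) :
    PolyBounded fun b => S b + T b := by
  obtain ⟨P, hP⟩ := hS
  obtain ⟨Q, hQ⟩ := hT
  exact ⟨P + Q, fun b => by rw [Polynomial.eval_add]; exact Nat.add_le_add (hP b) (hQ b)⟩

theorem PolyBounded.mul {S T : ℕ → ℕ} (hS : PolyBounded S) (hT : PolyBounded T) :
    PolyBounded fun b => S b * T b := by
  obtain ⟨P, hP⟩ := hS
  obtain ⟨Q, hQ⟩ := hT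
  exact ⟨P * Q, fun b => by rw [Polynomial.eval_mul]; exact Nat.mul_le_mul (hP b) (hQ b)⟩

/-! ### Rules for execution -/

/-- The invariant sees the number of finished iterations and the number of oracle calls so far, so
that one rule delivers termination, running time and call count. -/
theorem Exec.loop_count {O : List Bool → List Bool} {r : ℕ} {p : Prog} {T m : ℕ}
    (I : ℕ → Config → ℕ → Prop)
    (hstep : ∀ j < m, ∀ s k, I j s k → s.reg r ≠ 0 ∧
      ∃ s' t c, Exec O p s s' t c ∧ I (j + 1) s' (k + c) ∧ t ≤ T)
    (hend : ∀ s k, I m s k → s.reg r = 0) {s : Config} {k : ℕ} (h0 : I 0 s k) :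
    ∃ s' t c, Exec O (.loop r p) s s' t c ∧ I m s' (k + c) ∧ t ≤ m * (T + 1) + 1 := by
  -- Induction on the iterations still to be made, because `Exec.loop_step` splits off the first
  -- one.
  suffices H : ∀ i ≤ m, ∀ s k, I (m - i) s k →
      ∃ s' t c, Exec O (.loop r p) s s' t c ∧ I m s' (k + c) ∧ t ≤ i * (T + 1) + 1 by
    exact H m le_rfl s k (by simpa using h0)
  intro i
  induction i with
  | zero =>
    intro _ s k h
    exact ⟨s, 1, 0, Exec.loop_stop (hend s k h), h, by omega⟩
  | succ i ih =>
    intro hi s k h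
    obtain ⟨hr, s', t, c, he, hI, ht⟩ := hstep (m - (i + 1)) (by omega) s k h
    rw [show m - (i + 1) + 1 = m - i by omega] at hI
    obtain ⟨s'', t', c', he', hI', ht'⟩ := ih (by omega) s' (k + c) hI
    refine ⟨s'', 1 + t + t', c + c', .loop_step hr he he', ?_, ?_⟩
    · rwa [← Nat.add_assoc]
    · rw [Nat.succ_mul]; omega

/-! ### Expressions

Variables are the even registers and temporaries are the odd ones; the register `1` holds a bound
`B`. The memory below the address `B` is a scratch area, above it there are sixteen interleaved
infinite arrays. -/

/-- Expressions over variables and arrays. -/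
inductive Ex where
  | c (k : ℕ)
  | v (x : ℕ)
  | add (e f : Ex)
  | sub (e f : Ex)
  | ar (k : Fin 16) (e : Ex)
  | ite (e f g : Ex)
  /-- the sum of `e` over all `x < B` -/
  | sum (x : ℕ) (e : Ex)

/-- The value of an expression. -/
def Ex.eval (B : ℕ) : Ex → (ℕ → ℕ) → (Fin 16 → ℕ → ℕ) → ℕ
  | .c k, _, _ => k
  | .v x, f, _ => f x
  | .add e e', f, a => e.eval B f a + e'.eval B f a
  | .sub e e', f, a => e.eval B f a - e'.eval B f a
  | .ar k e, f, a => a k (e.eval B f a)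
  | .ite e e' e'', f, a => if e.eval B f a ≠ 0 then e'.eval B f a else e''.eval B f a
  | .sum x e, f, a => ∑ j ∈ Finset.range B, e.eval B (Function.update f x j) a

/-- The register of the temporary `d`. -/
abbrev tmp (d : ℕ) : ℕ := 2 * d + 3

/-- Replace the index `i` in the register `tmp d` by the address of the entry `i` of the array
`k`, using the register `tmp (d + 1)`. -/
def addrProg (k : Fin 16) (d : ℕ) : Prog :=
  .seq (.add (tmp d) (tmp d) (tmp d)) <| .seq (.add (tmp d) (tmp d) (tmp d)) <|
  .seq (.add (tmp d) (tmp d) (tmp d)) <| .seq (.add (tmp d) (tmp d) (tmp d)) <|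
  .seq (.const (tmp (d + 1)) k) <| .seq (.add (tmp d) (tmp d) (tmp (d + 1)))
    (.add (tmp d) (tmp d) 1)

/-- `reg r := reg a`, using the register `z`. -/
def moveProg (r a z : ℕ) : Prog :=
  .seq (.const z 0) (.add r a z)

/-- Run `p` for the values `x = B - 1, …, 0`, with the counter in `tmp d`, and restore `x`, whose
value is saved in `tmp (d + 1)`. -/
def downProg (x d : ℕ) (p : Prog) : Prog :=
  .seq (moveProg (tmp (d + 1)) (2 * x) (tmp (d + 2))) <|
  .seq (moveProg (tmp d) 1 (tmp (d + 2))) <|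
  .seq (.loop (tmp d) <|
    .seq (.const (tmp (d + 2)) 1) <| .seq (.sub (2 * x) (tmp d) (tmp (d + 2))) <|
    .seq p (moveProg (tmp d) (2 * x) (tmp (d + 2))))
  (moveProg (2 * x) (tmp (d + 1)) (tmp (d + 2)))

/-- Compute an expression into the register `tmp d`. -/
def Ex.comp : Ex → ℕ → Prog
  | .c k, d => .const (tmp d) k
  | .v x, d => moveProg (tmp d) (2 * x) (tmp d)
  | .add e f, d => .seq (e.comp d) <| .seq (f.comp (d + 1)) (.add (tmp d) (tmp d) (tmp (d + 1)))
  | .sub e f, d => .seq (e.comp d) <| .seq (f.comp (d + 1)) (.sub (tmp d) (tmp d) (tmp (d + 1)))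
  | .ar k e, d => .seq (e.comp d) <| .seq (addrProg k d) (.load (tmp d) (tmp d))
  | .ite e f g, d => .seq (e.comp d) (.ite (tmp d) (f.comp d) (g.comp d))
  | .sum x e, d => .seq (.const (tmp d) 0) <|
      downProg x (d + 1) <| .seq (e.comp (d + 4)) (.add (tmp d) (tmp d) (tmp (d + 4)))

/-- The variables of a configuration. -/
def Config.vars (s : Config) : ℕ → ℕ := fun x => s.reg (2 * x)

/-- The arrays of a configuration. -/
def Config.arrs (s : Config) (B : ℕ) : Fin 16 → ℕ → ℕ := fun k i => s.mem (B + 16 * i + k)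

theorem Config.arrs_congr {s s' : Config} (h : s.mem = s'.mem) (B : ℕ) :
    s.arrs B = s'.arrs B := by
  unfold Config.arrs
  rw [h]

/-! ### Correctness and running time of compiled expressions -/

theorem exec_moveProg (O : List Bool → List Bool) {r a z : ℕ} (hz : z ≠ a) (s : Config) :
    ∃ s', Exec O (moveProg r a z) s s' 2 0 ∧ s'.mem = s.mem ∧ s'.reg r = s.reg a ∧
      ∀ q, q ≠ r → q ≠ z → s'.reg q = s.reg q := by
  refine ⟨_, .seq (.const _ _ _) (.add _ _ _ _), rfl, ?_, ?_⟩
  · simp [Config.set, Function.update_of_ne hz.symm]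
  · intro q h1 h2
    simp [Config.set, h1, h2]

theorem exec_moveProg_self (O : List Bool → List Bool) {r a : ℕ} (hz : r ≠ a) (s : Config) :
    ∃ s', Exec O (moveProg r a r) s s' 2 0 ∧ s'.mem = s.mem ∧ s'.reg r = s.reg a ∧
      ∀ q, q ≠ r → s'.reg q = s.reg q := by
  obtain ⟨s', h1, h2, h3, h4⟩ := exec_moveProg O (r := r) hz s
  exact ⟨s', h1, h2, h3, fun q hq => h4 q hq hq⟩

/-- Four doublings replace the multiplication by 16, which the machine does not offer. -/
theorem exec_addrProg (O : List Bool → List Bool) (k : Fin 16) (d : ℕ) (s : Config) :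
    ∃ s', Exec O (addrProg k d) s s' 7 0 ∧ s'.mem = s.mem ∧
      s'.reg (tmp d) = s.reg 1 + 16 * s.reg (tmp d) + k ∧
      ∀ q, q ≠ tmp d → q ≠ tmp (d + 1) → s'.reg q = s.reg q := by
  refine ⟨_, .seq (.add _ _ _ _) <| .seq (.add _ _ _ _) <| .seq (.add _ _ _ _) <|
    .seq (.add _ _ _ _) <| .seq (.const _ _ _) <| .seq (.add _ _ _ _) (.add _ _ _ _), rfl, ?_, ?_⟩
  · have h1 : (1 : ℕ) ≠ tmp d := by simp [tmp]
    have h2 : (1 : ℕ) ≠ tmp (d + 1) := by simp [tmp]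
    have h3 : tmp d ≠ tmp (d + 1) := by simp [tmp]
    simp only [Config.set, Function.update_self, Function.update_of_ne h1, Function.update_of_ne h2,
      Function.update_of_ne h3]
    omega
  · intro q h1 h2
    simp only [Config.set, Function.update_of_ne h1, Function.update_of_ne h2]

/-- The body of a downward loop may be reasoned about with an invariant that does not mention the
bookkeeping registers. -/
theorem exec_downProg {O : List Bool → List Bool} {x d B T : ℕ} {p : Prog}
    (I : ℕ → Config → Prop)
    (hI : ∀ j s s', I j s → s'.mem = s.mem →
      (∀ r, r ≠ 2 * x ∧ (r % 2 = 0 ∨ r < tmp d) → s'.reg r = s.reg r) → I j s')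
    (hstep : ∀ j < B, ∀ s, I (j + 1) s → s.reg (2 * x) = j → s.reg 1 = B →
      ∃ s' t, Exec O p s s' t 0 ∧ I j s' ∧
        (∀ r, r = 1 ∨ r = 2 * x ∨ r = tmp (d + 1) → s'.reg r = s.reg r) ∧ t ≤ T)
    {s : Config} (hB : s.reg 1 = B) (h0 : I B s) :
    ∃ s' t, Exec O (downProg x d p) s s' t 0 ∧ I 0 s' ∧ s'.reg 1 = B ∧
      s'.reg (2 * x) = s.reg (2 * x) ∧ t ≤ B * (T + 5) + 7 := by
  have hx1 : tmp (d + 2) ≠ 2 * x := by simp only [tmp]; omega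
  obtain ⟨s1, e1, m1, v1, r1⟩ := exec_moveProg O (r := tmp (d + 1)) hx1 s
  obtain ⟨s2, e2, m2, v2, r2⟩ := exec_moveProg O (r := tmp d) (a := 1) (z := tmp (d + 2))
    (by simp only [tmp]; omega) s1
  -- After j rounds the counter is B - j. The body may destroy the counter, since it is restored
  -- from the register of x; only that register, the bound and the saved old value of x have to
  -- survive.
  have hl := Exec.loop_count (O := O) (r := tmp d) (m := B) (T := T + 4)
    (p := .seq (.const (tmp (d + 2)) 1) <| .seq (.sub (2 * x) (tmp d) (tmp (d + 2))) <|
      .seq p (moveProg (tmp d) (2 * x) (tmp (d + 2))))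
    (fun j s' k => k = 0 ∧ I (B - j) s' ∧ s'.reg (tmp d) = B - j ∧ s'.reg 1 = B ∧
      s'.reg (tmp (d + 1)) = s.reg (2 * x)) (s := s2) (k := 0) ?_ ?_ ?_
  · obtain ⟨s3, t3, c3, e3, ⟨hc3, i3, -, b3, v3⟩, ht3⟩ := hl
    obtain rfl : c3 = 0 := by omega
    obtain ⟨s4, e4, m4, v4, r4⟩ := exec_moveProg O (r := 2 * x) (a := tmp (d + 1))
      (z := tmp (d + 2)) (by simp only [tmp]; omega) s3
    refine ⟨s4, _, .seq e1 <| .seq e2 <| .seq e3 e4, ?_, ?_, ?_, ?_⟩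
    · refine hI _ s3 s4 (by simpa using i3) m4 fun r hr => r4 r ?_ ?_
      all_goals (simp only [tmp] at hr ⊢; omega)
    · rw [r4 1 (by omega) (by simp only [tmp]; omega), b3]
    · rw [v4, v3]
    · have : B * (T + 4 + 1) = B * (T + 5) := rfl
      omega
  · rintro j hj s' k ⟨rfl, hI', hd, h1, hs⟩
    refine ⟨by omega, ?_⟩
    have e1 := Exec.const (O := O) (tmp (d + 2)) 1 s'
    have e2 := Exec.sub (O := O) (2 * x) (tmp d) (tmp (d + 2)) (s'.set (tmp (d + 2)) 1)
    set s2' := (s'.set (tmp (d + 2)) 1).set (2 * x) ((s'.set (tmp (d + 2)) 1).reg (tmp d) -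
      (s'.set (tmp (d + 2)) 1).reg (tmp (d + 2))) with hs2'
    have hq : ∀ q, q ≠ 2 * x → q ≠ tmp (d + 2) → s2'.reg q = s'.reg q := by
      intro q h1 h2
      simp [hs2', Config.set, h1, h2]
    have hqx : s2'.reg (2 * x) = B - (j + 1) := by
      have : tmp d ≠ tmp (d + 2) := by simp [tmp]
      simp only [hs2', Config.set, Function.update_self, Function.update_of_ne this, hd]
      omega
    obtain ⟨s3, t3, e3, i3, r3, ht3⟩ := hstep (B - (j + 1)) (by omega) s2'
      (by
        rw [show B - (j + 1) + 1 = B - j by omega]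
        exact hI _ s' s2' hI' rfl fun r hr => hq r (by simp only [tmp] at hr; omega)
          (by simp only [tmp] at hr ⊢; omega)) hqx
      (by rw [hq 1 (by omega) (by simp only [tmp]; omega), h1])
    obtain ⟨s4, e4, m4, v4, r4⟩ := exec_moveProg O (r := tmp d) (a := 2 * x)
      (z := tmp (d + 2)) hx1 s3
    refine ⟨s4, _, _, .seq e1 <| .seq e2 <| .seq e3 e4, ⟨by simp, ?_, ?_, ?_, ?_⟩, by omega⟩
    · refine hI _ s3 s4 i3 m4 fun r hr => r4 r ?_ ?_
      all_goals (simp only [tmp] at hr ⊢; omega)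
    · rw [v4, r3 _ (by simp), hqx]
    · rw [r4 1 (by simp only [tmp]; omega) (by simp only [tmp]; omega), r3 _ (by simp),
        hq 1 (by omega) (by simp only [tmp]; omega), h1]
    · rw [r4 _ (by simp [tmp]) (by simp [tmp]), r3 _ (by simp),
        hq _ (by simp only [tmp]; omega) (by simp [tmp]), hs]
  · rintro s' k ⟨-, -, h, -⟩
    simpa using h
  · refine ⟨rfl, ?_, ?_, ?_, ?_⟩
    · refine hI _ s s2 h0 (m2.trans m1) fun r hr => ?_
      rw [r2, r1] <;> simp only [tmp] at hr ⊢ <;> omega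
    · rw [v2, r1 1 (by simp only [tmp]; omega) (by simp only [tmp]; omega), hB]; rfl
    · rw [r2 1 (by simp only [tmp]; omega) (by simp only [tmp]; omega),
        r1 1 (by simp only [tmp]; omega) (by simp only [tmp]; omega), hB]
    · rw [r2 _ (by simp only [tmp]; omega) (by simp only [tmp]; omega), v1]

/-- Temporaries form a stack: code at depth d leaves all variables and all registers below `tmp d`
alone, so operands computed earlier survive. For a fixed expression the time bound depends on B
alone, because the only loops are sums over x < B. -/
theorem Ex.exec_comp (e : Ex) : ∀ d, ∃ T, PolyBounded T ∧ ∀ (O : List Bool → List Bool) (B : ℕ)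
    (s : Config), s.reg 1 = B → ∃ s' t, Exec O (e.comp d) s s' t 0 ∧ s'.mem = s.mem ∧
      s'.reg (tmp d) = e.eval B s.vars (s.arrs B) ∧
      (∀ r, r % 2 = 0 ∨ r < tmp d → s'.reg r = s.reg r) ∧ t ≤ T B := by
  induction e with
  | c k =>
    intro d
    refine ⟨_, .const 1, fun O B s _ => ⟨_, _, .const _ _ _, rfl, ?_, fun r hr => ?_, le_rfl⟩⟩
    · simp [Config.set, Ex.eval]
    · have : r ≠ tmp d := by simp only [tmp] at hr ⊢; omega
      simp [Config.set, this]
  | v x =>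
    intro d
    refine ⟨_, .const 2, fun O B s _ => ?_⟩
    obtain ⟨s', h1, h2, h3, h4⟩ := exec_moveProg_self O (r := tmp d) (a := 2 * x)
      (by simp only [tmp]; omega) s
    exact ⟨s', 2, h1, h2, h3, fun r hr => h4 r (by simp only [tmp] at hr ⊢; omega), le_rfl⟩
  | add e f he hf =>
    intro d
    obtain ⟨T, hT, h1⟩ := he d
    obtain ⟨S, hS, h2⟩ := hf (d + 1)
    refine ⟨_, (hT.add hS).add (.const 1), fun O B s hs => ?_⟩
    obtain ⟨s1, t1, e1, m1, v1, r1, ht1⟩ := h1 O B s hs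
    obtain ⟨s2, t2, e2, m2, v2, r2, ht2⟩ := h2 O B s1 (by rw [r1 1 (by simp [tmp]), hs])
    have hv : s1.vars = s.vars := funext fun x => r1 (2 * x) (by omega)
    have ha : s1.arrs B = s.arrs B := Config.arrs_congr m1 B
    refine ⟨_, _, .seq e1 (.seq e2 (.add _ _ _ _)), m2.trans m1, ?_, fun r hr => ?_, ?_⟩
    · simp only [Config.set, Function.update_self]
      rw [v2, r2 (tmp d) (by simp [tmp]), v1, hv, ha]; rfl
    · have : r ≠ tmp d := by simp only [tmp] at hr ⊢; omega
      simp only [Config.set, Function.update_of_ne this]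
      rw [r2 r (by simp only [tmp] at hr ⊢; omega), r1 r hr]
    · omega
  | sub e f he hf =>
    intro d
    obtain ⟨T, hT, h1⟩ := he d
    obtain ⟨S, hS, h2⟩ := hf (d + 1)
    refine ⟨_, (hT.add hS).add (.const 1), fun O B s hs => ?_⟩
    obtain ⟨s1, t1, e1, m1, v1, r1, ht1⟩ := h1 O B s hs
    obtain ⟨s2, t2, e2, m2, v2, r2, ht2⟩ := h2 O B s1 (by rw [r1 1 (by simp [tmp]), hs])
    have hv : s1.vars = s.vars := funext fun x => r1 (2 * x) (by omega)
    have ha : s1.arrs B = s.arrs B := Config.arrs_congr m1 B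
    refine ⟨_, _, .seq e1 (.seq e2 (.sub _ _ _ _)), m2.trans m1, ?_, fun r hr => ?_, ?_⟩
    · simp only [Config.set, Function.update_self]
      rw [v2, r2 (tmp d) (by simp [tmp]), v1, hv, ha]; rfl
    · have : r ≠ tmp d := by simp only [tmp] at hr ⊢; omega
      simp only [Config.set, Function.update_of_ne this]
      rw [r2 r (by simp only [tmp] at hr ⊢; omega), r1 r hr]
    · omega
  | ar k e he =>
    intro d
    obtain ⟨T, hT, h1⟩ := he d
    refine ⟨_, hT.add (.const 8), fun O B s hs => ?_⟩
    obtain ⟨s1, t1, e1, m1, v1, r1, ht1⟩ := h1 O B s hs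
    obtain ⟨s2, e2, m2, v2, r2⟩ := exec_addrProg O k d s1
    have hr1 : s1.reg 1 = B := by rw [r1 1 (by simp [tmp]), hs]
    refine ⟨_, _, .seq e1 (.seq e2 (.load _ _ _)), m2.trans m1, ?_, fun r hr => ?_, ?_⟩
    · simp only [Config.set, Function.update_self]
      rw [v2, m2, m1, v1, hr1]; rfl
    · have h : r ≠ tmp d := by simp only [tmp] at hr ⊢; omega
      have h' : r ≠ tmp (d + 1) := by simp only [tmp] at hr ⊢; omega
      simp only [Config.set, Function.update_of_ne h]
      rw [r2 r h h', r1 r hr]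
    · omega
  | ite e f g he hf hg =>
    intro d
    obtain ⟨T, hT, h1⟩ := he d
    obtain ⟨S, hS, h2⟩ := hf d
    obtain ⟨U, hU, h3⟩ := hg d
    refine ⟨_, ((hT.add hS).add hU).add (.const 1), fun O B s hs => ?_⟩
    obtain ⟨s1, t1, e1, m1, v1, r1, ht1⟩ := h1 O B s hs
    have hr1 : s1.reg 1 = B := by rw [r1 1 (by simp [tmp]), hs]
    have hv : s1.vars = s.vars := funext fun x => r1 (2 * x) (by omega)
    have ha : s1.arrs B = s.arrs B := Config.arrs_congr m1 B
    by_cases h : e.eval B s.vars (s.arrs B) = 0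
    · obtain ⟨s2, t2, e2, m2, v2, r2, ht2⟩ := h3 O B s1 hr1
      refine ⟨_, _, .seq e1 (.ite_false (v1.trans h) e2), m2.trans m1, ?_, fun r hr => ?_, ?_⟩
      · rw [v2, hv, ha]; simp [Ex.eval, h]
      · rw [r2 r hr, r1 r hr]
      · omega
    · obtain ⟨s2, t2, e2, m2, v2, r2, ht2⟩ := h2 O B s1 hr1
      refine ⟨_, _, .seq e1 (.ite_true (by rwa [v1]) e2), m2.trans m1, ?_, fun r hr => ?_, ?_⟩
      · rw [v2, hv, ha]; simp [Ex.eval, h]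
      · rw [r2 r hr, r1 r hr]
      · omega
  | sum x e he =>
    intro d
    obtain ⟨T, hT, h1⟩ := he (d + 4)
    refine ⟨_, (PolyBounded.id.mul (hT.add (.const 6))).add (.const 8), fun O B s hs => ?_⟩
    have e0 := Exec.const (O := O) (tmp d) 0 s
    have hl := exec_downProg (O := O) (x := x) (d := d + 1)
      (B := B) (T := T B + 1) (p := .seq (e.comp (d + 4)) (.add (tmp d) (tmp d) (tmp (d + 4))))
      -- The loop runs downwards, so the accumulator holds the terms from j on; adding the missing
      -- terms below j always gives the full sum.
      (fun j s' => s'.mem = s.mem ∧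
        s'.reg (tmp d) + ∑ i ∈ Finset.range j, e.eval B (Function.update s.vars x i) (s.arrs B) =
          ∑ i ∈ Finset.range B, e.eval B (Function.update s.vars x i) (s.arrs B) ∧
        ∀ r, r ≠ 2 * x ∧ (r % 2 = 0 ∨ r < tmp d) → s'.reg r = s.reg r) ?_ ?_
        (s := s.set (tmp d) 0) ?_ ?_
    · obtain ⟨s', t, e1, ⟨hm, hsum, hr⟩, hb, hx, ht⟩ := hl
      refine ⟨s', _, .seq e0 e1, hm, by simpa [Ex.eval] using hsum, fun r hr' => ?_, ?_⟩
      · by_cases h : r = 2 * x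
        · subst h
          rw [hx]
          have : 2 * x ≠ tmp d := by simp only [tmp]; omega
          simp [Config.set, this]
        · exact hr r ⟨h, hr'⟩
      · have : B * (T B + 1 + 5) = B * (T B + 6) := rfl
        omega
    · rintro j s1 s2 ⟨h1, h2, h3⟩ hm hr
      refine ⟨hm.trans h1, ?_, fun r hr' => ?_⟩
      · rwa [hr (tmp d) (by simp only [tmp]; omega)]
      · rw [hr r (by simp only [tmp] at hr' ⊢; omega), h3 r hr']
    · rintro j hj s1 ⟨hm, hsum, hr⟩ hx hb
      obtain ⟨s2, t2, e2, m2, v2, r2, ht2⟩ := h1 O B s1 hb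
      have hv : s1.vars = Function.update s.vars x j := by
        funext y
        by_cases h : y = x
        · subst h; simp [Config.vars, hx]
        · rw [Function.update_of_ne h]; exact hr _ (by omega)
      have ha : s1.arrs B = s.arrs B := Config.arrs_congr hm B
      have hne : ∀ r, r ≠ tmp d → r % 2 = 0 ∨ r < tmp (d + 4) →
          (s2.set (tmp d) (s2.reg (tmp d) + s2.reg (tmp (d + 4)))).reg r = s1.reg r := by
        intro r h h'
        simp only [Config.set, Function.update_of_ne h]
        exact r2 r h'
      refine ⟨_, _, .seq e2 (.add _ _ _ _), ⟨m2.trans hm, ?_, fun r hr' => ?_⟩, fun r hr' => ?_, ?_⟩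
      · rw [← hsum, Finset.sum_range_succ]
        simp only [Config.set, Function.update_self]
        rw [v2, r2 (tmp d) (by simp only [tmp]; omega), hv, ha]
        omega
      · rw [hne r (by simp only [tmp] at hr' ⊢; omega) (by simp only [tmp] at hr' ⊢; omega)]
        exact hr r hr'
      · exact hne r (by simp only [tmp] at hr' ⊢; omega) (by simp only [tmp] at hr' ⊢; omega)
      · omega
    · have : 1 ≠ tmp d := by simp [tmp]
      simp [Config.set, hs]
    · refine ⟨rfl, by simp [Config.set], fun r hr => ?_⟩
      have : r ≠ tmp d := by simp only [tmp] at hr ⊢; omega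
      simp [Config.set, this]

end SplitUIG

namespace SplitUIG

/-! ### Commands -/

/-- Fill the scratch area with the values of `e` at `x = 0, …, B - 1`. -/
def fillProg (x : ℕ) (e : Ex) (d : ℕ) : Prog :=
  downProg x d <| .seq (e.comp (d + 3)) (.store (2 * x) (tmp (d + 3)))

/-- Copy the scratch area to the first `B` entries of the array `k`. -/
def dumpProg (k : Fin 16) (x d : ℕ) : Prog :=
  downProg x d <| .seq (.load (tmp (d + 3)) (2 * x)) <|
    .seq (moveProg (tmp (d + 4)) (2 * x) (tmp (d + 4))) <|
    .seq (addrProg k (d + 4)) (.store (tmp (d + 4)) (tmp (d + 3)))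

/-- Values are written while later ones are still to be computed. This is harmless: the writes stay
below the address B, and an expression reads memory only through the arrays, which lie above it. -/
theorem exec_fillProg (x : ℕ) (e : Ex) (d : ℕ) : ∃ T, PolyBounded T ∧
    ∀ (O : List Bool → List Bool) (B : ℕ) (s : Config), s.reg 1 = B →
      ∃ s' t, Exec O (fillProg x e d) s s' t 0 ∧
        (∀ i, s'.mem i =
          if i < B then e.eval B (Function.update s.vars x i) (s.arrs B) else s.mem i) ∧
        (∀ r, r % 2 = 0 ∨ r < tmp d → s'.reg r = s.reg r) ∧ t ≤ T B := by
  obtain ⟨T, hT, h1⟩ := e.exec_comp (d + 3)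
  refine ⟨_, (PolyBounded.id.mul (hT.add (.const 6))).add (.const 7), fun O B s hs => ?_⟩
  have hl := exec_downProg (O := O) (x := x) (d := d) (B := B) (T := T B + 1)
    (p := .seq (e.comp (d + 3)) (.store (2 * x) (tmp (d + 3))))
    (fun j s' => (∀ i, s'.mem i = if j ≤ i ∧ i < B then
        e.eval B (Function.update s.vars x i) (s.arrs B) else s.mem i) ∧
      ∀ r, r ≠ 2 * x ∧ (r % 2 = 0 ∨ r < tmp d) → s'.reg r = s.reg r) ?_ ?_ hs ?_
  · obtain ⟨s', t, e1, ⟨hm, hr⟩, hb, hx, ht⟩ := hl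
    refine ⟨s', t, e1, fun i => by simpa using hm i, fun r hr' => ?_, ?_⟩
    · by_cases h : r = 2 * x
      · rw [h, hx]
      · exact hr r ⟨h, hr'⟩
    · have : B * (T B + 1 + 5) = B * (T B + 6) := rfl
      omega
  · rintro j s1 s2 ⟨h2, h3⟩ hm hr
    refine ⟨fun i => by rw [hm, h2], fun r hr' => ?_⟩
    rw [hr r (by simp only [tmp] at hr' ⊢; omega), h3 r hr']
  · rintro j hj s1 ⟨hm, hr⟩ hx hb
    obtain ⟨s2, t2, e2, m2, v2, r2, ht2⟩ := h1 O B s1 hb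
    have hv : s1.vars = Function.update s.vars x j := by
      funext y
      by_cases h : y = x
      · subst h; simp [Config.vars, hx]
      · rw [Function.update_of_ne h]; exact hr _ (by omega)
    have ha : s1.arrs B = s.arrs B := by
      funext k i
      simp only [Config.arrs, hm]
      rw [if_neg (by omega)]
    refine ⟨_, _, .seq e2 (.store _ _ _), ⟨fun i => ?_, fun r hr' => ?_⟩, fun r hr' => ?_, ?_⟩
    · simp only
      rw [v2, hv, ha, r2 (2 * x) (by omega), hx, m2]
      by_cases h : i = j
      · subst h; simp [hj]
      · rw [Function.update_of_ne h, hm]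
        refine if_congr ?_ rfl rfl
        omega
    · rw [← hr r hr']
      exact r2 r (by simp only [tmp] at hr' ⊢; omega)
    · exact r2 r (by simp only [tmp] at hr' ⊢; omega)
    · omega
  · exact ⟨fun i => by rw [if_neg (by omega)], fun r _ => rfl⟩

/-- Used after `exec_fillProg`, this makes an array assignment simultaneous: all new values are in
the scratch area before the first old entry is overwritten. -/
theorem exec_dumpProg (k : Fin 16) (x d : ℕ) : ∃ T, PolyBounded T ∧
    ∀ (O : List Bool → List Bool) (B : ℕ) (s : Config), s.reg 1 = B →
      ∃ s' t, Exec O (dumpProg k x d) s s' t 0 ∧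
        s'.arrs B = Function.update (s.arrs B) k
          (fun i => if i < B then s.mem i else s.arrs B k i) ∧
        (∀ r, r % 2 = 0 ∨ r < tmp d → s'.reg r = s.reg r) ∧ t ≤ T B := by
  refine ⟨_, (PolyBounded.id.mul (.const 16)).add (.const 7), fun O B s hs => ?_⟩
  have hl := exec_downProg (O := O) (x := x) (d := d) (B := B) (T := 11)
    (p := .seq (.load (tmp (d + 3)) (2 * x)) <|
      .seq (moveProg (tmp (d + 4)) (2 * x) (tmp (d + 4))) <|
      .seq (addrProg k (d + 4)) (.store (tmp (d + 4)) (tmp (d + 3))))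
    (fun j s' => (∀ q < B, s'.mem q = s.mem q) ∧
      (∀ k' i, s'.arrs B k' i = if k' = k ∧ j ≤ i ∧ i < B then s.mem i else s.arrs B k' i) ∧
      ∀ r, r ≠ 2 * x ∧ (r % 2 = 0 ∨ r < tmp d) → s'.reg r = s.reg r) ?_ ?_ hs ?_
  · obtain ⟨s', t, e1, ⟨-, hm, hr⟩, hb, hx, ht⟩ := hl
    refine ⟨s', t, e1, ?_, fun r hr' => ?_, ht⟩
    · funext k' i
      rw [hm]
      by_cases h : k' = k
      · subst h; simp
      · simp [h]
    · by_cases h : r = 2 * x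
      · rw [h, hx]
      · exact hr r ⟨h, hr'⟩
  · rintro j s1 s2 ⟨h1, h2, h3⟩ hm hr
    refine ⟨fun q hq => by rw [hm, h1 q hq], fun k' i => ?_, fun r hr' => ?_⟩
    · rw [Config.arrs_congr hm, h2]
    · rw [hr r (by simp only [tmp] at hr' ⊢; omega), h3 r hr']
  · rintro j hj s1 ⟨hlow, hm, hr⟩ hx hb
    have e1 := Exec.load (O := O) (tmp (d + 3)) (2 * x) s1
    set s2 := s1.set (tmp (d + 3)) (s1.mem (s1.reg (2 * x))) with hs2
    have v1 : s2.reg (tmp (d + 3)) = s.mem j := by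
      simp [hs2, Config.set, hx, hlow j hj]
    have r1 : ∀ r, r ≠ tmp (d + 3) → s2.reg r = s1.reg r := fun r h => by
      simp only [hs2, Config.set, Function.update_of_ne h]
    obtain ⟨s3, e3, m3, v3, r3⟩ := exec_moveProg_self O (r := tmp (d + 4)) (a := 2 * x)
      (by simp only [tmp]; omega) s2
    obtain ⟨s4, e4, m4, v4, r4⟩ := exec_addrProg O k (d + 4) s3
    have hm4 : s4.mem = s1.mem := by rw [m4, m3]; rfl
    have hreg : ∀ r, r = 1 ∨ r % 2 = 0 ∨ r < tmp (d + 3) → s4.reg r = s1.reg r := by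
      intro r hr'
      rw [r4 r (by simp only [tmp] at hr' ⊢; omega) (by simp only [tmp] at hr' ⊢; omega),
        r3 r (by simp only [tmp] at hr' ⊢; omega), r1 r (by simp only [tmp] at hr' ⊢; omega)]
    have haddr : s4.reg (tmp (d + 4)) = B + 16 * j + k := by
      rw [v4, v3, r3 1 (by simp only [tmp]; omega), r1 1 (by simp only [tmp]; omega), hb,
        r1 (2 * x) (by simp only [tmp]; omega), hx]
    have hval : s4.reg (tmp (d + 3)) = s.mem j := by
      rw [r4 _ (by simp only [tmp]; omega) (by simp only [tmp]; omega),
        r3 _ (by simp only [tmp]; omega), v1]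
    refine ⟨_, _, .seq e1 <| .seq e3 <| .seq e4 (.store _ _ _),
      ⟨fun q hq => ?_, fun k' i => ?_, fun r hr' => ?_⟩, fun r hr' => ?_, by omega⟩
    · simp only [haddr]
      rw [Function.update_of_ne (by omega), hm4, hlow q hq]
    · simp only [haddr, hval, Config.arrs, hm4]
      by_cases h : k' = k ∧ i = j
      · obtain ⟨rfl, rfl⟩ := h
        simp [hj]
      -- Both array numbers are below 16, so an address determines array and index.
      · have hne : B + 16 * i + (k' : ℕ) ≠ B + 16 * j + k := by
          intro h'
          apply h
          rw [Fin.ext_iff]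
          omega
        rw [Function.update_of_ne hne]
        refine (hm k' i).trans (if_congr ?_ rfl rfl)
        have : k' = k → i ≠ j := fun h1 h2 => h ⟨h1, h2⟩
        constructor
        · rintro ⟨h1, h2⟩
          exact ⟨h1, by omega⟩
        · rintro ⟨h1, h2⟩
          have := this h1
          exact ⟨h1, by omega⟩
    · rw [← hr r hr']
      exact hreg r (by simp only [tmp] at hr' ⊢; omega)
    · exact hreg r (by simp only [tmp] at hr' ⊢; omega)
  · exact ⟨fun q _ => rfl, fun k' i => by rw [if_neg (by omega)], fun r _ => rfl⟩

/-- States: the variables, the arrays, and the number of oracle calls made. -/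
@[ext]
structure St where
  v : ℕ → ℕ
  a : Fin 16 → ℕ → ℕ
  calls : ℕ

/-- The state shown by a configuration. -/
def Config.view (s : Config) (B n : ℕ) : St :=
  ⟨s.vars, s.arrs B, n⟩

/-- Commands. -/
inductive Cmd where
  | setv (x : ℕ) (e : Ex)
  /-- assign `e` to the array entries with index `x < B`, simultaneously -/
  | seta (k : Fin 16) (x : ℕ) (e : Ex)
  /-- ask the oracle the word with cells `e`, and put the cells of the answer into an array -/
  | ask (k : Fin 16) (x : ℕ) (e : Ex)
  | seq (p q : Cmd)
  | ite (e : Ex) (p q : Cmd)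
  /-- run `p` for all `x < min e B` -/
  | loop (x : ℕ) (e : Ex) (p : Cmd)

/-- Apply `f 0`, …, `f (m - 1)`. -/
def iter {σ : Type*} (f : ℕ → σ → σ) : ℕ → σ → σ
  | 0, s => s
  | m + 1, s => f m (iter f m s)

/-- The meaning of a command. -/
def Cmd.run (O : List Bool → List Bool) (B : ℕ) : Cmd → St → St
  | .setv x e, s => ⟨Function.update s.v x (e.eval B s.v s.a), s.a, s.calls⟩
  | .seta k x e, s => ⟨s.v, Function.update s.a k fun i =>
      if i < B then e.eval B (Function.update s.v x i) s.a else s.a k i, s.calls⟩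
  | .ask k x e, s => ⟨s.v, Function.update s.a k fun i =>
      if i < B then
        writeWord (fun j => e.eval B (Function.update s.v x j) s.a) 0
          (O (readWord (fun j => e.eval B (Function.update s.v x j) s.a) 0)) i
      else s.a k i, s.calls + 1⟩
  | .seq p q, s => q.run O B (p.run O B s)
  | .ite e p q, s => if e.eval B s.v s.a ≠ 0 then p.run O B s else q.run O B s
  | .loop x e p, s => iter (fun j s => p.run O B ⟨Function.update s.v x j, s.a, s.calls⟩)
      (min (e.eval B s.v s.a) B) s

/-- All questions asked by a command, and the answers to them, fit into the scratch area. -/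
def Cmd.Safe (O : List Bool → List Bool) : Cmd → Prop
  | .setv _ _ => True
  | .seta _ _ _ => True
  | .ask _ x e => ∀ B, 2 ≤ B → ∀ v a, e.eval B (Function.update v x 0) a < B ∧
      (O (readWord (fun j => e.eval B (Function.update v x j) a) 0)).length < B
  | .seq p q => p.Safe O ∧ q.Safe O
  | .ite _ p q => p.Safe O ∧ q.Safe O
  | .loop _ _ p => p.Safe O

/-- The compiler. -/
def Cmd.comp : Cmd → ℕ → Prog
  | .setv x e, d => .seq (e.comp d) (moveProg (2 * x) (tmp d) (tmp (d + 1)))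
  | .seta k x e, d => .seq (fillProg x e d) (dumpProg k x d)
  | .ask k x e, d => .seq (fillProg x e d) <| .seq (.const (tmp d) 0) <|
      .seq (.call (tmp d) (tmp d)) (dumpProg k x d)
  | .seq p q, d => .seq (p.comp d) (q.comp d)
  | .ite e p q, d => .seq (e.comp d) (.ite (tmp d) (p.comp d) (q.comp d))
  | .loop x e p, d => .seq (e.comp d) <|
      .seq (.sub (tmp (d + 1)) (tmp d) 1) <| .seq (.sub (tmp d) (tmp d) (tmp (d + 1))) <|
      .seq (.const (tmp (d + 1)) 0) <| .seq (.sub (tmp (d + 2)) (tmp d) (tmp (d + 1))) <|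
      .loop (tmp (d + 2)) <| .seq (moveProg (2 * x) (tmp (d + 1)) (tmp (d + 3))) <|
        .seq (p.comp (d + 3)) <| .seq (.const (tmp (d + 3)) 1) <|
        .seq (.add (tmp (d + 1)) (tmp (d + 1)) (tmp (d + 3)))
          (.sub (tmp (d + 2)) (tmp d) (tmp (d + 1)))

/-! ### Correctness and running time of compiled commands -/

theorem readWord_congr {m m' : ℕ → ℕ} {a : ℕ} (h : ∀ i, a ≤ i → i ≤ a + m a → m i = m' i) :
    readWord m a = readWord m' a := by
  unfold readWord
  rw [← h a le_rfl (by omega)]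
  refine List.map_congr_left fun i hi => ?_
  rw [List.mem_range] at hi
  rw [h (a + 1 + i) (by omega) (by omega)]

theorem length_readWord (m : ℕ → ℕ) (a : ℕ) : (readWord m a).length = m a := by
  simp [readWord]

/-- A command may change any variable, so only the odd registers below `tmp d` are guaranteed; these
include the bound B and the counters of enclosing loops. The quantifier over n lets the call counter
of the state start anywhere, so that counts add up along sequences and loops. -/
theorem Cmd.exec_comp (p : Cmd) : ∀ d, ∃ T, PolyBounded T ∧ ∀ (O : List Bool → List Bool) (B : ℕ)
    (s : Config), p.Safe O → 2 ≤ B → s.reg 1 = B → ∃ s' t c, Exec O (p.comp d) s s' t c ∧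
      (∀ n, s'.view B (n + c) = p.run O B (s.view B n)) ∧
      (∀ r, r % 2 = 1 → r < tmp d → s'.reg r = s.reg r) ∧ t ≤ T B := by
  induction p with
  | setv x e =>
    intro d
    obtain ⟨T, hT, h1⟩ := e.exec_comp d
    refine ⟨_, hT.add (.const 2), fun O B s _ _ hs => ?_⟩
    obtain ⟨s1, t1, e1, m1, v1, r1, ht1⟩ := h1 O B s hs
    obtain ⟨s2, e2, m2, v2, r2⟩ := exec_moveProg O (r := 2 * x) (a := tmp d) (z := tmp (d + 1))
      (by simp only [tmp]; omega) s1
    refine ⟨s2, _, _, .seq e1 e2, fun n => ?_, fun r h h' => ?_, by omega⟩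
    · refine St.ext ?_ (Config.arrs_congr (m2.trans m1) B) rfl
      funext y
      by_cases h : y = x
      · subst h
        simp only [Cmd.run, Config.view, Function.update_self]
        rw [← v1, ← v2]; rfl
      · simp only [Cmd.run, Config.view, Function.update_of_ne h, Config.vars]
        rw [r2 _ (by omega) (by simp only [tmp]; omega), r1 _ (by omega)]
    · rw [r2 _ (by omega) (by simp only [tmp] at h' ⊢; omega), r1 _ (by omega)]
  | seta k x e =>
    intro d
    obtain ⟨T, hT, h1⟩ := exec_fillProg x e d
    obtain ⟨S, hS, h2⟩ := exec_dumpProg k x d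
    refine ⟨_, hT.add hS, fun O B s _ _ hs => ?_⟩
    obtain ⟨s1, t1, e1, m1, r1, ht1⟩ := h1 O B s hs
    have ha : s1.arrs B = s.arrs B := by
      funext k i
      simp only [Config.arrs, m1]
      rw [if_neg (by omega)]
    obtain ⟨s2, t2, e2, m2, r2, ht2⟩ := h2 O B s1 (by rw [r1 1 (by simp [tmp]), hs])
    refine ⟨s2, _, _, .seq e1 e2, fun n => ?_, fun r h h' => ?_, by omega⟩
    · refine St.ext ?_ ?_ rfl
      · funext y
        exact (r2 _ (by omega)).trans (r1 _ (by omega))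
      · simp only [Cmd.run, Config.view]
        rw [m2, ha]
        congr 1
        funext i
        split_ifs with h
        · rw [m1, if_pos h]
        · rfl
    · rw [r2 r (.inr h'), r1 r (.inr h')]
  | ask k x e =>
    intro d
    obtain ⟨T, hT, h1⟩ := exec_fillProg x e d
    obtain ⟨S, hS, h2⟩ := exec_dumpProg k x d
    refine ⟨_, (hT.add hS).add ((PolyBounded.id.mul (.const 2)).add (.const 2)),
      fun O B s hsafe hB hs => ?_⟩
    obtain ⟨s1, t1, e1, m1, r1, ht1⟩ := h1 O B s hs
    have ha : s1.arrs B = s.arrs B := by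
      funext k i
      simp only [Config.arrs, m1]
      rw [if_neg (by omega)]
    set q : ℕ → ℕ := fun j => e.eval B (Function.update s.vars x j) (s.arrs B) with hq
    obtain ⟨hq1, hq2⟩ := hsafe B hB s.vars (s.arrs B)
    change q 0 < B at hq1
    change (O (readWord q 0)).length < B at hq2
    have hread : readWord s1.mem 0 = readWord q 0 := by
      have h0 : s1.mem 0 = q 0 := by rw [m1, if_pos (by omega)]
      refine readWord_congr fun i _ hi => ?_
      rw [m1, if_pos (by omega)]
    have e2 := Exec.const (O := O) (tmp d) 0 s1
    have e3 := Exec.call (O := O) (tmp d) (tmp d) (s1.set (tmp d) 0)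
    have hreg : (s1.set (tmp d) 0).reg (tmp d) = 0 := by simp [Config.set]
    have hmem : (s1.set (tmp d) 0).mem = s1.mem := rfl
    rw [hreg, hmem, hread, length_readWord] at e3
    set s3 : Config := ⟨(s1.set (tmp d) 0).reg, writeWord s1.mem 0 (O (readWord q 0))⟩ with hs3
    have r3 : ∀ r, r ≠ tmp d → s3.reg r = s1.reg r := fun r h => by
      simp only [hs3, Config.set, Function.update_of_ne h]
    have hs3' : s3.reg 1 = B := by rw [r3 1 (by simp [tmp]), r1 1 (by simp [tmp]), hs]
    -- By `Cmd.Safe` the answer is shorter than B, so with its length cell it stays inside the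
    -- scratch area.
    have ha3 : s3.arrs B = s.arrs B := by
      rw [← ha]
      funext k i
      simp only [hs3, Config.arrs, writeWord]
      rw [if_neg (by omega), if_neg (by omega)]
    obtain ⟨s4, t4, e4, m4, r4, ht4⟩ := h2 O B s3 hs3'
    refine ⟨s4, _, _, .seq e1 <| .seq e2 <| .seq e3 e4, fun n => ?_, fun r h h' => ?_, by omega⟩
    · refine St.ext ?_ ?_ rfl
      · funext y
        exact (r4 _ (by omega)).trans ((r3 _ (by simp only [tmp]; omega)).trans (r1 _ (by omega)))
      · simp only [Cmd.run, Config.view]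
        rw [m4, ha3]
        congr 1
        funext i
        split_ifs with h
        · simp only [hs3, writeWord, m1, if_pos h]
          rfl
        · rfl
    · rw [r4 r (.inr h'), r3 r (by omega), r1 r (.inr h')]
  | seq p q hp hq =>
    intro d
    obtain ⟨T, hT, h1⟩ := hp d
    obtain ⟨S, hS, h2⟩ := hq d
    refine ⟨_, hT.add hS, fun O B s hsafe hB hs => ?_⟩
    obtain ⟨s1, t1, c1, e1, v1, r1, ht1⟩ := h1 O B s hsafe.1 hB hs
    obtain ⟨s2, t2, c2, e2, v2, r2, ht2⟩ := h2 O B s1 hsafe.2 hB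
      (by rw [r1 1 (by simp) (by simp [tmp]), hs])
    refine ⟨s2, _, _, .seq e1 e2, fun n => ?_, fun r h h' => ?_, by omega⟩
    · rw [← Nat.add_assoc, v2, v1]; rfl
    · rw [r2 r h h', r1 r h h']
  | ite e p q hp hq =>
    intro d
    obtain ⟨U, hU, h0⟩ := e.exec_comp d
    obtain ⟨T, hT, h1⟩ := hp d
    obtain ⟨S, hS, h2⟩ := hq d
    refine ⟨_, (hU.add (hT.add hS)).add (.const 1), fun O B s hsafe hB hs => ?_⟩
    obtain ⟨s1, t1, e1, m1, v1, r1, ht1⟩ := h0 O B s hs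
    have hr1 : s1.reg 1 = B := by rw [r1 1 (by simp [tmp]), hs]
    have hview : ∀ n, s1.view B n = s.view B n := fun n =>
      St.ext (funext fun x => r1 (2 * x) (by omega)) (Config.arrs_congr m1 B) rfl
    by_cases h : e.eval B s.vars (s.arrs B) = 0
    · obtain ⟨s2, t2, c2, e2, v2, r2, ht2⟩ := h2 O B s1 hsafe.2 hB hr1
      refine ⟨s2, _, _, .seq e1 (.ite_false (v1.trans h) e2), fun n => ?_, fun r h' h'' => ?_,
        by omega⟩
      · rw [Nat.zero_add, v2, hview]
        exact (if_neg (not_not.2 h)).symm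
      · rw [r2 r h' h'', r1 r (.inr h'')]
    · obtain ⟨s2, t2, c2, e2, v2, r2, ht2⟩ := h1 O B s1 hsafe.1 hB hr1
      refine ⟨s2, _, _, .seq e1 (.ite_true (by rwa [v1]) e2), fun n => ?_, fun r h' h'' => ?_,
        by omega⟩
      · rw [Nat.zero_add, v2, hview]
        exact (if_pos h).symm
      · rw [r2 r h' h'', r1 r (.inr h'')]
  | loop x e p hp =>
    intro d
    obtain ⟨U, hU, h0⟩ := e.exec_comp d
    obtain ⟨T, hT, h1⟩ := hp (d + 3)
    refine ⟨_, hU.add ((PolyBounded.id.mul (hT.add (.const 6))).add (.const 5)),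
      fun O B s hsafe hB hs => ?_⟩
    obtain ⟨s1, t1, e1, m1, v1, r1, ht1⟩ := h0 O B s hs
    have hr1 : s1.reg 1 = B := by rw [r1 1 (by simp [tmp]), hs]
    have hview : ∀ n, s1.view B n = s.view B n := fun n =>
      St.ext (funext fun x => r1 (2 * x) (by omega)) (Config.arrs_congr m1 B) rfl
    -- The minimum of e and B is e - (e - B) in truncated subtraction.
    have e2 := Exec.sub (O := O) (tmp (d + 1)) (tmp d) 1 s1
    have e3 := Exec.sub (O := O) (tmp d) (tmp d) (tmp (d + 1))
      (s1.set (tmp (d + 1)) (s1.reg (tmp d) - s1.reg 1))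
    set s3 := (s1.set (tmp (d + 1)) (s1.reg (tmp d) - s1.reg 1)).set (tmp d)
      ((s1.set (tmp (d + 1)) (s1.reg (tmp d) - s1.reg 1)).reg (tmp d) -
        (s1.set (tmp (d + 1)) (s1.reg (tmp d) - s1.reg 1)).reg (tmp (d + 1))) with hs3
    have e4 := Exec.const (O := O) (tmp (d + 1)) 0 s3
    have e5 := Exec.sub (O := O) (tmp (d + 2)) (tmp d) (tmp (d + 1)) (s3.set (tmp (d + 1)) 0)
    set s5 := (s3.set (tmp (d + 1)) 0).set (tmp (d + 2))
      ((s3.set (tmp (d + 1)) 0).reg (tmp d) - (s3.set (tmp (d + 1)) 0).reg (tmp (d + 1))) with hs5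
    set m := min (e.eval B s.vars (s.arrs B)) B with hm
    have n1 : tmp d ≠ tmp (d + 1) := by simp [tmp]
    have n2 : tmp d ≠ tmp (d + 2) := by simp [tmp]
    have n3 : tmp (d + 1) ≠ tmp (d + 2) := by simp [tmp]
    have r5 : ∀ r, r ≠ tmp d → r ≠ tmp (d + 1) → r ≠ tmp (d + 2) → s5.reg r = s1.reg r := by
      intro r h1 h2 h3
      simp only [hs5, hs3, Config.set, Function.update_of_ne h1, Function.update_of_ne h2,
        Function.update_of_ne h3]
    have v3 : s3.reg (tmp d) = m := by
      simp only [hs3, Config.set, Function.update_self, Function.update_of_ne n1, v1, hr1, hm]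
      omega
    have v5 : s5.reg (tmp d) = m := by
      rw [← v3]
      simp only [hs5, Config.set, Function.update_of_ne n1, Function.update_of_ne n2]
    have v5' : s5.reg (tmp (d + 1)) = 0 := by
      simp only [hs5, Config.set, Function.update_of_ne n3, Function.update_self]
    have v5'' : s5.reg (tmp (d + 2)) = m := by
      simp only [hs5, Config.set, Function.update_of_ne n1, Function.update_self, v3]
      omega
    have hl := Exec.loop_count (O := O) (r := tmp (d + 2)) (m := m) (T := T B + 5)
      (p := .seq (moveProg (2 * x) (tmp (d + 1)) (tmp (d + 3))) <|
        .seq (p.comp (d + 3)) <| .seq (.const (tmp (d + 3)) 1) <|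
        .seq (.add (tmp (d + 1)) (tmp (d + 1)) (tmp (d + 3)))
          (.sub (tmp (d + 2)) (tmp d) (tmp (d + 1))))
      (fun j s' k => (∀ n, s'.view B (n + k) =
          iter (fun j s => p.run O B ⟨Function.update s.v x j, s.a, s.calls⟩) j (s.view B n)) ∧
        s'.reg (tmp d) = m ∧ s'.reg (tmp (d + 1)) = j ∧ s'.reg (tmp (d + 2)) = m - j ∧
        ∀ r, r % 2 = 1 → r < tmp d → s'.reg r = s.reg r) (s := s5) (k := 0) ?_ ?_ ?_
    · obtain ⟨s6, t6, c6, e6, ⟨hv, -, -, -, hr⟩, ht6⟩ := hl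
      refine ⟨s6, _, _, .seq e1 <| .seq e2 <| .seq e3 <| .seq e4 <| .seq e5 e6, fun n => ?_, hr, ?_⟩
      · rw [show 0 + (0 + (0 + (0 + (0 + c6)))) = 0 + c6 by omega, hv]
        rfl
      · have : m * (T B + 5 + 1) ≤ B * (T B + 6) := Nat.mul_le_mul (by omega) le_rfl
        omega
    · rintro j hj s6 k ⟨hv, h2, h3, h4, h5⟩
      refine ⟨by omega, ?_⟩
      -- The loop variable is refreshed from a protected counter in each round, so the body is free
      -- to overwrite it.
      obtain ⟨s7, e7, m7, v7, r7⟩ := exec_moveProg O (r := 2 * x) (a := tmp (d + 1))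
        (z := tmp (d + 3)) (by simp [tmp]) s6
      obtain ⟨s8, t8, c8, e8, v8, r8, ht8⟩ := h1 O B s7 hsafe hB (by
        rw [r7 1 (by omega) (by simp only [tmp]; omega), h5 1 (by simp) (by simp [tmp]), hs])
      have e9 := Exec.const (O := O) (tmp (d + 3)) 1 s8
      have e10 := Exec.add (O := O) (tmp (d + 1)) (tmp (d + 1)) (tmp (d + 3))
        (s8.set (tmp (d + 3)) 1)
      set s10 := (s8.set (tmp (d + 3)) 1).set (tmp (d + 1))
        ((s8.set (tmp (d + 3)) 1).reg (tmp (d + 1)) + (s8.set (tmp (d + 3)) 1).reg (tmp (d + 3)))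
        with hs10
      have e11 := Exec.sub (O := O) (tmp (d + 2)) (tmp d) (tmp (d + 1)) s10
      have n4 : tmp (d + 1) ≠ tmp (d + 3) := by simp [tmp]
      have n5 : tmp d ≠ tmp (d + 3) := by simp [tmp]
      have hfr : ∀ r, r % 2 = 1 → r < tmp (d + 3) → s8.reg r = s6.reg r := fun r h h' => by
        rw [r8 r h h', r7 r (by omega) (by omega)]
      have hd : s10.reg (tmp d) = m := by
        simp only [hs10, Config.set, Function.update_of_ne n1, Function.update_of_ne n5]
        rw [hfr _ (by simp only [tmp]; omega) (by simp only [tmp]; omega), h2]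
      have hd1 : s10.reg (tmp (d + 1)) = j + 1 := by
        simp only [hs10, Config.set, Function.update_of_ne n4, Function.update_self]
        rw [hfr _ (by simp only [tmp]; omega) (by simp only [tmp]; omega), h3]
      refine ⟨_, _, _, .seq e7 <| .seq e8 <| .seq e9 <| .seq e10 e11,
        ⟨fun n => ?_, ?_, ?_, ?_, fun r h h' => ?_⟩, by omega⟩
      · have h8 : s8.view B (n + k + c8) =
            iter (fun j s => p.run O B ⟨Function.update s.v x j, s.a, s.calls⟩) (j + 1)
              (s.view B n) := by
          rw [v8, iter, ← hv]
          congr 1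
          refine St.ext ?_ (Config.arrs_congr m7 B) rfl
          funext y
          by_cases h : y = x
          · subst h
            simp only [Config.view, Function.update_self, Config.vars, v7, h3]
          · simp only [Config.view, Function.update_of_ne h, Config.vars]
            exact r7 _ (by omega) (by simp only [tmp]; omega)
        rw [show n + (k + (0 + (c8 + (0 + (0 + 0))))) = n + k + c8 by omega, ← h8]
        refine St.ext (funext fun y => ?_) rfl rfl
        have n6 : 2 * y ≠ tmp (d + 1) := by simp only [tmp]; omega
        have n7 : 2 * y ≠ tmp (d + 2) := by simp only [tmp]; omega
        have n8 : 2 * y ≠ tmp (d + 3) := by simp only [tmp]; omega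
        simp only [hs10, Config.view, Config.vars, Config.set, Function.update_of_ne n6,
          Function.update_of_ne n7, Function.update_of_ne n8]
      · simp only [Config.set, Function.update_of_ne n2]
        exact hd
      · simp only [Config.set, Function.update_of_ne n3]
        exact hd1
      · simp only [Config.set, Function.update_self, hd, hd1]
      · have n6 : r ≠ tmp (d + 1) := by simp only [tmp] at h' ⊢; omega
        have n7 : r ≠ tmp (d + 2) := by simp only [tmp] at h' ⊢; omega
        have n8 : r ≠ tmp (d + 3) := by simp only [tmp] at h' ⊢; omega
        rw [← h5 r h h', ← hfr r h (by simp only [tmp] at h' ⊢; omega)]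
        simp only [hs10, Config.set, Function.update_of_ne n6, Function.update_of_ne n7,
          Function.update_of_ne n8]
    · rintro s6 k ⟨-, -, -, h, -⟩
      simpa using h
    · refine ⟨fun n => ?_, v5, v5', by rw [v5'']; rfl, fun r h h' => ?_⟩
      · change s5.view B n = s.view B n
        rw [← hview n]
        refine St.ext (funext fun y => ?_) rfl rfl
        exact r5 _ (by simp only [tmp]; omega) (by simp only [tmp]; omega)
          (by simp only [tmp]; omega)
      · rw [r5 r (by simp only [tmp] at h' ⊢; omega) (by simp only [tmp] at h' ⊢; omega)
          (by simp only [tmp] at h' ⊢; omega), r1 r (.inr h')]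

end SplitUIG

/-! ### Complete programs, from the input word to the output word -/

namespace SplitUIG

/-- The state in which the cells of the input word are in the array `0`. -/
def inputSt (w : List Bool) : St :=
  ⟨fun _ => 0, Function.update (fun _ _ => 0) 0 (writeWord (fun _ => 0) 0 w), 0⟩

/-- Read the input, run a command, and write the word with cells `e` as output. -/
def Cmd.fullProg (p : Cmd) (x : ℕ) (e : Ex) : Prog :=
  .seq (.load 1 3) <| .seq (.const 3 2) <| .seq (.add 1 1 3) <|
    .seq (dumpProg 0 x 0) <| .seq (p.comp 0) (fillProg x e 0)

/-- The input with its length cell fills the addresses up to `w.length`, hence lies in the scratch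
area for B = `w.length + 2`. One dump moves it to the array 0, and a final fill writes the output
where the machine expects it. The polynomial depends neither on the oracle nor on the input. -/
theorem Cmd.outputs_fullProg (p : Cmd) (x : ℕ) (e : Ex) : ∃ P : Polynomial ℕ,
    ∀ (O : List Bool → List Bool) (w : List Bool) (s : St), p.Safe O →
      p.run O (w.length + 2) (inputSt w) = s →
      e.eval (w.length + 2) (Function.update s.v x 0) s.a < w.length + 2 →
      Outputs O (p.fullProg x e) w
        (readWord (fun i => e.eval (w.length + 2) (Function.update s.v x i) s.a) 0)
        (P.eval w.length) s.calls := by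
  obtain ⟨T, hT, h1⟩ := exec_dumpProg 0 x 0
  obtain ⟨S, hS, h2⟩ := p.exec_comp 0
  obtain ⟨U, hU, h3⟩ := exec_fillProg x e 0
  obtain ⟨P, hP⟩ := (hT.add (hS.add hU)).add (.const 3)
  refine ⟨P.comp (Polynomial.X + Polynomial.C 2), fun O w s hsafe hrun he => ?_⟩
  set B := w.length + 2 with hB
  -- Register 3 is still zero and thus addresses the cell with the input length; only afterwards
  -- does it receive the constant 2.
  have e1 := Exec.load (O := O) 1 3 (init w)
  have e2 := Exec.const (O := O) 3 2 ((init w).set 1 ((init w).mem ((init w).reg 3)))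
  have e3 := Exec.add (O := O) 1 1 3 (((init w).set 1 ((init w).mem ((init w).reg 3))).set 3 2)
  set s3 := (((init w).set 1 ((init w).mem ((init w).reg 3))).set 3 2).set 1
    ((((init w).set 1 ((init w).mem ((init w).reg 3))).set 3 2).reg 1 +
      (((init w).set 1 ((init w).mem ((init w).reg 3))).set 3 2).reg 3) with hs3
  have v3 : s3.reg 1 = B := by
    simp [hs3, Config.set, init, writeWord, hB]
  obtain ⟨s4, t4, e4, a4, r4, ht4⟩ := h1 O B s3 v3
  have hv4 : s4.view B 0 = inputSt w := by
    refine St.ext (funext fun y => ?_) ?_ rfl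
    · refine (r4 (2 * y) (by omega)).trans ?_
      have n1 : 2 * y ≠ 1 := by omega
      have n3 : 2 * y ≠ 3 := by omega
      simp [hs3, Config.set, init, inputSt, n1, n3]
    · refine a4.trans ?_
      have h0 : s3.arrs B = fun _ _ => 0 := by
        funext k i
        simp only [hs3, Config.arrs, Config.set, init, writeWord]
        rw [if_neg (by omega), if_neg (by omega)]
      rw [h0]
      simp only [inputSt]
      congr 1
      funext i
      split_ifs with h
      · rfl
      · simp only [writeWord]
        rw [if_neg (by omega), if_neg (by omega)]
  obtain ⟨s5, t5, c5, e5, v5, r5, ht5⟩ := h2 O B s4 hsafe (by omega)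
    (by rw [r4 1 (by simp [tmp]), v3])
  specialize v5 0
  rw [hv4, hrun] at v5
  obtain ⟨s6, t6, e6, m6, r6, ht6⟩ := h3 O B s5
    (by rw [r5 1 (by simp) (by simp [tmp]), r4 1 (by simp [tmp]), v3])
  have hv : s5.vars = s.v := congrArg St.v v5
  have ha : s5.arrs B = s.a := congrArg St.a v5
  have hc : c5 = s.calls := by simpa [Config.view] using congrArg St.calls v5
  rw [hv, ha] at m6
  refine ⟨s6, _, _, .seq e1 <| .seq e2 <| .seq e3 <| .seq e4 <| .seq e5 e6, ?_, ?_, by omega⟩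
  · have h0 := m6 0
    rw [if_pos (by omega)] at h0
    refine readWord_congr fun i _ hi => ?_
    rw [m6, if_pos (by omega)]
  · rw [Polynomial.eval_comp, Polynomial.eval_add, Polynomial.eval_X, Polynomial.eval_C]
    refine le_trans ?_ (hP B)
    simp only
    omega

end SplitUIG

namespace SplitUIG

/-! ### Unit interval graphs and split graphs -/

theorem Icc_inter_Icc_nonempty_iff {x y L : ℝ} (hL : 0 < L) :
    (Set.Icc x (x + L) ∩ Set.Icc y (y + L)).Nonempty ↔ x ≤ y + L ∧ y ≤ x + L := by
  constructor
  · rintro ⟨z, ⟨h1, h2⟩, h3, h4⟩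
    exact ⟨h1.trans h4, h3.trans h2⟩
  · rintro ⟨h1, h2⟩
    exact ⟨max x y, ⟨le_max_left _ _, max_le (by linarith) h2⟩,
      le_max_right _ _, max_le h1 (by linarith)⟩

theorem isUnitInterval_of_int {V : Type*} {G : SimpleGraph V} (L : ℤ) (p : V → ℤ) (hL : 0 < L)
    (h : ∀ u v, u ≠ v → (G.Adj u v ↔ p u ≤ p v + L ∧ p v ≤ p u + L)) : IsUnitInterval G := by
  refine ⟨L, fun v => p v, by exact_mod_cast hL, fun u v huv => ?_⟩
  rw [Icc_inter_Icc_nonempty_iff (by exact_mod_cast hL), h u v huv]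
  simp only
  norm_cast

/-- A role filled by at most one vertex becomes a number, with n standing for an unfilled role. This
makes the roles enumerable by loops. -/
theorem exists_index_of_unique {n : ℕ} (R : Fin n → Prop) (h : ∀ u v, R u → R v → u = v) :
    ∃ a ≤ n, ∀ v : Fin n, R v ↔ v.val = a := by
  by_cases h' : ∃ v, R v
  · obtain ⟨v, hv⟩ := h'
    refine ⟨v, v.2.le, fun u => ⟨fun hu => by rw [h u v hu hv], fun hu => ?_⟩⟩
    rwa [Fin.ext hu]
  · push Not at h'
    exact ⟨n, le_rfl, fun v => ⟨fun hv => absurd hv (h' v), fun hv => absurd v.2 (by omega)⟩⟩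

/-- In a split unit interval graph `G - T`, at most three vertices of the independent side have
neighbours: one to the left of a point common to all intervals of the clique, one that contains
it, and one to the right of it. -/
theorem exists_left_mid_right {n : ℕ} {G : SimpleGraph (Fin n)} {C : Fin n → Prop}
    (hI : ∀ u v, ¬ C u → ¬ C v → ¬ G.Adj u v)
    (hC : ∀ u v, C u → C v → u ≠ v → G.Adj u v) {T : Finset (Fin n)} {p : Fin n → ℝ} {L : ℝ}
    (hL : 0 < L)
    (hp : ∀ u v, u ∉ T → v ∉ T → u ≠ v → (G.Adj u v ↔ p u ≤ p v + L ∧ p v ≤ p u + L))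
    (hne : ∃ u, C u ∧ u ∉ T) :
    ∃ (x : ℝ) (a b c : ℕ), a ≤ n ∧ b ≤ n ∧ c ≤ n ∧
      (∀ u, C u → u ∉ T → p u ≤ x ∧ x ≤ p u + L) ∧
      (∀ v : Fin n, ((v ∉ T ∧ ¬ C v ∧ ∃ u, u ∉ T ∧ C u ∧ G.Adj v u) ∧ p v + L < x) ↔ v.val = a) ∧
      (∀ v : Fin n, ((v ∉ T ∧ ¬ C v ∧ ∃ u, u ∉ T ∧ C u ∧ G.Adj v u) ∧ p v ≤ x ∧ x ≤ p v + L) ↔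
        v.val = b) ∧
      (∀ v : Fin n, ((v ∉ T ∧ ¬ C v ∧ ∃ u, u ∉ T ∧ C u ∧ G.Adj v u) ∧ x < p v) ↔ v.val = c) := by
  classical
  -- The common point is the rightmost left endpoint in the kept clique: every other kept clique
  -- interval starts no later and meets the one starting there.
  obtain ⟨m, hm, hmax⟩ := Finset.exists_max_image (Finset.univ.filter fun u => C u ∧ u ∉ T) p
    (by obtain ⟨u, hu⟩ := hne; exact ⟨u, by simpa using hu⟩)
  simp only [Finset.mem_filter, Finset.mem_univ, true_and] at hm hmax
  have hx : ∀ u, C u → u ∉ T → p u ≤ p m ∧ p m ≤ p u + L := by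
    intro u h1 h2
    refine ⟨hmax u ⟨h1, h2⟩, ?_⟩
    by_cases h : u = m
    · subst h; linarith
    · exact ((hp u m h2 hm.2 h).1 (hC u m h1 hm.1 h)).2
  have hnot : ∀ u v, u ∉ T → v ∉ T → u ≠ v → ¬ C u → ¬ C v → p v + L < p u ∨ p u + L < p v := by
    intro u v h1 h2 h3 h4 h5
    by_contra! h
    exact hI u v h4 h5 ((hp u v h1 h2 h3).2 h)
  have htouch : ∀ v u, v ∉ T → ¬ C v → u ∉ T → C u → G.Adj v u → p v ≤ p u + L ∧ p u ≤ p v + L :=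
    fun v u h1 h2 h3 h4 h5 => (hp v u h1 h3 (fun h => h2 (h ▸ h4))).1 h5
  -- Of two disjoint intervals to the left of x, the farther one would end before x - L, where no
  -- interval of length L containing x can reach. The right side is symmetric, and two intervals
  -- containing x are not disjoint.
  obtain ⟨a, ha, ha'⟩ := exists_index_of_unique
    (fun v => (v ∉ T ∧ ¬ C v ∧ ∃ u, u ∉ T ∧ C u ∧ G.Adj v u) ∧ p v + L < p m) (by
      rintro u v ⟨⟨h1, h2, u', h3, h4, h5⟩, h6⟩ ⟨⟨k1, k2, v', k3, k4, k5⟩, k6⟩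
      by_contra hne
      have q1 := hx u' h4 h3
      have q2 := hx v' k4 k3
      have q3 := htouch u u' h1 h2 h3 h4 h5
      have q4 := htouch v v' k1 k2 k3 k4 k5
      rcases hnot u v h1 k1 hne h2 k2 with h | h <;> linarith)
  obtain ⟨b, hb, hb'⟩ := exists_index_of_unique
    (fun v => (v ∉ T ∧ ¬ C v ∧ ∃ u, u ∉ T ∧ C u ∧ G.Adj v u) ∧ p v ≤ p m ∧ p m ≤ p v + L) (by
      rintro u v ⟨⟨h1, h2, -⟩, h6⟩ ⟨⟨k1, k2, -⟩, k6⟩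
      by_contra hne
      rcases hnot u v h1 k1 hne h2 k2 with h | h <;> linarith)
  obtain ⟨c, hc, hc'⟩ := exists_index_of_unique
    (fun v => (v ∉ T ∧ ¬ C v ∧ ∃ u, u ∉ T ∧ C u ∧ G.Adj v u) ∧ p m < p v) (by
      rintro u v ⟨⟨h1, h2, u', h3, h4, h5⟩, h6⟩ ⟨⟨k1, k2, v', k3, k4, k5⟩, k6⟩
      by_contra hne
      have q1 := hx u' h4 h3
      have q2 := hx v' k4 k3
      have q3 := htouch u u' h1 h2 h3 h4 h5
      have q4 := htouch v v' k1 k2 k3 k4 k5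
      rcases hnot u v h1 k1 hne h2 k2 with h | h <;> linarith)
  exact ⟨p m, a, b, c, ha, hb, hc, hx, ha', hb', hc'⟩

theorem IsSplitPartition.mem_right_iff {V : Type*} {G : SimpleGraph V} {C I : Set V}
    (h : IsSplitPartition G C I) (v : V) : v ∈ I ↔ v ∉ C := by
  rw [← h.1.compl_eq, Set.mem_compl_iff]

theorem IsSplitPartition.adj_left {V : Type*} {G : SimpleGraph V} {C I : Set V}
    (h : IsSplitPartition G C I) (u v : V) (hu : u ∈ C) (hv : v ∈ C) (huv : u ≠ v) : G.Adj u v :=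
  h.2.1 hu hv huv

theorem IsSplitPartition.not_adj_right {V : Type*} {G : SimpleGraph V} {C I : Set V}
    (h : IsSplitPartition G C I) (u v : V) (hu : u ∉ C) (hv : v ∉ C) : ¬ G.Adj u v := by
  intro hadj
  exact h.2.2 ((h.mem_right_iff u).2 hu) ((h.mem_right_iff v).2 hv) hadj.ne hadj

/-- If there is another vertex, connectedness gives each independent vertex a neighbour, necessarily
in the clique, so for nonempty C the three roles of `exists_left_mid_right` with nothing deleted
exhaust I. If C is empty, the graph has at most one vertex. -/
theorem ncard_right_le_three {n : ℕ} {G : SimpleGraph (Fin n)} {C I : Set (Fin n)}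
    (hconn : G.Connected) (hsplit : IsSplitPartition G C I) (hG : IsUnitInterval G) :
    I.ncard ≤ 3 := by
  classical
  have htouch : ∀ v ∈ I, ∀ u, u ≠ v → ∃ w, w ∈ C ∧ G.Adj v w := by
    intro v hv u huv
    obtain ⟨w⟩ := hconn.preconnected v u
    cases w with
    | nil => exact absurd rfl huv
    | cons h _ =>
      rename_i w' _
      refine ⟨w', ?_, h⟩
      by_contra hw
      exact hsplit.not_adj_right _ _ ((hsplit.mem_right_iff v).1 hv) hw h
  by_cases hne : ∃ u, u ∈ C
  · obtain ⟨L, p, hL, hp⟩ := hG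
    obtain ⟨u, hu⟩ := hne
    obtain ⟨x, a, b, c, -, -, -, -, ha, hb, hc⟩ := exists_left_mid_right (C := fun v => v ∈ C)
      (T := ∅) (p := p) hsplit.not_adj_right hsplit.adj_left hL
      (fun u v _ _ huv => by rw [hp u v huv, Icc_inter_Icc_nonempty_iff hL]) ⟨u, hu, by simp⟩
    have hsub : I.image Fin.val ⊆ (({a, b, c} : Finset ℕ) : Set ℕ) := by
      rintro _ ⟨v, hv, rfl⟩
      have hvC := (hsplit.mem_right_iff v).1 hv
      obtain ⟨w, hw, hvw⟩ := htouch v hv u (fun h => hvC (h ▸ hu))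
      have hQ : v ∉ (∅ : Finset (Fin n)) ∧ v ∉ C ∧ ∃ u, u ∉ (∅ : Finset (Fin n)) ∧ u ∈ C ∧ G.Adj v u :=
        ⟨by simp, hvC, w, by simp, hw, hvw⟩
      rcases lt_or_ge (p v + L) x with h | h
      · simp [(ha v).1 ⟨hQ, h⟩]
      rcases lt_or_ge x (p v) with h' | h'
      · simp [(hc v).1 ⟨hQ, h'⟩]
      · simp [(hb v).1 ⟨hQ, h', h⟩]
    calc I.ncard = (I.image Fin.val).ncard := (Set.ncard_image_of_injective _ Fin.val_injective).symm
      _ ≤ (({a, b, c} : Finset ℕ) : Set ℕ).ncard := Set.ncard_le_ncard hsub (Finset.finite_toSet _)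
      _ = ({a, b, c} : Finset ℕ).card := Set.ncard_coe_finset _
      _ ≤ 3 := Finset.card_le_three
  · have h1 : I.ncard ≤ 1 := by
      rw [Set.ncard_le_one_iff]
      intro u v hu hv
      by_contra h
      obtain ⟨w, hw, -⟩ := htouch u hu v (Ne.symm h)
      exact hne ⟨w, hw⟩
    omega

/-! ### The candidate solutions

A guess consists of three indices; those that are not vertices of the independent side stand for
nothing. The index `n + 1` for the third one requests the second kind of candidates. -/

section Guess

variable (n : ℕ) (E : ℕ → ℕ → Prop) (C : ℕ → Prop)

/-- `v` is a neighbour of the vertex `a` of the independent side. -/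
def Nbr (a v : ℕ) : Prop := a < n ∧ ¬ C a ∧ E a v

/-- The vertices of the clique that a guess forces into the solution. -/
def Forced (a b c v : ℕ) : Prop :=
  C v ∧ if c = n + 1 then ¬ Nbr n E C a v ∧ ¬ Nbr n E C b v
    else (b < n ∧ ¬ C b ∧ ¬ E b v) ∨ (Nbr n E C a v ∧ Nbr n E C c v)

/-- The vertices neither forced into the solution nor guessed to be kept. -/
def Active (a b c v : ℕ) : Prop :=
  (C v ∧ ¬ Forced n E C a b c v) ∨ (¬ C v ∧ v ≠ a ∧ v ≠ b ∧ v ≠ c)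

/-- The edges between the active vertices `i` of the independent side and `j` of the clique. -/
def Bip (A : ℕ → Prop) (i j : ℕ) : Prop := ¬ C i ∧ C j ∧ A i ∧ A j ∧ E i j

/-- The bipartite graph with the edges `Bip`. -/
def bipGraph (A : ℕ → Prop) : SimpleGraph (Fin n) where
  Adj u v := Bip E C A u v ∨ Bip E C A v u
  symm := ⟨fun _ _ h => h.symm⟩
  loopless := ⟨fun _ h => by rcases h with h | h <;> exact h.1 h.2.1⟩

end Guess

theorem bipGraph_isBipartite (n : ℕ) (E : ℕ → ℕ → Prop) (C A : ℕ → Prop) :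
    (bipGraph n E C A).IsBipartite := by
  classical
  refine ⟨SimpleGraph.Coloring.mk (fun v => if C v then 0 else 1) ?_⟩
  rintro u v (h | h)
  · simp [h.1, h.2.1]
  · simp [h.1, h.2.1]

/-- The cover isolates every remaining independent vertex that is not guessed; these can be placed
far away and far from each other. Removing the forced vertices is exactly what lets the rest be
drawn with explicit integer intervals of length 4. -/
theorem isSolution_of_guess {n : ℕ} {G : SimpleGraph (Fin n)} {E : ℕ → ℕ → Prop} {C : ℕ → Prop}
    (hE : ∀ u v : Fin n, G.Adj u v ↔ E u v)
    (hI : ∀ u v : Fin n, ¬ C u → ¬ C v → ¬ G.Adj u v)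
    (hC : ∀ u v : Fin n, C u → C v → u ≠ v → G.Adj u v) {a b c : ℕ} {X S : Finset (Fin n)}
    (hX : (bipGraph n E C (Active n E C a b c)).IsVertexCover (X : Set (Fin n)))
    (hS : ∀ v, v ∈ S ↔ Forced n E C a b c v ∨ v ∈ X) : IsSolution G S := by
  classical
  -- remaining independent vertices that are not guessed are isolated
  have hiso : ∀ i j : Fin n, i ∉ S → j ∉ S → ¬ C i → C j → E i j →
      (i : ℕ) = a ∨ (i : ℕ) = b ∨ (i : ℕ) = c := by
    intro i j hi hj hCi hCj hij
    by_contra! h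
    have hF : ¬ Forced n E C a b c j := fun hF => hj ((hS j).2 (.inl hF))
    have hadj : (bipGraph n E C (Active n E C a b c)).Adj i j :=
      .inl ⟨hCi, hCj, .inr ⟨hCi, h⟩, .inl ⟨hCj, hF⟩, hij⟩
    rcases hX hadj with h | h
    · exact hi ((hS i).2 (.inr h))
    · exact hj ((hS j).2 (.inr h))
  have key : ∀ p : Fin n → ℤ,
      (∀ u v : Fin n, C u → C v → p u ≤ p v + 4) →
      (∀ u v : Fin n, u ≠ v → ¬ C u → ¬ C v → p u > p v + 4 ∨ p v > p u + 4) →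
      (∀ u v : Fin n, u ∉ S → v ∉ S → ¬ C u → C v → (E u v ↔ p u ≤ p v + 4 ∧ p v ≤ p u + 4)) →
      IsSolution G S := by
    intro p h1 h2 h3
    refine isUnitInterval_of_int 4 (fun v => p v) (by norm_num) ?_
    rintro ⟨u, hu⟩ ⟨v, hv⟩ huv
    replace huv : u ≠ v := fun h => huv (Subtype.ext h)
    change G.Adj u v ↔ _
    by_cases hCu : C u <;> by_cases hCv : C v
    · exact iff_of_true (hC u v hCu hCv huv) ⟨h1 u v hCu hCv, h1 v u hCv hCu⟩
    · rw [G.adj_comm, hE, h3 v u hv hu hCv hCu, and_comm]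
    · rw [hE, h3 u v hu hv hCu hCv]
    · refine iff_of_false (hI u v hCu hCv) ?_
      change ¬ (p u ≤ p v + 4 ∧ p v ≤ p u + 4)
      have := h2 u v huv hCu hCv
      omega
  have hnF : ∀ j : Fin n, j ∉ S → C j → ¬ Forced n E C a b c j :=
    fun j hj _ hF => hj ((hS j).2 (.inl hF))
  by_cases hc : c = n + 1
  -- Second kind: a is [-3, 1] and b is [5, 9]. Clique intervals start at 0, 1 or 2 when they meet a
  -- only, both, or b only. Each start meets at least one of the two, which is why clique vertices
  -- adjacent to neither are forced out.
  · refine key (fun v => if C v then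
        if Nbr n E C a v then if Nbr n E C b v then 1 else 0 else 2
      else if (v : ℕ) = a then -3 else if (v : ℕ) = b then 5 else 100 + 10 * (v : ℕ)) ?_ ?_ ?_
    · intro u v hu hv
      simp only [hu, hv, if_true]
      split_ifs <;> omega
    · intro u v huv hu hv
      have : (u : ℕ) ≠ v := fun h => huv (Fin.ext h)
      simp only [hu, hv, if_false]
      split_ifs <;> omega
    · intro u v hu hv hCu hCv
      have hF := hnF v hv hCv
      simp only [Forced, hc, hCv, if_true, true_and, not_and, not_not] at hF
      simp only [hCu, hCv, if_true, if_false]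
      by_cases hua : (u : ℕ) = a
      · have : Nbr n E C a v ↔ E u v := by rw [← hua]; simp [Nbr, hCu]
        rw [if_pos hua, this]
        split_ifs with h1 h2
        exacts [iff_of_true h1 (by omega), iff_of_true h1 (by omega), iff_of_false h1 (by omega)]
      by_cases hub : (u : ℕ) = b
      · have : Nbr n E C b v ↔ E u v := by rw [← hub]; simp [Nbr, hCu]
        rw [if_neg hua, if_pos hub, this]
        rw [this] at hF
        split_ifs with h1 h2
        exacts [iff_of_true h2 (by omega), iff_of_false h2 (by omega),
          iff_of_true (hF h1) (by omega)]
      · rw [if_neg hua, if_neg hub]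
        refine iff_of_false (fun h => ?_) (by split_ifs <;> omega)
        have := hiso u v hu hv hCu hCv h
        have := u.2
        omega
  -- First kind: a is [-4, 0], b is [1, 5] and c is [6, 10]. The starts 0, 2 and 1 meet a, c, or
  -- neither of these, and all of them meet b; no interval of length 4 bridges the gap from 0 to 6.
  · refine key (fun v => if C v then
        if Nbr n E C a v then 0 else if Nbr n E C c v then 2 else 1
      else if (v : ℕ) = b then 1 else if (v : ℕ) = a then -4 else if (v : ℕ) = c then 6
        else 100 + 10 * (v : ℕ)) ?_ ?_ ?_
    · intro u v hu hv
      simp only [hu, hv, if_true]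
      split_ifs <;> omega
    · intro u v huv hu hv
      have : (u : ℕ) ≠ v := fun h => huv (Fin.ext h)
      simp only [hu, hv, if_false]
      split_ifs <;> omega
    · intro u v hu hv hCu hCv
      have hF := hnF v hv hCv
      simp only [Forced, hc, hCv, if_false, true_and, not_or] at hF
      obtain ⟨hF1, hF2⟩ := hF
      simp only [hCu, hCv, if_true, if_false]
      by_cases hub : (u : ℕ) = b
      · rw [if_pos hub]
        refine iff_of_true ?_ (by split_ifs <;> omega)
        by_contra h
        exact hF1 ⟨hub ▸ u.2, hub ▸ hCu, hub ▸ h⟩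
      by_cases hua : (u : ℕ) = a
      · have : Nbr n E C a v ↔ E u v := by rw [← hua]; simp [Nbr, hCu]
        rw [if_neg hub, if_pos hua, this]
        split_ifs with h1 h2
        exacts [iff_of_true h1 (by omega), iff_of_false h1 (by omega), iff_of_false h1 (by omega)]
      by_cases huc : (u : ℕ) = c
      · have : Nbr n E C c v ↔ E u v := by rw [← huc]; simp [Nbr, hCu]
        rw [if_neg hub, if_neg hua, if_pos huc, this]
        rw [this] at hF2
        split_ifs with h1 h2
        exacts [iff_of_false (fun h => hF2 ⟨h1, h⟩) (by omega), iff_of_true h2 (by omega),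
          iff_of_false h2 (by omega)]
      · rw [if_neg hub, if_neg hua, if_neg huc]
        refine iff_of_false (fun h => ?_) (by split_ifs <;> omega)
        have := hiso u v hu hv hCu hCv h
        omega

/-- The roles left, middle and right in a representation of G - T supply the guess. The second kind
is needed only when the middle role is unfilled and some kept clique vertex meets both outer
vertices. An edge between kept vertices always ends in a guessed independent vertex, so T covers all
edges between active ones. -/
theorem exists_guess {n : ℕ} {G : SimpleGraph (Fin n)} {E : ℕ → ℕ → Prop} {C : ℕ → Prop}
    (hE : ∀ u v : Fin n, G.Adj u v ↔ E u v)
    (hI : ∀ u v : Fin n, ¬ C u → ¬ C v → ¬ G.Adj u v)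
    (hC : ∀ u v : Fin n, C u → C v → u ≠ v → G.Adj u v) {T : Finset (Fin n)}
    (hT : IsSolution G T) : ∃ a b c, a < n + 1 ∧ b < n + 1 ∧ c < n + 2 ∧
      (∀ v : Fin n, Forced n E C a b c v → v ∈ T) ∧
      (bipGraph n E C (Active n E C a b c)).IsVertexCover (T : Set (Fin n)) := by
  classical
  have hcover : ∀ A : ℕ → Prop, (∀ i j : Fin n, Bip E C A i j → i ∈ T ∨ j ∈ T) →
      (bipGraph n E C A).IsVertexCover (T : Set (Fin n)) := by
    rintro A h u v (huv | huv)
    · exact h u v huv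
    · exact (h v u huv).symm
  by_cases hne : ∃ u : Fin n, C u ∧ u ∉ T
  · obtain ⟨L, f, hL, hf⟩ := hT
    set p : Fin n → ℝ := fun v => if h : v ∈ T then 0 else f ⟨v, h⟩ with hp
    have hp' : ∀ u v, u ∉ T → v ∉ T → u ≠ v → (G.Adj u v ↔ p u ≤ p v + L ∧ p v ≤ p u + L) := by
      intro u v hu hv huv
      simp only [hp, dif_neg hu, dif_neg hv]
      rw [← Icc_inter_Icc_nonempty_iff hL, ← hf _ _ (fun h => huv (congrArg Subtype.val h))]
      rfl
    obtain ⟨x, a, b, c, ha, hb, hc, hx, ha', hb', hc'⟩ := exists_left_mid_right (C := fun v => C v)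
      hI hC hL hp' hne
    have hadj : ∀ i j : Fin n, C j → i ∉ T → ¬ C i → j ∉ T →
        (E i j ↔ p i ≤ p j + L ∧ p j ≤ p i + L) := by
      intro i j h1 h2 h3 h4
      rw [← hE, hp' i j h2 h4 (fun h => h3 (h ▸ h1))]
    have hcases : ∀ i j : Fin n, C j → i ∉ T → ¬ C i → j ∉ T → E i j →
        (i : ℕ) = a ∨ (i : ℕ) = b ∨ (i : ℕ) = c := by
      intro i j h1 h2 h3 h4 h5
      have hQ : i ∉ T ∧ ¬ C i ∧ ∃ u : Fin n, u ∉ T ∧ C u ∧ G.Adj i u :=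
        ⟨h2, h3, j, h4, h1, (hE i j).2 h5⟩
      rcases lt_or_ge (p i + L) x with h | h
      · exact .inl ((ha' i).1 ⟨hQ, h⟩)
      rcases lt_or_ge x (p i) with h' | h'
      · exact .inr (.inr ((hc' i).1 ⟨hQ, h'⟩))
      · exact .inr (.inl ((hb' i).1 ⟨hQ, h', h⟩))
    by_cases hmode : b = n ∧ ∃ w : Fin n, C w ∧ w ∉ T ∧ Nbr n E C a w ∧ Nbr n E C c w
    · obtain ⟨rfl, w, hCw, hw, ⟨han, hCa, haw⟩, ⟨hcn, hCc, hcw⟩⟩ := hmode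
      -- The right vertex moves to the second slot. Since n has been replaced by b, the value `b +
      -- 1` is the marker n + 1 for the second kind.
      refine ⟨a, c, b + 1, by omega, by omega, by omega, fun v hv => ?_, hcover _ ?_⟩
      · obtain ⟨hCv, hv⟩ := hv
        rw [if_pos rfl] at hv
        obtain ⟨hv1, hv2⟩ := hv
        by_contra hvT
        have hva : ¬ E a v := fun h => hv1 ⟨han, hCa, h⟩
        have hvc : ¬ E c v := fun h => hv2 ⟨hcn, hCc, h⟩
        obtain ⟨⟨haT, -, -⟩, hax⟩ := (ha' ⟨a, han⟩).2 rfl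
        obtain ⟨⟨hcT, -, -⟩, hcx⟩ := (hc' ⟨c, hcn⟩).2 rfl
        have q1 := hx v hCv hvT
        have q2 := hx w hCw hw
        have q3 := (hadj ⟨a, han⟩ w hCw haT hCa hw).1 haw
        have q4 := (hadj ⟨c, hcn⟩ w hCw hcT hCc hw).1 hcw
        have q5 := fun h => hva ((hadj ⟨a, han⟩ v hCv haT hCa hvT).2 h)
        have q6 := fun h => hvc ((hadj ⟨c, hcn⟩ v hCv hcT hCc hvT).2 h)
        -- As w meets both outer intervals, the right one starts at most 2L after the start of the
        -- left one. An interval of the clique that starts too late to meet the left one therefore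
        -- reaches the right one.
        by_cases h : p v ≤ p ⟨a, han⟩ + L
        · exact q5 ⟨by linarith, h⟩
        · exact q6 ⟨by linarith, by linarith⟩
      · rintro i j ⟨h1, h2, hi, -, h3⟩
        by_contra! h
        have h4 := hcases i j h2 h.1 h1 h.2 h3
        rcases hi with ⟨h5, -⟩ | ⟨-, h5⟩
        · exact h1 h5
        · have := i.2
          omega
    · refine ⟨a, b, c, by omega, by omega, by omega, fun v hv => ?_, hcover _ ?_⟩
      · obtain ⟨hCv, hv⟩ := hv
        rw [if_neg (by omega)] at hv
        by_contra hvT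
        have q1 := hx v hCv hvT
        rcases hv with ⟨hbn, hCb, hbv⟩ | ⟨⟨han, hCa, hav⟩, ⟨hcn, hCc, hcv⟩⟩
        · obtain ⟨⟨hbT, -, -⟩, hbx⟩ := (hb' ⟨b, hbn⟩).2 rfl
          exact hbv ((hadj ⟨b, hbn⟩ v hCv hbT hCb hvT).2 ⟨by linarith, by linarith⟩)
        · rcases hb.lt_or_eq with hbn | hbn
          · obtain ⟨⟨haT, -, -⟩, hax⟩ := (ha' ⟨a, han⟩).2 rfl
            obtain ⟨⟨hcT, -, -⟩, hcx⟩ := (hc' ⟨c, hcn⟩).2 rfl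
            obtain ⟨⟨hbT, hCb, -⟩, hbx⟩ := (hb' ⟨b, hbn⟩).2 rfl
            have q3 := (hadj ⟨a, han⟩ v hCv haT hCa hvT).1 hav
            have q4 := (hadj ⟨c, hcn⟩ v hCv hcT hCc hvT).1 hcv
            have hab : ¬ (p ⟨a, han⟩ ≤ p ⟨b, hbn⟩ + L ∧ p ⟨b, hbn⟩ ≤ p ⟨a, han⟩ + L) := by
              intro h
              have hne : (⟨a, han⟩ : Fin n) ≠ ⟨b, hbn⟩ := fun h => by rw [h] at hax; linarith
              exact hI _ _ hCa hCb ((hp' _ _ haT hbT hne).2 h)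
            have hbc : ¬ (p ⟨b, hbn⟩ ≤ p ⟨c, hcn⟩ + L ∧ p ⟨c, hcn⟩ ≤ p ⟨b, hbn⟩ + L) := by
              intro h
              have hne : (⟨b, hbn⟩ : Fin n) ≠ ⟨c, hcn⟩ := fun h => by rw [h] at hbx; linarith
              exact hI _ _ hCb hCc ((hp' _ _ hbT hcT hne).2 h)
            -- The middle interval lies strictly between the outer ones, so their gap exceeds L and
            -- v cannot meet both.
            rw [not_and, not_le] at hab hbc
            have := hab (by linarith)
            have := hbc (by linarith)
            linarith
          · exact hmode ⟨hbn, v, hCv, hvT, ⟨han, hCa, hav⟩, ⟨hcn, hCc, hcv⟩⟩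
      · rintro i j ⟨h1, h2, hi, -, h3⟩
        by_contra! h
        have h4 := hcases i j h2 h.1 h1 h.2 h3
        rcases hi with ⟨h5, -⟩ | ⟨-, h5⟩
        · exact h1 h5
        · omega
  · push Not at hne
    -- When T contains the whole clique side, the empty guess forces nothing and T covers every
    -- edge.
    refine ⟨n, n, n, by omega, by omega, by omega, ?_, hcover _ fun i j h => .inr (hne j h.2.1)⟩
    rintro v ⟨-, h⟩
    simp [Nbr] at h

/-- A candidate for the guess that fits a solution `T` is not larger than `T`. -/
theorem card_le_of_guess {n : ℕ} {E : ℕ → ℕ → Prop} {C : ℕ → Prop} {a b c : ℕ}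
    {X S T : Finset (Fin n)}
    (hX : IsMinVertexCover (bipGraph n E C (Active n E C a b c)) X)
    (hS : ∀ v, v ∈ S ↔ Forced n E C a b c v ∨ v ∈ X)
    (hF : ∀ v : Fin n, Forced n E C a b c v → v ∈ T)
    (hT : (bipGraph n E C (Active n E C a b c)).IsVertexCover (T : Set (Fin n))) :
    S.card ≤ T.card := by
  classical
  have hact : ∀ v, Forced n E C a b c v → ¬ Active n E C a b c v := by
    rintro v h (h' | h')
    · exact h'.2 h
    · exact h'.1 h.1
  -- Forced vertices are inactive and hence isolated in the bipartite graph, so T still covers it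
  -- without them. The cost of a candidate thus splits into its forced part and a cover.
  have hcov : (bipGraph n E C (Active n E C a b c)).IsVertexCover
      ((T.filter fun v : Fin n => ¬ Forced n E C a b c v : Finset (Fin n)) : Set (Fin n)) := by
    intro u v huv
    have hu : ¬ Forced n E C a b c u := fun h => by
      rcases huv with h' | h'
      · exact hact _ h h'.2.2.1
      · exact hact _ h h'.2.2.2.1
    have hv : ¬ Forced n E C a b c v := fun h => by
      rcases huv with h' | h'
      · exact hact _ h h'.2.2.2.1
      · exact hact _ h h'.2.2.1
    rcases hT huv with h | h
    · exact .inl (by simpa [hu] using h)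
    · exact .inr (by simpa [hv] using h)
  have hsub : S ⊆ T.filter (fun v : Fin n => Forced n E C a b c v) ∪ X := by
    intro v hv
    rw [Finset.mem_union, Finset.mem_filter]
    rcases (hS v).1 hv with h | h
    · exact .inl ⟨hF v h, h⟩
    · exact .inr h
  calc S.card ≤ (T.filter (fun v : Fin n => Forced n E C a b c v) ∪ X).card := Finset.card_le_card hsub
    _ ≤ (T.filter (fun v : Fin n => Forced n E C a b c v)).card + X.card := Finset.card_union_le _ _
    _ ≤ (T.filter (fun v : Fin n => Forced n E C a b c v)).card +
        (T.filter (fun v : Fin n => ¬ Forced n E C a b c v)).card := by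
          exact Nat.add_le_add_left (hX.2 _ hcov) _
    _ = T.card := Finset.card_filter_add_card_filter_not _

end SplitUIG

namespace SplitUIG

/-! ### Minimum vertex covers by an auction

Bidders `i` bid for objects `j` with `R i j`; `P j` is the price of the object `j`, and
`Q j = i + 1` if `i` owns it. -/

/-- The invariant of the auction. -/
structure AuctionInv (n : ℕ) (R : ℕ → ℕ → Prop) (P Q : ℕ → ℕ) : Prop where
  owner : ∀ j, Q j ≠ 0 → ∃ i, Q j = i + 1 ∧ R i j ∧ ∀ j', R i j' → P j ≤ P j' + 1
  inj : ∀ j j', Q j ≠ 0 → Q j = Q j' → j = j'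
  owned : ∀ j, P j ≠ 0 → Q j ≠ 0
  le : ∀ j, P j ≤ n + 1

/-- The bidder `i` owns nothing and may bid for the object `j`. -/
def Bid (n : ℕ) (R : ℕ → ℕ → Prop) (P Q : ℕ → ℕ) (i j : ℕ) : Prop :=
  R i j ∧ (¬ ∃ j' < n, Q j' = i + 1) ∧ P j < n + 1 ∧ ∀ j', R i j' → P j ≤ P j'

/-- Prices never fall, so the other owners keep their slack of one. The new owner chose a cheapest
object, which after the increase is dearer than any alternative by at most one. A displaced owner
simply becomes free. -/
theorem AuctionInv.bid {n : ℕ} {R : ℕ → ℕ → Prop} {P Q : ℕ → ℕ}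
    (hR : ∀ i j, R i j → i < n ∧ j < n) (h : AuctionInv n R P Q) {i j : ℕ} (hb : Bid n R P Q i j) :
    AuctionInv n R (fun x => if x = j then P x + 1 else P x)
      (fun x => if x = j then i + 1 else Q x) := by
  obtain ⟨hij, hfree, hP, hmin⟩ := hb
  have hmono : ∀ x, P x ≤ if x = j then P x + 1 else P x := fun x => by split_ifs <;> omega
  have hfree' : ∀ x, Q x ≠ i + 1 := by
    intro x hx
    obtain ⟨i', h1, h2, -⟩ := h.owner x (by omega)
    exact hfree ⟨x, (hR _ _ h2).2, hx⟩
  refine ⟨fun x hx => ?_, fun x y hx hxy => ?_, fun x hx => ?_, fun x => ?_⟩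
  · by_cases hxj : x = j
    · subst hxj
      refine ⟨i, by simp, hij, fun j' hj' => ?_⟩
      have h1 := hmin j' hj'
      have h2 := hmono j'
      simp only [if_true]
      omega
    · simp only [if_neg hxj] at hx ⊢
      obtain ⟨i', h1, h2, h3⟩ := h.owner x hx
      exact ⟨i', h1, h2, fun j' hj' => (h3 j' hj').trans (by have := hmono j'; omega)⟩
  · have h1 := hfree' x
    have h2 := hfree' y
    split_ifs at hx hxy with h3 h4 h4
    · omega
    · omega
    · omega
    · exact h.inj x y hx hxy
  · by_cases hxj : x = j
    · simp [hxj]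
    · simp only [if_neg hxj] at hx ⊢
      exact h.owned x hx
  · have := h.le x
    by_cases hxj : x = j
    · subst hxj; simp only [if_true]; omega
    · simpa [hxj] using this

theorem AuctionInv.init (n : ℕ) (R : ℕ → ℕ → Prop) :
    AuctionInv n R (fun _ => 0) (fun _ => 0) :=
  ⟨fun _ h => absurd rfl h, fun _ _ h => absurd rfl h, fun _ h => absurd rfl h,
    fun _ => Nat.zero_le _⟩

/-- By `sum_bid` every bid raises the sum of the prices by one, so this bounds the number of bids.
-/
theorem AuctionInv.sum_le {n : ℕ} {R : ℕ → ℕ → Prop} {P Q : ℕ → ℕ} (h : AuctionInv n R P Q) :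
    ∑ j ∈ Finset.range n, P j ≤ n * (n + 1) := by
  calc ∑ j ∈ Finset.range n, P j ≤ ∑ _j ∈ Finset.range n, (n + 1) :=
        Finset.sum_le_sum fun j _ => h.le j
    _ = n * (n + 1) := by simp

theorem sum_bid {n : ℕ} (P : ℕ → ℕ) {j : ℕ} (hj : j < n) :
    ∑ x ∈ Finset.range n, (if x = j then P x + 1 else P x) = ∑ x ∈ Finset.range n, P x + 1 := by
  have : ∀ x, (if x = j then P x + 1 else P x) = P x + if x = j then 1 else 0 := fun x => by
    split_ifs <;> rfl
  simp only [this, Finset.sum_add_distrib]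
  simp [hj]

/-- Pigeonhole: n prices cannot occupy n + 1 levels. -/
theorem exists_free_level (n : ℕ) (P : ℕ → ℕ) :
    ∃ k, 1 ≤ k ∧ k ≤ n + 1 ∧ ∀ j < n, P j ≠ k := by
  obtain ⟨k, hk, hk'⟩ := Finset.exists_mem_notMem_of_card_lt_card
    (s := (Finset.range n).image P) (t := Finset.Icc 1 (n + 1))
    (lt_of_le_of_lt Finset.card_image_le (by simp))
  rw [Finset.mem_Icc] at hk
  refine ⟨k, hk.1, hk.2, fun j hj h => hk' ?_⟩
  rw [Finset.mem_image]
  exact ⟨j, Finset.mem_range.2 hj, h⟩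

/-- When no bid is possible, a price level that does not occur yields a minimum vertex cover. -/
theorem AuctionInv.isMinVertexCover {n : ℕ} {R : ℕ → ℕ → Prop} {P Q : ℕ → ℕ}
    (h : AuctionInv n R P Q) (hR : ∀ i j, R i j → i < n ∧ j < n) (hR' : ∀ i j k, R i j → ¬ R j k)
    (hstuck : ∀ i j, ¬ Bid n R P Q i j) {k : ℕ} (hk1 : k ≤ n + 1)
    (hk : ∀ j < n, P j ≠ k) {H : SimpleGraph (Fin n)} (hH : ∀ u v : Fin n, H.Adj u v ↔ R u v ∨ R v u)
    {X : Finset (Fin n)} (hX : ∀ v : Fin n, v ∈ X ↔ k < P v ∨ ∃ j, R v j ∧ P j < k) :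
    IsMinVertexCover H X := by
  classical
  -- A bidder that owns nothing but wants an object below the maximal price could still bid for a
  -- cheapest one.
  have hown : ∀ i j, R i j → P j < n + 1 → ∃ j' < n, Q j' = i + 1 := by
    intro i j hij hP
    by_contra hfree
    obtain ⟨j₀, hj₀, hmin⟩ := Finset.exists_min_image ((Finset.range n).filter (R i)) P
      ⟨j, by simp [hij, (hR _ _ hij).2]⟩
    simp only [Finset.mem_filter, Finset.mem_range, and_imp] at hj₀ hmin
    refine hstuck i j₀ ⟨hj₀.2, hfree, ?_, fun j' hj' => hmin j' (hR _ _ hj').2 hj'⟩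
    exact lt_of_le_of_lt (hmin j (hR _ _ hij).2 hij) hP
  have hedge : ∀ u v : Fin n, R u v → u ∈ X ∨ v ∈ X := by
    intro u v huv
    rcases lt_or_ge k (P v) with h1 | h1
    · exact .inr ((hX v).2 (.inl h1))
    · exact .inl ((hX u).2 (.inr ⟨v, huv, lt_of_le_of_ne h1 (hk v v.2)⟩))
  refine ⟨?_, fun Y hY => ?_⟩
  · intro u v huv
    rcases (hH u v).1 huv with h1 | h1
    · exact hedge u v h1
    · exact (hedge v u h1).symm
  -- Weak duality: the pairs of objects and owners form a matching, and Y contains an end of each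
  -- pair. It remains to assign distinct pairs to the vertices of X.
  · have hpick : ∀ j, Q j ≠ 0 → ∃ y ∈ Y, (y : ℕ) = j ∨ (y : ℕ) + 1 = Q j := by
      intro j hj
      obtain ⟨i, h1, h2, -⟩ := h.owner j hj
      obtain ⟨hi, hj'⟩ := hR i j h2
      rcases hY ((hH ⟨i, hi⟩ ⟨j, hj'⟩).2 (.inl h2)) with h3 | h3
      · exact ⟨_, h3, .inr h1.symm⟩
      · exact ⟨_, h3, .inl rfl⟩
    have hmap : ∀ v : Fin n, ∃ y : Fin n, v ∈ X → y ∈ Y ∧ ∃ j, Q j ≠ 0 ∧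
        ((y : ℕ) = j ∨ (y : ℕ) + 1 = Q j) ∧
        ((k < P j ∧ j = v) ∨ (P j < k ∧ Q j = v + 1)) := by
      intro v
      by_cases hv : v ∈ X
      swap
      · exact ⟨v, fun h => absurd h hv⟩
      rcases (hX v).1 hv with h1 | ⟨j, h1, h2⟩
      · have hQ := h.owned v (by omega)
        obtain ⟨y, hy, hy'⟩ := hpick v hQ
        exact ⟨y, fun _ => ⟨hy, v, hQ, hy', .inl ⟨h1, rfl⟩⟩⟩
      · obtain ⟨j', h3, h4⟩ := hown v j h1 (by omega)
        have hQ : Q j' ≠ 0 := by omega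
        obtain ⟨y, hy, hy'⟩ := hpick j' hQ
        obtain ⟨i, h5, -, h7⟩ := h.owner j' hQ
        obtain rfl : i = v := by omega
        -- The slack gives the owned object a price of at most k, hence below k as k does not occur.
        -- So a bidder in X gets a pair with a cheap object, whereas an object in X gets a pair with
        -- an expensive one.
        have h8 := h7 j h1
        have h9 := hk j' h3
        exact ⟨y, fun _ => ⟨hy, j', hQ, hy', .inr ⟨by omega, h4⟩⟩⟩
    choose f hf using hmap
    refine Finset.card_le_card_of_injOn f (fun v hv => (hf v hv).1) ?_
    intro v hv w hw hvw
    obtain ⟨-, j, h1, h2, h3⟩ := hf v hv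
    obtain ⟨-, j', h1', h2', h3'⟩ := hf w hw
    rw [← hvw] at h2'
    obtain ⟨i, q1, q2, -⟩ := h.owner j h1
    obtain ⟨i', q1', q2', -⟩ := h.owner j' h1'
    -- A vertex of Y meets only one pair: bidders own at most one object, and by `hR'` no vertex is
    -- both a bidder and an object.
    have hjj : j = j' := by
      rcases h2 with h2 | h2 <;> rcases h2' with h2' | h2'
      · omega
      · obtain rfl : i' = j := by omega
        exact absurd q2' (hR' _ _ _ q2)
      · obtain rfl : i = j' := by omega
        exact absurd q2 (hR' _ _ _ q2')
      · exact h.inj j j' h1 (by omega)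
    subst hjj
    apply Fin.ext
    omega

/-! ### Derived expressions -/

namespace Ex

/-- The truth of an expression. -/
def T (e : Ex) (B : ℕ) (f : ℕ → ℕ) (a : Fin 16 → ℕ → ℕ) : Prop := e.eval B f a ≠ 0

/-- Negation. -/
def not (e : Ex) : Ex := .ite e (.c 0) (.c 1)

/-- Conjunction. -/
def and (e e' : Ex) : Ex := .ite e e' (.c 0)

/-- Disjunction. -/
def or (e e' : Ex) : Ex := .ite e (.c 1) e'

/-- Strict comparison. -/
def lt (e e' : Ex) : Ex := .sub e' e

/-- Equality. -/
def eq (e e' : Ex) : Ex := (lt e e').or (lt e' e) |>.not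

/-- Existence of a value `x < B`. -/
def ex (x : ℕ) (e : Ex) : Ex := .sum x e

/-- Universality over the values `x < B`. -/
def all (x : ℕ) (e : Ex) : Ex := (ex x e.not).not

/-- The least `y < B` for which `e` holds, or `B`; the variable `x` is auxiliary. -/
def find (x y : ℕ) (e : Ex) : Ex :=
  .sum x (ex y ((lt (.v x) (.v y)).not.and e)).not

variable {B : ℕ} {f : ℕ → ℕ} {a : Fin 16 → ℕ → ℕ} {e e' e'' : Ex}

theorem T_ar {k : Fin 16} : (Ex.ar k e).T B f a ↔ a k (e.eval B f a) ≠ 0 := Iff.rfl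

open Classical in
theorem eval_ite : (Ex.ite e e' e'').eval B f a =
    if e.T B f a then e'.eval B f a else e''.eval B f a := by
  by_cases h : e.eval B f a = 0 <;> simp [Ex.eval, T, h]

theorem T_not : e.not.T B f a ↔ ¬ e.T B f a := by
  simp only [not, T, eval_ite, Ex.eval]
  split_ifs with h <;> simp [h]

theorem T_and : (e.and e').T B f a ↔ e.T B f a ∧ e'.T B f a := by
  simp only [and, T, eval_ite, Ex.eval]
  split_ifs with h <;> simp [h]

theorem T_or : (e.or e').T B f a ↔ e.T B f a ∨ e'.T B f a := by
  simp only [or, T, eval_ite, Ex.eval]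
  split_ifs with h <;> simp [h]

theorem T_lt : (e.lt e').T B f a ↔ e.eval B f a < e'.eval B f a := by
  simp only [lt, T, Ex.eval]
  omega

theorem T_eq : (e.eq e').T B f a ↔ e.eval B f a = e'.eval B f a := by
  simp only [eq, T_not, T_or, T_lt]
  omega

theorem T_ex {x : ℕ} : (Ex.ex x e).T B f a ↔ ∃ j < B, e.T B (Function.update f x j) a := by
  simp only [ex, T, Ex.eval, Ne, Finset.sum_eq_zero_iff, Finset.mem_range]
  push Not
  rfl

theorem T_all {x : ℕ} : (Ex.all x e).T B f a ↔ ∀ j < B, e.T B (Function.update f x j) a := by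
  simp only [all, T_not, T_ex]
  push Not
  rfl

open Classical in
theorem eval_not : e.not.eval B f a = if e.T B f a then 0 else 1 := by
  rw [not, eval_ite]
  rfl

/-- The specification of `find`. -/
theorem find_spec {x y : ℕ} {R : ℕ → Prop}
    (hR : ∀ i < B, ∀ j < B,
      e.T B (Function.update (Function.update f x i) y j) a ↔ R j) (hxy : x ≠ y) :
    (Ex.find x y e).eval B f a ≤ B ∧
      ((Ex.find x y e).eval B f a < B → R ((Ex.find x y e).eval B f a)) ∧
      ∀ j < (Ex.find x y e).eval B f a, ¬ R j := by
  classical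
  -- The expression counts the i without a hit up to i; these are exactly the numbers below the
  -- first hit.
  have heval : (Ex.find x y e).eval B f a =
      ((Finset.range B).filter fun i => ∀ j ≤ i, ¬ R j).card := by
    rw [find, Ex.eval, Finset.card_filter]
    refine Finset.sum_congr rfl fun i hi => ?_
    rw [Finset.mem_range] at hi
    rw [eval_not, T_ex]
    have : (∃ j < B, ((lt (.v x) (.v y)).not.and e).T B
        (Function.update (Function.update f x i) y j) a) ↔ ¬ ∀ j ≤ i, ¬ R j := by
      push Not
      constructor
      · rintro ⟨j, hj, h⟩
        rw [T_and, T_not, T_lt, hR i hi j hj] at h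
        refine ⟨j, ?_, h.2⟩
        simpa [Ex.eval, Function.update_of_ne hxy] using h.1
      · rintro ⟨j, hj, h⟩
        refine ⟨j, by omega, ?_⟩
        rw [T_and, T_not, T_lt, hR i hi j (by omega)]
        refine ⟨?_, h⟩
        simpa [Ex.eval, Function.update_of_ne hxy] using hj
    by_cases h : ∀ j ≤ i, ¬ R j
    · rw [if_neg fun h' => this.1 h' h, if_pos h]
    · rw [if_pos (this.2 h), if_neg h]
  rw [heval]
  by_cases h : ∃ j, j < B ∧ R j
  · have hcard : ((Finset.range B).filter fun i => ∀ j ≤ i, ¬ R j) = Finset.range (Nat.find h) := by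
      ext i
      simp only [Finset.mem_filter, Finset.mem_range, Nat.lt_find_iff]
      constructor
      · rintro ⟨h1, h2⟩ j hj ⟨-, h3⟩
        exact h2 j hj h3
      · intro h1
        have hi : i < B := by
          by_contra hi
          obtain ⟨j, hj, hj'⟩ := h
          exact h1 j (by omega) ⟨hj, hj'⟩
        exact ⟨hi, fun j hj hj' => h1 j hj ⟨by omega, hj'⟩⟩
    rw [hcard, Finset.card_range]
    have hs := Nat.find_spec h
    refine ⟨hs.1.le, fun _ => hs.2, fun j hj hj' => Nat.find_min h hj ⟨by omega, hj'⟩⟩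
  · push Not at h
    have hcard : ((Finset.range B).filter fun i => ∀ j ≤ i, ¬ R j) = Finset.range B := by
      refine Finset.filter_true_of_mem fun i hi j hj => h j ?_
      rw [Finset.mem_range] at hi
      omega
    rw [hcard, Finset.card_range]
    exact ⟨le_rfl, fun h => absurd h (lt_irrefl _), h⟩

/-- The product of the variables `x` and `y`, provided that `x` is at most `B`; `z` is auxiliary. -/
def mul (z x y : ℕ) : Ex := .sum z (.ite (lt (.v z) (.v x)) (.v y) (.c 0))

/-- The value of y is added once for each z that is below both x and B. -/
theorem eval_mul {x y z : ℕ} (hx : x ≠ z) (hy : y ≠ z) :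
    (Ex.mul z x y).eval B f a = min (f x) B * f y := by
  classical
  have h : ∀ j, (Ex.ite (lt (.v z) (.v x)) (.v y) (.c 0)).eval B (Function.update f z j) a =
      if j < f x then f y else 0 := by
    intro j
    rw [eval_ite, T_lt]
    simp [Ex.eval, hx, hy]
  rw [mul, Ex.eval, Finset.sum_congr rfl fun j _ => h j, ← Finset.sum_filter, Finset.sum_const,
    smul_eq_mul]
  congr 1
  have : (Finset.range B).filter (fun j => j < f x) = Finset.range (min (f x) B) := by
    ext j
    simp only [Finset.mem_filter, Finset.mem_range]
    omega
  rw [this, Finset.card_range]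

end Ex

theorem iter_induction {σ : Type*} {f : ℕ → σ → σ} (I : ℕ → σ → Prop) {m : ℕ} {s : σ} (h0 : I 0 s)
    (hstep : ∀ j < m, ∀ s, I j s → I (j + 1) (f j s)) : I m (iter f m s) := by
  induction m with
  | zero => exact h0
  | succ m ih => exact hstep m (by omega) _ (ih fun j hj => hstep j (by omega))

end SplitUIG

namespace SplitUIG

theorem Cmd.run_ite_pos {O : List Bool → List Bool} {B : ℕ} {e : Ex} {p q : Cmd} {s : St}
    (h : e.T B s.v s.a) : (Cmd.ite e p q).run O B s = p.run O B s := if_pos h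

theorem Cmd.run_ite_neg {O : List Bool → List Bool} {B : ℕ} {e : Ex} {p q : Cmd} {s : St}
    (h : ¬ e.T B s.v s.a) : (Cmd.ite e p q).run O B s = q.run O B s := if_neg h

/-! ### Programs on graphs

The variable `0` holds the number of vertices and the array `0` the input. The array `1` holds the
clique side, the array `4` the active vertices, and the array `5` a vertex cover, shifted by
one. -/

/-- The adjacency relation given by the cells of the input. -/
def AdjR (B n : ℕ) (inp : ℕ → ℕ) (i j : ℕ) : Prop := inp (n + 2 + (min i B * n + j)) ≠ 0

/-- The adjacency of the vertices in the variables `i` and `j`. -/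
def adjE (i j : ℕ) : Ex := .ar 0 (.add (.add (.v 0) (.c 2)) (.add (.mul 30 i 0) (.v j)))

/-- The variable 30 is bound inside the product. The truncation in `AdjR` is that of the product, so
no bound on the vertices is needed. -/
theorem T_adjE {B : ℕ} {f : ℕ → ℕ} {a : Fin 16 → ℕ → ℕ} {i j : ℕ} (hi : i ≠ 30) :
    (adjE i j).T B f a ↔ AdjR B (f 0) (a 0) (f i) (f j) := by
  simp only [adjE, Ex.T_ar, Ex.eval, AdjR]
  rw [Ex.eval_mul hi (by norm_num)]

/-- The bipartite relation given by the arrays. -/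
def BipR (B : ℕ) (f : ℕ → ℕ) (a : Fin 16 → ℕ → ℕ) (i j : ℕ) : Prop :=
  i < f 0 ∧ j < f 0 ∧ Bip (AdjR B (f 0) (a 0)) (fun x => a 1 x ≠ 0) (fun x => a 4 x ≠ 0) i j

/-- The bipartite relation for the variables `i` and `j`. -/
def bipE (i j : ℕ) : Ex :=
  (Ex.lt (.v i) (.v 0)).and <| (Ex.lt (.v j) (.v 0)).and <| (Ex.ar 1 (.v i)).not.and <|
    (Ex.ar 1 (.v j)).and <| (Ex.ar 4 (.v i)).and <| (Ex.ar 4 (.v j)).and (adjE i j)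

theorem T_bipE {B : ℕ} {f : ℕ → ℕ} {a : Fin 16 → ℕ → ℕ} {i j : ℕ} (hi : i ≠ 30) :
    (bipE i j).T B f a ↔ BipR B f a (f i) (f j) := by
  simp only [bipE, Ex.T_and, Ex.T_not, Ex.T_lt, Ex.T_ar, T_adjE hi, BipR, Bip, Ex.eval]

/-- The graph in which a vertex cover is sought. -/
def St.bipGraph (s : St) (B : ℕ) : SimpleGraph (Fin (s.v 0)) :=
  SplitUIG.bipGraph (s.v 0) (AdjR B (s.v 0) (s.a 0)) (fun x => s.a 1 x ≠ 0) (fun x => s.a 4 x ≠ 0)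

/-- What a vertex cover subroutine with `δ` oracle calls does. -/
structure CoverSpec (B δ : ℕ) (s s' : St) : Prop where
  v_eq : ∀ x < 10, s'.v x = s.v x
  a_eq : ∀ k, k ≠ 5 → k ≠ 6 → k ≠ 7 → s'.a k = s.a k
  calls_eq : s'.calls = s.calls + δ
  cover : ∃ X : Finset (Fin (s.v 0)), IsMinVertexCover (s.bipGraph B) X ∧
    ∀ v : Fin (s.v 0), v ∈ X ↔ s'.a 5 (v + 1) ≠ 0

/-! ### The auction as a program -/

/-- The possible bids. -/
def bidE (i j : ℕ) : Ex :=
  (bipE i j).and <|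
    (Ex.ex 22 ((Ex.lt (.v 22) (.v 0)).and (Ex.eq (.ar 7 (.v 22)) (.add (.v i) (.c 1))))).not.and <|
    (Ex.lt (.ar 6 (.v j)) (.add (.v 0) (.c 1))).and <|
    Ex.all 22 ((bipE i 22).not.or (Ex.lt (.ar 6 (.v 22)) (.ar 6 (.v j))).not)

/-- One step of the auction. -/
def bidCmd : Cmd :=
  .seq (.setv 10 (.find 24 20 (.ex 21 (bidE 20 21)))) <|
  .seq (.setv 11 (.find 24 21 (bidE 10 21))) <|
  .ite (.lt (.v 10) (.v 0))
    (.seq (.seta 7 20 (.ite (.eq (.v 20) (.v 11)) (.add (.v 10) (.c 1)) (.ar 7 (.v 20))))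
      (.seta 6 20 (.ite (.eq (.v 20) (.v 11)) (.add (.ar 6 (.v 20)) (.c 1)) (.ar 6 (.v 20)))))
    (.setv 10 (.v 10))

/-- The auction. -/
def auctionCmd : Cmd :=
  .seq (.seta 6 20 (.c 0)) <| .seq (.seta 7 20 (.c 0)) <|
  .seq (.loop 12 (.sum 20 (.c 1)) bidCmd) <|
  .seq (.setv 13 (.find 24 20 ((Ex.lt (.c 0) (.v 20)).and
    (Ex.ex 21 ((Ex.lt (.v 21) (.v 0)).and (Ex.eq (.ar 6 (.v 21)) (.v 20)))).not)))
  (.seta 5 20 (.ex 21 ((Ex.eq (.add (.v 21) (.c 1)) (.v 20)).and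
    ((Ex.lt (.v 13) (.ar 6 (.v 21))).or
      (.ex 22 ((bipE 21 22).and (Ex.lt (.ar 6 (.v 22)) (.v 13))))))))

/-- The first `B` values of a function. -/
def trunc (B : ℕ) (g : ℕ → ℕ) (x : ℕ) : ℕ := if x < B then g x else 0

theorem trunc_of_lt {B x : ℕ} (g : ℕ → ℕ) (h : x < B) : trunc B g x = g x := if_pos h

theorem BipR.congr {B : ℕ} {f f' : ℕ → ℕ} {a a' : Fin 16 → ℕ → ℕ} (hf : f' 0 = f 0)
    (h0 : a' 0 = a 0) (h1 : a' 1 = a 1) (h4 : a' 4 = a 4) : BipR B f' a' = BipR B f a := by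
  unfold BipR
  rw [hf, h0, h1, h4]

/-- Quantifiers below B may replace unbounded ones because the relation lives below `f 0`, which is
at most B. The truncation is there for `AuctionInv`, which speaks of all indices, while only the
entries below B are initialised. -/
theorem T_bidE {B : ℕ} {f : ℕ → ℕ} {a : Fin 16 → ℕ → ℕ} {i j : ℕ} (hi : i ≠ 30) (hi' : i ≠ 22)
    (hj' : j ≠ 22) (hB : f 0 ≤ B) :
    (bidE i j).T B f a ↔
      Bid (f 0) (BipR B f a) (trunc B (a 6)) (trunc B (a 7)) (f i) (f j) := by
  have h0 : (0 : ℕ) ≠ 22 := by norm_num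
  have hcongr : ∀ x, BipR B (Function.update f 22 x) a = BipR B f a := fun x =>
    BipR.congr (Function.update_of_ne h0 _ _) rfl rfl rfl
  simp only [bidE, Ex.T_and, T_bipE hi, Ex.T_not, Ex.T_ex, Ex.T_all, Ex.T_or, Ex.T_lt, Ex.T_eq,
    Ex.eval, Function.update_self, Function.update_of_ne hi', Function.update_of_ne hj',
    Function.update_of_ne h0, hcongr, Bid]
  refine and_congr_right fun hR => and_congr (not_congr ?_) (and_congr ?_ ?_)
  · constructor
    · rintro ⟨x, -, h1, h2⟩
      exact ⟨x, h1, by rwa [trunc_of_lt _ (by omega)]⟩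
    · rintro ⟨x, h1, h2⟩
      rw [trunc_of_lt _ (by omega)] at h2
      exact ⟨x, by omega, h1, h2⟩
  · rw [trunc_of_lt _ (lt_of_lt_of_le hR.2.1 hB)]
  · rw [trunc_of_lt _ (lt_of_lt_of_le hR.2.1 hB)]
    constructor
    · intro h x hx
      have hxB := lt_of_lt_of_le hx.2.1 hB
      rw [trunc_of_lt _ hxB]
      rcases h x hxB with h' | h'
      · exact absurd hx h'
      · omega
    · intro h x hx
      by_cases hR' : BipR B f a (f i) x
      · have := h x hR'
        rw [trunc_of_lt _ hx] at this
        exact .inr (by omega)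
      · exact .inl hR'

/-- What the steps of the auction leave unchanged. -/
structure AuctionFrame (s s' : St) : Prop where
  v_eq : ∀ x < 10, s'.v x = s.v x
  a_eq : ∀ k, k ≠ 5 → k ≠ 6 → k ≠ 7 → s'.a k = s.a k
  calls_eq : s'.calls = s.calls

theorem AuctionFrame.bipR {s s' : St} (h : AuctionFrame s s') (B : ℕ) :
    BipR B s'.v s'.a = BipR B s.v s.a :=
  BipR.congr (h.v_eq 0 (by norm_num)) (h.a_eq 0 (by decide) (by decide) (by decide))
    (h.a_eq 1 (by decide) (by decide) (by decide)) (h.a_eq 4 (by decide) (by decide) (by decide))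

/-- The alternative in `ht` measures progress: either the auction is over, and then a step changes
neither prices nor owners, or the prices count the steps made. -/
theorem run_bidCmd (O : List Bool → List Bool) {B t : ℕ} {s : St} (hB : s.v 0 ≤ B)
    (h : AuctionInv (s.v 0) (BipR B s.v s.a) (trunc B (s.a 6)) (trunc B (s.a 7)))
    (ht : (∀ i j, ¬ Bid (s.v 0) (BipR B s.v s.a) (trunc B (s.a 6)) (trunc B (s.a 7)) i j) ∨
      ∑ j ∈ Finset.range (s.v 0), trunc B (s.a 6) j = t) {s' : St} (hs' : bidCmd.run O B s = s') :
    AuctionFrame s s' ∧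
      AuctionInv (s.v 0) (BipR B s.v s.a) (trunc B (s'.a 6)) (trunc B (s'.a 7)) ∧
      ((∀ i j, ¬ Bid (s.v 0) (BipR B s.v s.a) (trunc B (s'.a 6)) (trunc B (s'.a 7)) i j) ∨
        ∑ j ∈ Finset.range (s.v 0), trunc B (s'.a 6) j = t + 1) := by
  have hRlt : ∀ i j, BipR B s.v s.a i j → i < s.v 0 ∧ j < s.v 0 := fun i j h => ⟨h.1, h.2.1⟩
  obtain ⟨-, hi2, hi3⟩ := Ex.find_spec (B := B) (f := s.v) (a := s.a) (x := 24) (y := 20)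
    (e := .ex 21 (bidE 20 21))
    (R := fun i => ∃ j, Bid (s.v 0) (BipR B s.v s.a) (trunc B (s.a 6)) (trunc B (s.a 7)) i j)
    (by
      intro x _ i hi
      rw [Ex.T_ex]
      have : ∀ j, (bidE 20 21).T B
          (Function.update (Function.update (Function.update s.v 24 x) 20 i) 21 j) s.a ↔
          Bid (s.v 0) (BipR B s.v s.a) (trunc B (s.a 6)) (trunc B (s.a 7)) i j := by
        intro j
        rw [T_bidE (by norm_num) (by norm_num) (by norm_num)
          (by simpa [Function.update_apply] using hB),
          BipR.congr (f := s.v) (a := s.a) (by simp) rfl rfl rfl]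
        simp
      simp only [this]
      exact ⟨fun ⟨j, _, h⟩ => ⟨j, h⟩, fun ⟨j, h⟩ => ⟨j, lt_of_lt_of_le h.1.2.1 hB, h⟩⟩)
    (by norm_num)
  set i := (Ex.find 24 20 (.ex 21 (bidE 20 21))).eval B s.v s.a with hi
  obtain ⟨-, hj2, hj3⟩ := Ex.find_spec (B := B) (f := Function.update s.v 10 i) (a := s.a)
    (x := 24) (y := 21) (e := bidE 10 21)
    (R := fun j => Bid (s.v 0) (BipR B s.v s.a) (trunc B (s.a 6)) (trunc B (s.a 7)) i j)
    (by
      intro x _ j _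
      rw [T_bidE (by norm_num) (by norm_num) (by norm_num)
        (by simpa [Function.update_apply] using hB),
        BipR.congr (f := s.v) (a := s.a) (by simp) rfl rfl rfl]
      simp)
    (by norm_num)
  set j := (Ex.find 24 21 (bidE 10 21)).eval B (Function.update s.v 10 i) s.a with hj
  change (Cmd.ite _ _ _).run O B ⟨Function.update (Function.update s.v 10 i) 11 j, s.a, s.calls⟩ =
    s' at hs'
  have hcond : (Ex.lt (.v 10) (.v 0)).T B
      (Function.update (Function.update s.v 10 i) 11 j) s.a ↔ i < s.v 0 := by
    rw [Ex.T_lt]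
    simp [Ex.eval]
  by_cases hin : i < s.v 0
  · rw [Cmd.run_ite_pos (hcond.2 hin)] at hs'
    obtain ⟨j', hj'⟩ := hi2 (by omega)
    have hjB : j < B := by
      by_contra hjB
      exact hj3 j' (by have := hj'.1.2.1; omega) hj'
    have hbid := hj2 hjB
    subst hs'
    refine ⟨⟨fun x hx => ?_, fun k _ h6 h7 => ?_, rfl⟩, ?_⟩
    · have h10 : x ≠ 10 := by omega
      have h11 : x ≠ 11 := by omega
      simp [Cmd.run, h10, h11]
    · simp [Cmd.run, h6, h7]
    · have hP : trunc B (fun x => if x < B then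
            (Ex.ite (.eq (.v 20) (.v 11)) (.add (.ar 6 (.v 20)) (.c 1)) (.ar 6 (.v 20))).eval B
              (Function.update (Function.update (Function.update s.v 10 i) 11 j) 20 x)
              (Function.update s.a 7 fun x => if x < B then
                (Ex.ite (.eq (.v 20) (.v 11)) (.add (.v 10) (.c 1)) (.ar 7 (.v 20))).eval B
                (Function.update (Function.update (Function.update s.v 10 i) 11 j) 20 x) s.a
                else s.a 7 x) else s.a 6 x) =
          fun x => if x = j then trunc B (s.a 6) x + 1 else trunc B (s.a 6) x := by
        funext x
        by_cases hx : x < B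
        · simp only [trunc_of_lt _ hx, if_pos hx, Ex.eval_ite, Ex.T_eq]
          simp [Ex.eval]
        · have : x ≠ j := by omega
          simp [trunc, hx, this]
      have hQ : trunc B (fun x => if x < B then
            (Ex.ite (.eq (.v 20) (.v 11)) (.add (.v 10) (.c 1)) (.ar 7 (.v 20))).eval B
              (Function.update (Function.update (Function.update s.v 10 i) 11 j) 20 x) s.a
            else s.a 7 x) =
          fun x => if x = j then i + 1 else trunc B (s.a 7) x := by
        funext x
        by_cases hx : x < B
        · simp only [trunc_of_lt _ hx, if_pos hx, Ex.eval_ite, Ex.T_eq]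
          simp [Ex.eval]
        · have : x ≠ j := by omega
          simp [trunc, hx, this]
      simp only [Cmd.run, Function.update_self,
        Function.update_of_ne (show (7 : Fin 16) ≠ 6 by decide),
        Function.update_of_ne (show (6 : Fin 16) ≠ 7 by decide)]
      rw [hP, hQ]
      refine ⟨h.bid hRlt hbid, .inr ?_⟩
      rw [sum_bid _ hbid.1.2.1]
      rcases ht with ht | ht
      · exact absurd hbid (ht _ _)
      · rw [ht]
  · rw [Cmd.run_ite_neg (fun h => hin (hcond.1 h))] at hs'
    have hnone : ∀ i j, ¬ Bid (s.v 0) (BipR B s.v s.a) (trunc B (s.a 6)) (trunc B (s.a 7)) i j :=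
      fun i' j' hb => hi3 i' (by have := hb.1.1; omega) ⟨j', hb⟩
    subst hs'
    refine ⟨⟨fun x hx => ?_, fun k _ _ _ => rfl, rfl⟩, h, .inl hnone⟩
    have h10 : x ≠ 10 := by omega
    have h11 : x ≠ 11 := by omega
    simp [Cmd.run, h10, h11]

theorem run_auctionCmd (O : List Bool → List Bool) {B : ℕ} (s : St)
    (hB : s.v 0 * s.v 0 + s.v 0 + 2 ≤ B) : CoverSpec B 0 s (auctionCmd.run O B s) := by
  set n := s.v 0 with hn
  have hnB : n ≤ B := by have := Nat.zero_le (n * n); omega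
  have hRlt : ∀ i j, BipR B s.v s.a i j → i < n ∧ j < n := fun i j h => ⟨h.1, h.2.1⟩
  simp only [auctionCmd, Cmd.run]
  set s1 : St := ⟨s.v, Function.update (Function.update s.a 6 fun i => if i < B then
      (Ex.c 0).eval B (Function.update s.v 20 i) s.a else s.a 6 i) 7 fun i => if i < B then
      (Ex.c 0).eval B (Function.update s.v 20 i) (Function.update s.a 6 fun i => if i < B then
      (Ex.c 0).eval B (Function.update s.v 20 i) s.a else s.a 6 i) else
      (Function.update s.a 6 fun i => if i < B then
      (Ex.c 0).eval B (Function.update s.v 20 i) s.a else s.a 6 i) 7 i, s.calls⟩ with hs1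
  have hP1 : trunc B (s1.a 6) = fun _ => 0 := by
    funext x
    by_cases hx : x < B <;> simp [trunc, hs1, hx, Ex.eval]
  have hQ1 : trunc B (s1.a 7) = fun _ => 0 := by
    funext x
    by_cases hx : x < B <;> simp [trunc, hs1, hx, Ex.eval]
  have hm : min ((Ex.sum 20 (.c 1)).eval B s1.v s1.a) B = B := by
    simp [Ex.eval]
  rw [hm]
  have hloop := iter_induction (f := fun j s => bidCmd.run O B ⟨Function.update s.v 12 j, s.a, s.calls⟩)
    (fun t s' => AuctionFrame s s' ∧
      AuctionInv n (BipR B s.v s.a) (trunc B (s'.a 6)) (trunc B (s'.a 7)) ∧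
      ((∀ i j, ¬ Bid n (BipR B s.v s.a) (trunc B (s'.a 6)) (trunc B (s'.a 7)) i j) ∨
        ∑ j ∈ Finset.range n, trunc B (s'.a 6) j = t)) (m := B) (s := s1) ?_ ?_
  · set s2 := iter (fun j s => bidCmd.run O B ⟨Function.update s.v 12 j, s.a, s.calls⟩) B s1
    obtain ⟨hfr, hinv, hend⟩ := hloop
    -- The loop makes B steps, more than the largest possible sum n(n + 1) of the prices, so the
    -- auction must be over.
    have hstuck : ∀ i j, ¬ Bid n (BipR B s.v s.a) (trunc B (s2.a 6)) (trunc B (s2.a 7)) i j := by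
      rcases hend with h | h
      · exact h
      · have := hinv.sum_le
        rw [h, Nat.mul_add] at this
        omega
    have hv0 : s2.v 0 = n := hfr.v_eq 0 (by norm_num)
    obtain ⟨hk1, hk2, hk3⟩ := Ex.find_spec (B := B) (f := s2.v) (a := s2.a) (x := 24) (y := 20)
      (e := (Ex.lt (.c 0) (.v 20)).and
        (Ex.ex 21 ((Ex.lt (.v 21) (.v 0)).and (Ex.eq (.ar 6 (.v 21)) (.v 20)))).not)
      (R := fun k => 0 < k ∧ ∀ j < n, s2.a 6 j ≠ k) (by
        intro x _ k _
        simp only [Ex.T_and, Ex.T_lt, Ex.T_not, Ex.T_ex, Ex.T_eq, Ex.eval, Function.update_apply]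
        simp only [hv0]
        norm_num
        intro _
        constructor
        · intro h j hj
          exact h j (by omega) hj
        · intro h j _ hj
          exact h j hj)
      (by norm_num)
    set k := (Ex.find 24 20 ((Ex.lt (.c 0) (.v 20)).and
        (Ex.ex 21 ((Ex.lt (.v 21) (.v 0)).and
          (Ex.eq (.ar 6 (.v 21)) (.v 20)))).not)).eval B s2.v s2.a with hk
    have hkn : k ≤ n + 1 := by
      obtain ⟨k', h1, h2, h3⟩ := exists_free_level n (s2.a 6)
      by_contra hlt
      exact hk3 k' (by omega) ⟨h1, h3⟩
    have hkB : k < B := by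
      have : n ≤ n * n + n := by omega
      by_contra hlt
      obtain ⟨k', h1, h2, h3⟩ := exists_free_level n (s2.a 6)
      have h4 := hk3 k'
      have h5 : n ≤ n * n ∨ n = 0 := by
        rcases Nat.eq_zero_or_pos n with h | h
        · exact .inr h
        · exact .inl (Nat.le_mul_of_pos_left n h)
      exact h4 (by omega) ⟨h1, h3⟩
    obtain ⟨-, hk5⟩ := hk2 hkB
    refine ⟨fun x hx => ?_, fun q h5 h6 h7 => ?_, hfr.calls_eq, ?_⟩
    · have : x ≠ 13 := by omega
      simp only [Function.update_of_ne this]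
      exact hfr.v_eq x hx
    · simp only [Function.update_of_ne h5]
      exact hfr.a_eq q h5 h6 h7
    · classical
      refine ⟨Finset.univ.filter fun v : Fin n => k < trunc B (s2.a 6) v ∨
        ∃ j, BipR B s.v s.a v j ∧ trunc B (s2.a 6) j < k, ?_, fun v => ?_⟩
      · refine hinv.isMinVertexCover hRlt ?_ hstuck hkn ?_ ?_ fun v => by simp
        · intro i j l h1 h2
          exact h2.2.2.1 h1.2.2.2.1
        · intro j hj
          rw [trunc_of_lt _ (by omega)]
          exact hk5 j hj
        · intro u v
          have hu : (u : ℕ) < s.v 0 := u.2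
          have hv : (v : ℕ) < s.v 0 := v.2
          simp [St.bipGraph, bipGraph, BipR, hu, hv]
      · have hvn := v.2
        have hvB : (v : ℕ) + 1 < B := by
          have : n ≤ n * n + n := by omega
          omega
        rw [Finset.mem_filter]
        simp only [Finset.mem_univ, true_and, Function.update_self, if_pos hvB]
        change _ ↔ Ex.T _ _ _ _
        rw [Ex.T_ex]
        have hval : ∀ x y, (Function.update (Function.update (Function.update s2.v 13 k) 20 x) 21 y)
            0 = s2.v 0 := fun x y => by simp
        have hR : ∀ x y z, BipR B (Function.update (Function.update (Function.update
            (Function.update s2.v 13 k) 20 x) 21 y) 22 z) s2.a = BipR B s.v s.a := fun x y z => by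
          rw [← hfr.bipR]
          exact BipR.congr (by simp) rfl rfl rfl
        simp only [Ex.T_and, Ex.T_or, Ex.T_lt, Ex.T_eq, Ex.T_ex, Ex.eval,
          T_bipE (show 21 ≠ 30 by norm_num), hR]
        simp only [Function.update_apply]
        norm_num
        rw [trunc_of_lt _ (show (v : ℕ) < B by omega)]
        constructor
        · intro h
          refine ⟨v, by omega, rfl, h.imp_right ?_⟩
          rintro ⟨j, h1, h2⟩
          have hjB := lt_of_lt_of_le h1.2.1 hnB
          rw [trunc_of_lt _ hjB] at h2
          exact ⟨j, hjB, h1, h2⟩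
        · rintro ⟨j, -, h1, h2⟩
          obtain rfl : j = v := by omega
          refine h2.imp_right ?_
          rintro ⟨j, h1, h2, h3⟩
          exact ⟨j, h2, by rwa [trunc_of_lt _ h1]⟩
  · refine ⟨⟨fun _ _ => rfl, fun k _ h6 h7 => ?_, rfl⟩, ?_, .inr ?_⟩
    · simp [hs1, h6, h7]
    · rw [hP1, hQ1]
      exact .init _ _
    · rw [hP1]; simp
  · rintro j hj s' ⟨hfr, hinv, hend⟩
    have hfr' : AuctionFrame s ⟨Function.update s'.v 12 j, s'.a, s'.calls⟩ := by
      refine ⟨fun x hx => ?_, hfr.a_eq, hfr.calls_eq⟩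
      have : x ≠ 12 := by omega
      simp only [Function.update_of_ne this]
      exact hfr.v_eq x hx
    have hv0 : Function.update s'.v 12 j 0 = n := hfr'.v_eq 0 (by norm_num)
    have hR := hfr'.bipR B
    rw [← hR] at hinv hend ⊢
    rw [← hv0] at hinv hend ⊢
    obtain ⟨h1, h2⟩ := run_bidCmd O (s := ⟨Function.update s'.v 12 j, s'.a, s'.calls⟩)
      (by simp only [hv0]; exact hnB) hinv hend rfl
    exact ⟨⟨fun x hx => (h1.v_eq x hx).trans (hfr'.v_eq x hx),
      fun k q5 q6 q7 => (h1.a_eq k q5 q6 q7).trans (hfr'.a_eq k q5 q6 q7),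
      h1.calls_eq.trans hfr'.calls_eq⟩, h2⟩

end SplitUIG

namespace SplitUIG

/-! ### Finding a split partition

The vertices are added one by one. Two split partitions of a graph differ in at most one vertex of
the clique and one of the independent set. -/

/-- `C` is the clique side of a split partition of the first `m` vertices. -/
def PrefixOK (E : ℕ → ℕ → Prop) (m : ℕ) (C : ℕ → Prop) : Prop :=
  ∀ u < m, ∀ v < m, u ≠ v → (C u → C v → E u v) ∧ (¬ C u → ¬ C v → ¬ E u v)

/-- Move the elements `x`, `y`, `z` to the other side. -/
def Toggle (C : ℕ → Prop) (x y z w : ℕ) : Prop :=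
  ((w = x ∨ w = y ∨ w = z) ∧ ¬ C w) ∨ (¬ (w = x ∨ w = y ∨ w = z) ∧ C w)

/-- The value j + 1 codes absence and lies outside the prefix under consideration. Avoiding j leaves
the side of the new vertex to a separate index. -/
theorem exists_index_lt {j : ℕ} {R : ℕ → Prop}
    (h : ∀ u < j, ∀ v < j, R u → R v → u = v) :
    ∃ x < j + 2, x ≠ j ∧ ∀ w < j, R w ↔ w = x := by
  by_cases h' : ∃ u < j, R u
  · obtain ⟨u, hu, hR⟩ := h'
    exact ⟨u, by omega, by omega, fun w hw => ⟨fun hw' => h w hw u hu hw' hR, fun e => e ▸ hR⟩⟩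
  · push Not at h'
    exact ⟨j + 1, by omega, by omega, fun w hw => ⟨fun hR => absurd hR (h' w hw), by omega⟩⟩

/-- Two vertices on the clique side of one partition and the independent side of another would be
both adjacent and nonadjacent. So any partition of the longer prefix arises from the known one by at
most one move in each direction and a choice for the new vertex, which leaves only polynomially many
candidates. -/
theorem PrefixOK.exists_toggle {E : ℕ → ℕ → Prop} {j : ℕ} {C C' : ℕ → Prop} (h : PrefixOK E j C)
    (h' : PrefixOK E (j + 1) C') :
    ∃ x < j + 2, ∃ y < j + 2, ∃ z < j + 2, PrefixOK E (j + 1) (Toggle C x y z) := by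
  obtain ⟨x, hx, hxj, hx'⟩ := exists_index_lt (j := j) (R := fun w => C w ∧ ¬ C' w) (by
    rintro u hu v hv ⟨h1, h2⟩ ⟨h3, h4⟩
    by_contra huv
    exact (h' u (by omega) v (by omega) huv).2 h2 h4 ((h u hu v hv huv).1 h1 h3))
  obtain ⟨y, hy, hyj, hy'⟩ := exists_index_lt (j := j) (R := fun w => ¬ C w ∧ C' w) (by
    rintro u hu v hv ⟨h1, h2⟩ ⟨h3, h4⟩
    by_contra huv
    exact (h u hu v hv huv).2 h1 h3 ((h' u (by omega) v (by omega) huv).1 h2 h4))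
  obtain ⟨z, hz, hz'⟩ : ∃ z < j + 2, (z = j ∨ z = j + 1) ∧ ((C j ↔ C' j) ↔ z ≠ j) := by
    by_cases hj : C j ↔ C' j
    · exact ⟨j + 1, by omega, .inr rfl, by simp [hj]⟩
    · exact ⟨j, by omega, .inl rfl, by simp [hj]⟩
  have key : ∀ w < j + 1, Toggle C x y z w ↔ C' w := by
    intro w hw
    unfold Toggle
    rcases (Nat.lt_succ_iff.1 hw).lt_or_eq with hw | rfl
    · have h1 := hx' w hw
      have h2 := hy' w hw
      have h3 : w ≠ z := by omega
      grind
    · have h1 : w ≠ x := Ne.symm hxj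
      have h2 : w ≠ y := Ne.symm hyj
      have h3 := hz'.2
      rw [ne_comm] at h3
      grind
  refine ⟨x, hx, y, hy, z, hz, fun u hu v hv huv => ?_⟩
  rw [key u hu, key v hv]
  exact h' u hu v hv huv

/-- The clique side, kept in the array `1`, after toggling the variables `2`, `3`, `4`. -/
def toggleE (w : ℕ) : Ex :=
  .ite ((Ex.eq (.v w) (.v 2)).or <| (Ex.eq (.v w) (.v 3)).or (Ex.eq (.v w) (.v 4)))
    (Ex.ar 1 (.v w)).not (.ar 1 (.v w))

/-- The toggled side is correct on the vertices up to the variable `1`. -/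
def prefixE : Ex :=
  .all 21 <| .all 22 <| (Ex.lt (.v 1) (.v 21)).or <| (Ex.lt (.v 1) (.v 22)).or <|
    (Ex.eq (.v 21) (.v 22)).or <|
    ((toggleE 21).not.or <| (toggleE 22).not.or (adjE 21 22)).and
      ((toggleE 21).or <| (toggleE 22).or (adjE 21 22).not)

/-- Find a split partition. -/
def splitCmd : Cmd :=
  .seq (.seta 1 20 (.c 0)) <| .loop 1 (.v 0) <|
    .seq (.setv 2 (.find 24 2 (.ex 3 (.ex 4 prefixE)))) <|
    .seq (.setv 3 (.find 24 3 (.ex 4 prefixE))) <|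
    .seq (.setv 4 (.find 24 4 prefixE)) (.seta 1 20 (toggleE 20))

theorem Ex.T_ite {B : ℕ} {f : ℕ → ℕ} {a : Fin 16 → ℕ → ℕ} {e e' e'' : Ex} :
    (Ex.ite e e' e'').T B f a ↔ (e.T B f a ∧ e'.T B f a) ∨ (¬ e.T B f a ∧ e''.T B f a) := by
  simp only [Ex.T, Ex.eval]
  split_ifs with h <;> simp [h]

theorem T_toggleE {B : ℕ} {f : ℕ → ℕ} {a : Fin 16 → ℕ → ℕ} {w : ℕ} :
    (toggleE w).T B f a ↔ Toggle (fun x => a 1 x ≠ 0) (f 2) (f 3) (f 4) (f w) := by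
  simp only [toggleE, Ex.T_ite, Ex.T_or, Ex.T_eq, Ex.T_not, Ex.T_ar, Ex.eval, Toggle]

theorem T_prefixE {B : ℕ} {f : ℕ → ℕ} {a : Fin 16 → ℕ → ℕ} (h : f 1 < B) :
    prefixE.T B f a ↔ PrefixOK (AdjR B (f 0) (a 0)) (f 1 + 1)
      (Toggle (fun x => a 1 x ≠ 0) (f 2) (f 3) (f 4)) := by
  simp only [prefixE, Ex.T_all, Ex.T_or, Ex.T_and, Ex.T_not, Ex.T_lt, Ex.T_eq, T_toggleE,
    T_adjE (show 21 ≠ 30 by norm_num), Ex.eval, Function.update_apply, PrefixOK]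
  norm_num
  constructor
  · intro H u hu v hv huv
    have := H u (by omega) v (by omega)
    have h1 : ¬ f 1 < u := by omega
    have h2 : ¬ f 1 < v := by omega
    grind
  · intro H u hu v hv
    by_cases h1 : f 1 < u
    · exact .inl h1
    by_cases h2 : f 1 < v
    · exact .inr (.inl h2)
    by_cases h3 : u = v
    · exact .inr (.inr (.inl h3))
    have := H u (by omega) v (by omega) h3
    grind

/-- What the search for a split partition leaves unchanged. -/
structure SplitFrame (s s' : St) : Prop where
  v_eq : s'.v 0 = s.v 0
  a_eq : ∀ k, k ≠ 1 → s'.a k = s.a k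
  calls_eq : s'.calls = s.calls

/-- A partition of the whole graph restricts to each prefix, so each stage has a candidate and the
three nested searches find one. For a graph that is not split the result is arbitrary, and the
decision procedure has to test it. -/
theorem run_splitCmd (O : List Bool → List Bool) {B : ℕ} (s : St) (hB : s.v 0 + 2 ≤ B) :
    SplitFrame s (splitCmd.run O B s) ∧ ∀ C, PrefixOK (AdjR B (s.v 0) (s.a 0)) (s.v 0) C →
      PrefixOK (AdjR B (s.v 0) (s.a 0)) (s.v 0) (fun x => (splitCmd.run O B s).a 1 x ≠ 0) := by
  set n := s.v 0 with hn
  set E := AdjR B n (s.a 0) with hE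
  simp only [splitCmd]
  rw [Cmd.run]
  set s1 : St := (Cmd.seta 1 20 (.c 0)).run O B s with hs1
  rw [Cmd.run]
  have hm : min ((Ex.v 0).eval B s1.v s1.a) B = n := by
    change min (s.v 0) B = n
    omega
  rw [hm]
  have hloop := iter_induction (f := fun j s => ((Cmd.setv 2 (.find 24 2 (.ex 3 (.ex 4 prefixE)))).seq <|
    .seq (.setv 3 (.find 24 3 (.ex 4 prefixE))) <|
    .seq (.setv 4 (.find 24 4 prefixE)) (.seta 1 20 (toggleE 20))).run O B
      ⟨Function.update s.v 1 j, s.a, s.calls⟩)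
    (fun j s' => SplitFrame s s' ∧ ∀ C, PrefixOK E n C → PrefixOK E j fun x => s'.a 1 x ≠ 0)
    (m := n) (s := s1) ?_ ?_
  · exact hloop
  · refine ⟨⟨rfl, fun k hk => ?_, rfl⟩, fun C _ u hu => absurd hu (Nat.not_lt_zero u)⟩
    simp [hs1, Cmd.run, hk]
  · rintro j hj s' ⟨⟨hv, ha, hc⟩, hok⟩
    set f := Function.update s'.v 1 j with hf
    have hj1 : ∀ g : ℕ → ℕ, g 1 = j → g 1 < B := fun g hg => by omega
    have hf0 : f 0 = n := by simp [hf, hv, hn]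
    have hf1 : f 1 = j := by simp [hf]
    have ha0 : s'.a 0 = s.a 0 := ha 0 (by decide)
    set R : ℕ → ℕ → ℕ → Prop := fun x y z =>
      PrefixOK E (j + 1) (Toggle (fun x => s'.a 1 x ≠ 0) x y z) with hR
    have hT : ∀ g : ℕ → ℕ, g 0 = n → g 1 = j → (prefixE.T B g s'.a ↔ R (g 2) (g 3) (g 4)) := by
      intro g h0 h1
      rw [T_prefixE (by omega), h0, h1, ha0]
    obtain ⟨-, hx2, hx3⟩ := Ex.find_spec (B := B) (f := f) (a := s'.a) (x := 24) (y := 2)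
      (e := .ex 3 (.ex 4 prefixE)) (R := fun x => ∃ y < B, ∃ z < B, R x y z) (by
        intro _ _ x _
        simp only [Ex.T_ex]
        refine exists_congr fun y => and_congr_right fun _ => exists_congr fun z =>
          and_congr_right fun _ => ?_
        rw [hT _ (by simp [hf0]) (by simp [hf1])]
        simp) (by norm_num)
    set x := (Ex.find 24 2 (.ex 3 (.ex 4 prefixE))).eval B f s'.a with hx
    obtain ⟨-, hy2, hy3⟩ := Ex.find_spec (B := B) (f := Function.update f 2 x) (a := s'.a) (x := 24)
      (y := 3) (e := .ex 4 prefixE) (R := fun y => ∃ z < B, R x y z) (by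
        intro _ _ y _
        simp only [Ex.T_ex]
        refine exists_congr fun z => and_congr_right fun _ => ?_
        rw [hT _ (by simp [hf0]) (by simp [hf1])]
        simp) (by norm_num)
    set y := (Ex.find 24 3 (.ex 4 prefixE)).eval B (Function.update f 2 x) s'.a with hy
    obtain ⟨-, hz2, hz3⟩ := Ex.find_spec (B := B)
      (f := Function.update (Function.update f 2 x) 3 y) (a := s'.a) (x := 24)
      (y := 4) (e := prefixE) (R := fun z => R x y z) (by
        intro _ _ z _
        rw [hT _ (by simp [hf0]) (by simp [hf1])]
        simp) (by norm_num)
    set z := (Ex.find 24 4 prefixE).eval B (Function.update (Function.update f 2 x) 3 y) s'.a with hz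
    change SplitFrame s ((Cmd.seta 1 20 (toggleE 20)).run O B ⟨Function.update (Function.update
      (Function.update f 2 x) 3 y) 4 z, s'.a, s'.calls⟩) ∧ ∀ C, PrefixOK E n C →
      PrefixOK E (j + 1) fun w => ((Cmd.seta 1 20 (toggleE 20)).run O B ⟨Function.update
      (Function.update (Function.update f 2 x) 3 y) 4 z, s'.a, s'.calls⟩).a 1 w ≠ 0
    refine ⟨⟨?_, fun k hk => ?_, hc⟩, fun C hC => ?_⟩
    · simp [Cmd.run, hf0, hn]
    · simp only [Cmd.run, Function.update_of_ne hk]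
      exact ha k hk
    · obtain ⟨x', hx', y', hy', z', hz', h⟩ := (hok C hC).exists_toggle (C' := C)
        (fun u hu v hv => hC u (by omega) v (by omega))
      have hxB : x < B := by
        by_contra hlt
        exact hx3 x' (by omega) ⟨y', by omega, z', by omega, h⟩
      obtain ⟨y', hy', z', hz', h⟩ := hx2 hxB
      have hyB : y < B := by
        by_contra hlt
        exact hy3 y' (by omega) ⟨z', by omega, h⟩
      obtain ⟨z', hz', h⟩ := hy2 hyB
      have hzB : z < B := by
        by_contra hlt
        exact hz3 z' (by omega) h
      have hfin := hz2 hzB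
      have hval : ∀ w < B, ((Cmd.seta 1 20 (toggleE 20)).run O B ⟨Function.update (Function.update
          (Function.update f 2 x) 3 y) 4 z, s'.a, s'.calls⟩).a 1 w ≠ 0 ↔
          Toggle (fun x => s'.a 1 x ≠ 0) x y z w := by
        intro w hw
        simp only [Cmd.run, Function.update_self, if_pos hw]
        refine T_toggleE.trans ?_
        simp
      intro u hu v hv huv
      have h := hfin u hu v hv huv
      rw [← hval u (by omega), ← hval v (by omega)] at h
      exact h

end SplitUIG

namespace SplitUIG

/-! ### The search over all guesses

The guess is in the variables `1`, `2`, `3`, the size of the best solution found so far in the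
variable `4`, and the solution itself in the array `9`. -/

/-- The variable `w` is a neighbour of the guess in the variable `i`. -/
def nbrE (i w : ℕ) : Ex :=
  (Ex.lt (.v i) (.v 0)).and <| (Ex.ar 1 (.v i)).not.and (adjE i w)

/-- The variable `20` is forced into the solution. -/
def forcedE : Ex :=
  (Ex.ar 1 (.v 20)).and <| .ite (Ex.eq (.v 3) (.add (.v 0) (.c 1)))
    ((nbrE 1 20).not.and (nbrE 2 20).not)
    (((Ex.lt (.v 2) (.v 0)).and <| (Ex.ar 1 (.v 2)).not.and (adjE 2 20).not).or
      ((nbrE 1 20).and (nbrE 3 20)))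

/-- The variable `20` is active. -/
def activeE : Ex :=
  ((Ex.ar 1 (.v 20)).and forcedE.not).or <| (Ex.ar 1 (.v 20)).not.and <|
    (Ex.eq (.v 20) (.v 1)).not.and <| (Ex.eq (.v 20) (.v 2)).not.and (Ex.eq (.v 20) (.v 3)).not

/-- The variable `20` belongs to the candidate. -/
def candE : Ex :=
  (Ex.lt (.v 20) (.v 0)).and ((Ex.ar 3 (.v 20)).or (.ar 5 (.add (.v 20) (.c 1))))

/-- Replace the best solution by the candidate in the array `8` if that one is smaller. -/
def keepCmd : Cmd :=
  .seq (.setv 5 (.sum 20 (.ite (.ar 8 (.v 20)) (.c 1) (.c 0)))) <|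
  .ite (.lt (.v 5) (.v 4))
    (.seq (.seta 9 20 (.ar 8 (.v 20))) (.setv 4 (.v 5))) (.setv 5 (.v 5))

/-- Treat one guess, with the help of a vertex cover subroutine. -/
def guessCmd (V : Cmd) : Cmd :=
  .seq (.seta 3 20 forcedE) <| .seq (.seta 4 20 activeE) <| .seq V <|
  .seq (.seta 8 20 candE) keepCmd

/-- Find a minimum solution. -/
def searchCmd (V : Cmd) : Cmd :=
  .seq (.setv 4 (.add (.v 0) (.c 1))) <|
  .loop 1 (.add (.v 0) (.c 1)) <| .loop 2 (.add (.v 0) (.c 1)) <| .loop 3 (.add (.v 0) (.c 2)) <|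
  guessCmd V

theorem T_nbrE {B : ℕ} {f : ℕ → ℕ} {a : Fin 16 → ℕ → ℕ} {i w : ℕ} (hi : i ≠ 30) :
    (nbrE i w).T B f a ↔ Nbr (f 0) (AdjR B (f 0) (a 0)) (fun x => a 1 x ≠ 0) (f i) (f w) := by
  simp only [nbrE, Ex.T_and, Ex.T_lt, Ex.T_not, Ex.T_ar, T_adjE hi, Ex.eval, Nbr]

theorem T_forcedE {B : ℕ} {f : ℕ → ℕ} {a : Fin 16 → ℕ → ℕ} :
    forcedE.T B f a ↔ Forced (f 0) (AdjR B (f 0) (a 0)) (fun x => a 1 x ≠ 0)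
      (f 1) (f 2) (f 3) (f 20) := by
  simp only [forcedE, Ex.T_and, Ex.T_or, Ex.T_ite, Ex.T_lt, Ex.T_eq, Ex.T_not, Ex.T_ar,
    T_nbrE (show 1 ≠ 30 by norm_num), T_nbrE (show 2 ≠ 30 by norm_num),
    T_nbrE (show 3 ≠ 30 by norm_num), T_adjE (show 2 ≠ 30 by norm_num), Ex.eval, Forced]
  split_ifs with h <;> simp [h]

theorem T_activeE {B : ℕ} {f : ℕ → ℕ} {a : Fin 16 → ℕ → ℕ} :
    activeE.T B f a ↔ Active (f 0) (AdjR B (f 0) (a 0)) (fun x => a 1 x ≠ 0)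
      (f 1) (f 2) (f 3) (f 20) := by
  simp only [activeE, Ex.T_and, Ex.T_or, Ex.T_eq, Ex.T_not, Ex.T_ar, T_forcedE, Ex.eval, Active]

theorem bipGraph_congr {n : ℕ} {E : ℕ → ℕ → Prop} {C A A' : ℕ → Prop}
    (h : ∀ v < n, A v ↔ A' v) : bipGraph n E C A = bipGraph n E C A' := by
  ext u v
  simp only [bipGraph, Bip, h u u.2, h v v.2]

/-- The invariant of the search: `n` and the arrays `0` and `1` keep their values; the array `9`
holds a solution of the size in the variable `4`, if this is at most `n`; and no solution that
fits a guess in `Done` is smaller. -/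
structure SearchInv {n : ℕ} (G : SimpleGraph (Fin n)) (inp cl : ℕ → ℕ) (E : ℕ → ℕ → Prop)
    (Done : ℕ → ℕ → ℕ → Prop) (s : St) : Prop where
  v0 : s.v 0 = n
  a0 : s.a 0 = inp
  a1 : s.a 1 = cl
  sound : s.v 4 ≤ n → ∃ S : Finset (Fin n), IsSolution G S ∧ S.card = s.v 4 ∧
    ∀ v : Fin n, v ∈ S ↔ s.a 9 v ≠ 0
  least : ∀ a b c, Done a b c → ∀ T : Finset (Fin n),
    (∀ v : Fin n, Forced n E (fun x => cl x ≠ 0) a b c v → v ∈ T) →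
    (bipGraph n E (fun x => cl x ≠ 0) (Active n E (fun x => cl x ≠ 0) a b c)).IsVertexCover
      (T : Set (Fin n)) → s.v 4 ≤ T.card

theorem SearchInv.mono {n : ℕ} {G : SimpleGraph (Fin n)} {inp cl : ℕ → ℕ} {E : ℕ → ℕ → Prop}
    {Done Done' : ℕ → ℕ → ℕ → Prop} {s : St} (h : SearchInv G inp cl E Done s)
    (h' : ∀ a b c, Done' a b c → Done a b c) : SearchInv G inp cl E Done' s :=
  ⟨h.v0, h.a0, h.a1, h.sound, fun a b c hd => h.least a b c (h' a b c hd)⟩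

theorem SearchInv.setv {n : ℕ} {G : SimpleGraph (Fin n)} {inp cl : ℕ → ℕ} {E : ℕ → ℕ → Prop}
    {Done : ℕ → ℕ → ℕ → Prop} {s : St} (h : SearchInv G inp cl E Done s) {x : ℕ} (hx : x ≠ 0)
    (hx' : x ≠ 4) (k : ℕ) :
    SearchInv G inp cl E Done ⟨Function.update s.v x k, s.a, s.calls⟩ := by
  have h4 : Function.update s.v x k 4 = s.v 4 := Function.update_of_ne (Ne.symm hx') _ _
  refine ⟨by rw [← h.v0]; exact Function.update_of_ne (Ne.symm hx) _ _, h.a0, h.a1, ?_, ?_⟩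
  · simp only [h4]
    exact h.sound
  · simp only [h4]
    exact h.least

theorem sum_ite_eq_card {n B : ℕ} (hB : n ≤ B) {g : ℕ → ℕ} {S : Finset (Fin n)}
    (hg : ∀ i < B, g i ≠ 0 ↔ ∃ h : i < n, (⟨i, h⟩ : Fin n) ∈ S) :
    ∑ i ∈ Finset.range B, (if g i ≠ 0 then 1 else 0) = S.card := by
  rw [← Finset.card_filter]
  symm
  refine Finset.card_bij (fun v _ => (v : ℕ)) ?_ (fun u _ v _ h => Fin.ext h) ?_
  · intro v hv
    rw [Finset.mem_filter, Finset.mem_range]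
    have : (v : ℕ) < B := lt_of_lt_of_le v.2 hB
    exact ⟨this, (hg v this).2 ⟨v.2, hv⟩⟩
  · intro i hi
    rw [Finset.mem_filter, Finset.mem_range] at hi
    obtain ⟨h, hS⟩ := (hg i hi.1).1 hi.2
    exact ⟨⟨i, h⟩, hS, rfl⟩

theorem run_keepCmd (O : List Bool → List Bool) {B n : ℕ} {G : SimpleGraph (Fin n)}
    {inp cl : ℕ → ℕ} {E : ℕ → ℕ → Prop} {Done : ℕ → ℕ → ℕ → Prop} {s : St} (hB : n ≤ B)
    (h : SearchInv G inp cl E Done s) {S : Finset (Fin n)} (hS : IsSolution G S)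
    (hS' : ∀ i < B, s.a 8 i ≠ 0 ↔ ∃ h : i < n, (⟨i, h⟩ : Fin n) ∈ S) :
    SearchInv G inp cl E Done (keepCmd.run O B s) ∧ (keepCmd.run O B s).v 4 ≤ S.card ∧
      (keepCmd.run O B s).calls = s.calls ∧ ∀ x < 4, (keepCmd.run O B s).v x = s.v x := by
  have hsum : (Ex.sum 20 (.ite (.ar 8 (.v 20)) (.c 1) (.c 0))).eval B s.v s.a = S.card := by
    rw [← sum_ite_eq_card hB hS']
    simp [Ex.eval]
  have hrun : keepCmd.run O B s = (Cmd.ite (.lt (.v 5) (.v 4))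
    (.seq (.seta 9 20 (.ar 8 (.v 20))) (.setv 4 (.v 5))) (.setv 5 (.v 5))).run O B
      ⟨Function.update s.v 5 S.card, s.a, s.calls⟩ := by
    rw [← hsum]; rfl
  rw [hrun]
  have h' := h.setv (x := 5) (by norm_num) (by norm_num) S.card
  have hcond : (Ex.lt (.v 5) (.v 4)).T B (Function.update s.v 5 S.card) s.a ↔ S.card < s.v 4 := by
    rw [Ex.T_lt]
    simp [Ex.eval]
  by_cases hlt : S.card < s.v 4
  · rw [Cmd.run_ite_pos (hcond.2 hlt)]
    refine ⟨⟨?_, ?_, ?_, fun _ => ⟨S, hS, ?_, fun v => ?_⟩, fun a b c hd T hT hT' => ?_⟩, ?_, rfl, fun x hx => ?_⟩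
    · simp [Cmd.run, h.v0]
    · simp [Cmd.run, h.a0]
    · simp [Cmd.run, h.a1]
    · simp [Cmd.run, Ex.eval]
    · have hv : (v : ℕ) < B := lt_of_lt_of_le v.2 hB
      have := hS' v hv
      simp only [Cmd.run, Ex.eval, Function.update_self, if_pos hv, this, Fin.eta]
      exact ⟨fun h => ⟨v.2, h⟩, fun ⟨_, h⟩ => h⟩
    · have := h.least a b c hd T hT hT'
      simp only [Cmd.run, Ex.eval, Function.update_self]
      omega
    · simp [Cmd.run, Ex.eval]
    · have h4 : x ≠ 4 := by omega
      have h5 : x ≠ 5 := by omega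
      simp [Cmd.run, h4, h5]
  · rw [Cmd.run_ite_neg fun hc => hlt (hcond.1 hc)]
    refine ⟨h'.setv (by norm_num) (by norm_num) _, ?_, rfl, fun x hx => ?_⟩
    · simp only [Cmd.run]
      simp
      omega
    · have h5 : x ≠ 5 := by omega
      simp [Cmd.run, h5]

/-- The subroutine V enters only through `CoverSpec`, so one search serves both the auction (δ = 0)
and the oracle (δ = 1). The candidate is a solution for every guess, sensible or not; its optimality
is claimed only against solutions fitting this guess. -/
theorem run_guessCmd (O : List Bool → List Bool) {B δ n : ℕ} {V : Cmd}
    (hV : ∀ s : St, s.v 0 * s.v 0 + s.v 0 + 2 ≤ B → CoverSpec B δ s (V.run O B s))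
    (hB : n * n + n + 2 ≤ B) {G : SimpleGraph (Fin n)} {inp cl : ℕ → ℕ}
    (hE : ∀ u v : Fin n, G.Adj u v ↔ AdjR B n inp u v)
    (hI : ∀ u v : Fin n, ¬ cl u ≠ 0 → ¬ cl v ≠ 0 → ¬ G.Adj u v)
    (hC : ∀ u v : Fin n, cl u ≠ 0 → cl v ≠ 0 → u ≠ v → G.Adj u v)
    {Done : ℕ → ℕ → ℕ → Prop} {s : St} (h : SearchInv G inp cl (AdjR B n inp) Done s) :
    SearchInv G inp cl (AdjR B n inp)
      (fun a b c => Done a b c ∨ (a = s.v 1 ∧ b = s.v 2 ∧ c = s.v 3)) ((guessCmd V).run O B s) ∧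
      ((guessCmd V).run O B s).calls = s.calls + δ ∧
      ∀ x < 4, ((guessCmd V).run O B s).v x = s.v x := by
  classical
  have hnB : n + 1 < B := by have := Nat.zero_le (n * n); omega
  set E := AdjR B n inp with hEdef
  set C : ℕ → Prop := fun x => cl x ≠ 0 with hCdef
  set s1 : St := (Cmd.seta 4 20 activeE).run O B ((Cmd.seta 3 20 forcedE).run O B s) with hs1
  have hv1 : s1.v = s.v := rfl
  have ha1 : ∀ k, k ≠ 3 → k ≠ 4 → s1.a k = s.a k := fun k h3 h4 => by
    simp [hs1, Cmd.run, h3, h4]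
  have ha3 : ∀ w < B, s1.a 3 w ≠ 0 ↔ Forced n E C (s.v 1) (s.v 2) (s.v 3) w := by
    intro w hw
    have : s1.a 3 w = forcedE.eval B (Function.update s.v 20 w) s.a := by
      simp [hs1, Cmd.run, hw]
    rw [this]
    refine T_forcedE.trans ?_
    simp [h.v0, h.a0, h.a1, hEdef, hCdef]
  have ha4 : ∀ w < B, s1.a 4 w ≠ 0 ↔ Active n E C (s.v 1) (s.v 2) (s.v 3) w := by
    intro w hw
    have : s1.a 4 w = activeE.eval B (Function.update s.v 20 w)
        ((Cmd.seta 3 20 forcedE).run O B s).a := by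
      simp [hs1, Cmd.run, hw]
    rw [this]
    refine T_activeE.trans ?_
    simp [Cmd.run, h.v0, h.a0, h.a1, hEdef, hCdef]
  have hspec := hV s1 (by rw [hv1, h.v0]; exact hB)
  set s2 : St := V.run O B s1 with hs2
  obtain ⟨hv2, ha2, hc2, hcov⟩ := hspec
  have h2 : SearchInv G inp cl E Done s2 := by
    have e4 : s2.v 4 = s.v 4 := hv2 4 (by norm_num)
    have e9 : s2.a 9 = s.a 9 := (ha2 9 (by decide) (by decide) (by decide)).trans
      (ha1 9 (by decide) (by decide))
    refine ⟨(hv2 0 (by norm_num)).trans h.v0, ?_, ?_, ?_, ?_⟩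
    · rw [ha2 0 (by decide) (by decide) (by decide), ha1 0 (by decide) (by decide), h.a0]
    · rw [ha2 1 (by decide) (by decide) (by decide), ha1 1 (by decide) (by decide), h.a1]
    · rw [e4, e9]; exact h.sound
    · rw [e4]; exact h.least
  have hcov' : ∃ X : Finset (Fin n),
      IsMinVertexCover (bipGraph n E C (Active n E C (s.v 1) (s.v 2) (s.v 3))) X ∧
      ∀ v : Fin n, v ∈ X ↔ s2.a 5 (v + 1) ≠ 0 := by
    have e0 : s1.a 0 = inp := by rw [ha1 0 (by decide) (by decide), h.a0]
    have e1 : s1.a 1 = cl := by rw [ha1 1 (by decide) (by decide), h.a1]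
    -- The cover lives on `Fin (s1.v 0)`; the number of vertices is generalised to transport it to
    -- `Fin n`.
    have hgen : ∀ m, s1.v 0 = m → ∃ X : Finset (Fin m),
        IsMinVertexCover (bipGraph m (AdjR B m (s1.a 0)) (fun x => s1.a 1 x ≠ 0)
          (fun x => s1.a 4 x ≠ 0)) X ∧ ∀ v : Fin m, v ∈ X ↔ s2.a 5 (v + 1) ≠ 0 := by
      rintro m rfl
      exact hcov
    have := hgen n h.v0
    rw [e0, e1, bipGraph_congr fun v hv => ha4 v (by omega)] at this
    exact this
  obtain ⟨X, hX, hX'⟩ := hcov'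
  set S : Finset (Fin n) := Finset.univ.filter fun v : Fin n =>
    Forced n E C (s.v 1) (s.v 2) (s.v 3) v ∨ v ∈ X with hSdef
  have hS : ∀ v, v ∈ S ↔ Forced n E C (s.v 1) (s.v 2) (s.v 3) v ∨ v ∈ X := fun v => by
    simp [hSdef]
  set s3 : St := (Cmd.seta 8 20 candE).run O B s2 with hs3
  have h3 : SearchInv G inp cl E Done s3 := by
    have e9 : s3.a 9 = s2.a 9 := by simp [hs3, Cmd.run]
    refine ⟨h2.v0, ?_, ?_, ?_, h2.least⟩
    · rw [← h2.a0]; simp [hs3, Cmd.run]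
    · rw [← h2.a1]; simp [hs3, Cmd.run]
    · rw [e9]; exact h2.sound
  have hrun : (guessCmd V).run O B s = keepCmd.run O B s3 := rfl
  rw [hrun]
  obtain ⟨k1, k2, k3, k4⟩ := run_keepCmd O (B := B) (by omega) h3
    (isSolution_of_guess hE hI hC hX.1 hS) (by
      intro i hi
      have : s3.a 8 i = candE.eval B (Function.update s2.v 20 i) s2.a := by
        simp [hs3, Cmd.run, hi]
      rw [this]
      change candE.T _ _ _ ↔ _
      simp only [candE, Ex.T_and, Ex.T_lt, Ex.T_or, Ex.T_ar, Ex.eval, Function.update_self]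
      have e0 : Function.update s2.v 20 i 0 = n := by simp [h2.v0]
      rw [e0, ha2 3 (by decide) (by decide) (by decide), ha3 i hi]
      constructor
      · rintro ⟨hin, h⟩
        exact ⟨hin, (hS _).2 (h.imp_right fun h => (hX' ⟨i, hin⟩).2 h)⟩
      · rintro ⟨hin, h⟩
        exact ⟨hin, ((hS _).1 h).imp_right fun h => (hX' ⟨i, hin⟩).1 h⟩)
  refine ⟨⟨k1.v0, k1.a0, k1.a1, k1.sound, ?_⟩, by rw [k3]; exact hc2,
    fun x hx => (k4 x hx).trans (hv2 x (by omega))⟩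
  rintro a b c (hd | ⟨rfl, rfl, rfl⟩) T hT hT'
  · exact k1.least a b c hd T hT hT'
  · exact k2.trans (card_le_of_guess hX hS hT hT')

theorem isSolution_univ {n : ℕ} (G : SimpleGraph (Fin n)) : IsSolution G Finset.univ :=
  ⟨1, fun _ => 0, one_pos, fun u => absurd (Finset.mem_univ u.1) u.2⟩

/-- The three loops cover the range of guesses promised by `exists_guess`, so the stored size ends
up at most that of any solution, while the invariant keeps it the size of an actual one. -/
theorem run_searchCmd (O : List Bool → List Bool) {B δ n : ℕ} {V : Cmd}
    (hV : ∀ s : St, s.v 0 * s.v 0 + s.v 0 + 2 ≤ B → CoverSpec B δ s (V.run O B s))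
    (hB : n * n + n + 2 ≤ B) {G : SimpleGraph (Fin n)} {s : St} (hn : s.v 0 = n)
    (hE : ∀ u v : Fin n, G.Adj u v ↔ AdjR B n (s.a 0) u v)
    (hI : ∀ u v : Fin n, ¬ s.a 1 u ≠ 0 → ¬ s.a 1 v ≠ 0 → ¬ G.Adj u v)
    (hC : ∀ u v : Fin n, s.a 1 u ≠ 0 → s.a 1 v ≠ 0 → u ≠ v → G.Adj u v)
    {s' : St} (hs' : (searchCmd V).run O B s = s') :
    s'.v 0 = n ∧ s'.a 0 = s.a 0 ∧ s'.a 1 = s.a 1 ∧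
      s'.calls = s.calls + (n + 1) * ((n + 1) * ((n + 2) * δ)) ∧
      ∃ S : Finset (Fin n), IsMinSolution G S ∧ S.card = s'.v 4 ∧
        ∀ v : Fin n, v ∈ S ↔ s'.a 9 v ≠ 0 := by
  set s1 : St := (Cmd.setv 4 (.add (.v 0) (.c 1))).run O B s with hs1
  have hv4 : s1.v 4 = n + 1 := by simp [hs1, Cmd.run, Ex.eval, hn]
  have hnB : n + 2 ≤ B := by have := Nat.zero_le (n * n); omega
  set Inv : (ℕ → ℕ → ℕ → Prop) → St → Prop := SearchInv G (s.a 0) (s.a 1) (AdjR B n (s.a 0))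
    with hInv
  have h1 : Inv (fun a b c => a < 0) s1 := by
    refine ⟨by simp [hs1, Cmd.run, hn], rfl, rfl, fun h => by omega, fun a b c h => ?_⟩
    exact absurd h (Nat.not_lt_zero a)
  have hmin : ∀ (k : ℕ) (t : St), k ≤ 2 → t.v 0 = n →
      min ((Ex.add (.v 0) (.c k)).eval B t.v t.a) B = n + k := by
    intro k t hk ht
    simp only [Ex.eval, ht]
    omega
  set body3 : ℕ → St → St :=
    fun c t => (guessCmd V).run O B ⟨Function.update t.v 3 c, t.a, t.calls⟩ with hb3
  set loop3 := (Cmd.loop 3 (.add (.v 0) (.c 2)) (guessCmd V)) with hl3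
  have h3 : ∀ (Done : ℕ → ℕ → ℕ → Prop) (t : St), Inv Done t →
      Inv (fun a b c => Done a b c ∨ (a = t.v 1 ∧ b = t.v 2 ∧ c < n + 2)) (loop3.run O B t) ∧
      (loop3.run O B t).calls = t.calls + (n + 2) * δ ∧
      ∀ x < 3, (loop3.run O B t).v x = t.v x := by
    intro Done t ht
    have hrun : loop3.run O B t = iter body3 (n + 2) t := by
      rw [hl3, Cmd.run, hmin 2 t le_rfl ht.v0]
    rw [hrun]
    refine iter_induction (fun j t' =>
      Inv (fun a b c => Done a b c ∨ (a = t.v 1 ∧ b = t.v 2 ∧ c < j)) t' ∧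
        t'.calls = t.calls + j * δ ∧ ∀ x < 3, t'.v x = t.v x)
      ⟨ht.mono fun a b c h => by simpa using h, by simp, fun _ _ => rfl⟩ ?_
    rintro j - t' ⟨i1, i2, i3⟩
    obtain ⟨k1, k2, k3⟩ := run_guessCmd O hV hB hE hI hC
      (i1.setv (x := 3) (by norm_num) (by norm_num) j)
    refine ⟨k1.mono ?_, ?_, fun x hx => ?_⟩
    · simp only [Function.update_self, Function.update_of_ne (show 1 ≠ 3 by norm_num),
        Function.update_of_ne (show 2 ≠ 3 by norm_num), i3 1 (by norm_num), i3 2 (by norm_num)]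
      rintro a b c (h | ⟨h1, h2, h3⟩)
      · exact .inl (.inl h)
      · rcases (Nat.lt_succ_iff.1 h3).lt_or_eq with h3 | h3
        · exact .inl (.inr ⟨h1, h2, h3⟩)
        · exact .inr ⟨h1, h2, h3⟩
    · rw [Nat.add_mul, Nat.one_mul, ← Nat.add_assoc, ← i2]
      exact k2
    · rw [← i3 x hx]
      refine (k3 x (by omega)).trans (Function.update_of_ne (by omega) _ _)
  set body2 : ℕ → St → St :=
    fun b t => loop3.run O B ⟨Function.update t.v 2 b, t.a, t.calls⟩ with hb2
  set loop2 := (Cmd.loop 2 (.add (.v 0) (.c 1)) loop3) with hl2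
  have h2 : ∀ (Done : ℕ → ℕ → ℕ → Prop) (t : St), Inv Done t →
      Inv (fun a b c => Done a b c ∨ (a = t.v 1 ∧ b < n + 1 ∧ c < n + 2)) (loop2.run O B t) ∧
      (loop2.run O B t).calls = t.calls + (n + 1) * ((n + 2) * δ) ∧
      ∀ x < 2, (loop2.run O B t).v x = t.v x := by
    intro Done t ht
    have hrun : loop2.run O B t = iter body2 (n + 1) t := by
      rw [hl2, Cmd.run, hmin 1 t (by norm_num) ht.v0]
    rw [hrun]
    refine iter_induction (fun j t' =>
      Inv (fun a b c => Done a b c ∨ (a = t.v 1 ∧ b < j ∧ c < n + 2)) t' ∧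
        t'.calls = t.calls + j * ((n + 2) * δ) ∧ ∀ x < 2, t'.v x = t.v x)
      ⟨ht.mono fun a b c h => by simpa using h, by simp, fun _ _ => rfl⟩ ?_
    rintro j - t' ⟨i1, i2, i3⟩
    obtain ⟨k1, k2, k3⟩ := h3 _ _ (i1.setv (x := 2) (by norm_num) (by norm_num) j)
    refine ⟨k1.mono ?_, ?_, fun x hx => ?_⟩
    · simp only [Function.update_self, Function.update_of_ne (show 1 ≠ 2 by norm_num),
        i3 1 (by norm_num)]
      rintro a b c (h | ⟨h1, h2, h3⟩)
      · exact .inl (.inl h)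
      · rcases (Nat.lt_succ_iff.1 h2).lt_or_eq with h2 | h2
        · exact .inl (.inr ⟨h1, h2, h3⟩)
        · exact .inr ⟨h1, h2, h3⟩
    · rw [Nat.add_mul, Nat.one_mul, ← Nat.add_assoc, ← i2]
      exact k2
    · rw [← i3 x hx]
      refine (k3 x (by omega)).trans (Function.update_of_ne (by omega) _ _)
  have h1' : Inv (fun a b c => a < n + 1 ∧ b < n + 1 ∧ c < n + 2) s' ∧
      s'.calls = s.calls + (n + 1) * ((n + 1) * ((n + 2) * δ)) := by
    have hrun : s' = iter (fun a t => loop2.run O B ⟨Function.update t.v 1 a, t.a, t.calls⟩)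
        (n + 1) s1 := by
      rw [← hs', ← hmin 1 s1 (by norm_num) h1.v0]
      rfl
    rw [hrun]
    refine iter_induction (fun j t' => Inv (fun a b c => a < j ∧ b < n + 1 ∧ c < n + 2) t' ∧
        t'.calls = s.calls + j * ((n + 1) * ((n + 2) * δ)))
      ⟨h1.mono fun a b c h => h.1, by simp [hs1, Cmd.run]⟩ ?_
    rintro j - t' ⟨i1, i2⟩
    obtain ⟨k1, k2, -⟩ := h2 _ _ (i1.setv (x := 1) (by norm_num) (by norm_num) j)
    refine ⟨k1.mono ?_, ?_⟩
    · simp only [Function.update_self]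
      rintro a b c ⟨h1, h2, h3⟩
      rcases (Nat.lt_succ_iff.1 h1).lt_or_eq with h1 | h1
      · exact .inl ⟨h1, h2, h3⟩
      · exact .inr ⟨h1, h2, h3⟩
    · rw [Nat.add_mul j, Nat.one_mul, ← Nat.add_assoc, ← i2]
      exact k2
  obtain ⟨hfin, hcalls⟩ := h1'
  have hleast : ∀ T : Finset (Fin n), IsSolution G T → s'.v 4 ≤ T.card := by
    intro T hT
    obtain ⟨a, b, c, ha, hb, hc, hF, hcov⟩ :=
      exists_guess (C := fun x => s.a 1 x ≠ 0) hE hI hC hT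
    exact hfin.least a b c ⟨ha, hb, hc⟩ T hF hcov
  -- The initial size n + 1 means that nothing has been found. Deleting all vertices is a solution,
  -- so this value cannot persist.
  have hle : s'.v 4 ≤ n := by
    simpa using hleast _ (isSolution_univ G)
  obtain ⟨S, hS, hcard, hmem⟩ := hfin.sound hle
  exact ⟨hfin.v0, hfin.a0, hfin.a1, hcalls, S, ⟨hS, fun T hT => hcard ▸ hleast T hT⟩, hcard, hmem⟩

end SplitUIG

namespace SplitUIG

/-! ### Words and their cells -/

theorem finRange_flatMap_map {m n : ℕ} {α : Type*} (f : Fin m → Fin n → α) :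
    ((List.finRange m).flatMap fun i => (List.finRange n).map fun j => f i j) =
      List.ofFn fun k : Fin (m * n) => f k.divNat k.modNat := by
  rw [List.ofFn_mul, List.flatMap]
  congr 1
  rw [List.ofFn_eq_map]
  refine List.map_congr_left fun i _ => ?_
  rw [List.ofFn_eq_map]
  refine List.map_congr_left fun j _ => ?_
  have hn : 0 < n := Nat.pos_of_ne_zero fun h => by subst h; exact j.elim0
  congr 1
  · apply Fin.ext
    simp only [Fin.coe_divNat]
    rw [Nat.add_comm, Nat.add_mul_div_right _ _ hn, Nat.div_eq_of_lt j.2, Nat.zero_add]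
  · apply Fin.ext
    simp only [Fin.coe_modNat]
    rw [Nat.add_comm, Nat.add_mul_mod_self_right, Nat.mod_eq_of_lt j.2]

theorem mul_add_lt_sq {n i j : ℕ} (hi : i < n) (hj : j < n) : i * n + j < n * n := by
  calc i * n + j < i * n + n := by omega
    _ = (i + 1) * n := by rw [Nat.add_mul, Nat.one_mul]
    _ ≤ n * n := Nat.mul_le_mul hi le_rfl

theorem length_codeGraph {n : ℕ} (G : SimpleGraph (Fin n)) :
    (codeGraph G).length = n + 1 + n * n := by
  classical
  rw [codeGraph, finRange_flatMap_map]
  simp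
  omega

theorem codeGraph_getD {n : ℕ} (G : SimpleGraph (Fin n)) :
    (∀ t < n, (codeGraph G).getD t false = true) ∧ (codeGraph G).getD n false = false ∧
      ∀ i j : Fin n, (codeGraph G).getD (n + 1 + (i * n + j)) false = true ↔ G.Adj i j := by
  classical
  rw [codeGraph, finRange_flatMap_map]
  refine ⟨fun t ht => ?_, ?_, fun i j => ?_⟩
  · rw [List.getD_append _ _ _ _ (by simpa using ht)]
    simp [List.getD, ht]
  · rw [List.getD_append_right _ _ _ _ (by simp)]
    simp
  · have hn : 0 < n := by have := i.2; omega
    have h := mul_add_lt_sq i.2 j.2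
    rw [List.getD_append_right _ _ _ _ (by simp; omega)]
    rw [List.length_replicate, show n + 1 + ((i : ℕ) * n + j) - n = (i : ℕ) * n + j + 1 by omega,
      List.getD_cons_succ, List.getD_eq_getElem _ _ (by simpa using h), List.getElem_ofFn]
    rw [decide_eq_true_iff]
    have h1 : (⟨(i : ℕ) * n + j, h⟩ : Fin (n * n)).divNat = i := by
      apply Fin.ext
      simp only [Fin.coe_divNat]
      rw [Nat.add_comm, Nat.add_mul_div_right _ _ hn, Nat.div_eq_of_lt j.2, Nat.zero_add]
    have h2 : (⟨(i : ℕ) * n + j, h⟩ : Fin (n * n)).modNat = j := by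
      apply Fin.ext
      simp only [Fin.coe_modNat]
      rw [Nat.add_comm, Nat.add_mul_mod_self_right, Nat.mod_eq_of_lt j.2]
    rw [h1, h2]

/-- Serves in both directions of communication: recognising a code in the input, and showing that
the question put to the oracle is one. -/
theorem eq_codeGraph {n : ℕ} {G : SimpleGraph (Fin n)} {l : List Bool}
    (hl : l.length = n + 1 + n * n) (h1 : ∀ t < n, l.getD t false = true)
    (h2 : l.getD n false = false)
    (h3 : ∀ i j : Fin n, l.getD (n + 1 + (i * n + j)) false = true ↔ G.Adj i j) :
    l = codeGraph G := by
  obtain ⟨k1, k2, k3⟩ := codeGraph_getD G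
  refine List.ext_getElem (by rw [hl, length_codeGraph]) fun t ht ht' => ?_
  rw [← List.getD_eq_getElem _ false ht, ← List.getD_eq_getElem _ false ht']
  rcases lt_trichotomy t n with h | rfl | h
  · rw [h1 t h, k1 t h]
  · rw [h2, k2]
  · have hq : t - (n + 1) < n * n := by omega
    have hn : 0 < n := Nat.pos_of_ne_zero fun h => by subst h; omega
    have hi : (t - (n + 1)) / n < n := Nat.div_lt_of_lt_mul hq
    have hj : (t - (n + 1)) % n < n := Nat.mod_lt _ hn
    have e : t = n + 1 + ((t - (n + 1)) / n * n + (t - (n + 1)) % n) := by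
      rw [Nat.div_add_mod']; omega
    have := (h3 ⟨_, hi⟩ ⟨_, hj⟩).trans (k3 ⟨_, hi⟩ ⟨_, hj⟩).symm
    simp only at this
    rw [← e] at this
    exact Bool.eq_iff_iff.2 this

theorem writeWord_succ (w : List Bool) (m : ℕ → ℕ) (i : ℕ) (hi : i < w.length) :
    writeWord m 0 w (i + 1) = (w.getD i false).toNat := by
  unfold writeWord
  rw [if_neg (by omega), if_pos (by omega)]
  simp

/-- The cells of the input word. -/
def cells (w : List Bool) : ℕ → ℕ := writeWord (fun _ => 0) 0 w

theorem cells_zero (w : List Bool) : cells w 0 = w.length := by simp [cells, writeWord]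

theorem cells_succ (w : List Bool) (i : ℕ) : cells w (i + 1) = (w.getD i false).toNat := by
  by_cases hi : i < w.length
  · exact writeWord_succ w _ i hi
  · rw [List.getD_eq_default _ _ (by omega)]
    simp [cells, writeWord]
    omega

theorem cells_succ_ne_zero (w : List Bool) (i : ℕ) :
    cells w (i + 1) ≠ 0 ↔ w.getD i false = true := by
  rw [cells_succ]
  cases w.getD i false <;> simp

theorem readWord_getD (m : ℕ → ℕ) (a i : ℕ) (hi : i < m a) :
    (readWord m a).getD i false = true ↔ m (a + 1 + i) ≠ 0 := by
  rw [List.getD_eq_getElem _ _ (by simpa [readWord] using hi)]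
  simp [readWord]

/-! ### Binary expansions -/

/-- The number with the given binary digits. -/
def binVal : List Bool → ℕ
  | [] => 0
  | b :: l => 2 * binVal l + b.toNat

theorem binVal_bits (k : ℕ) : binVal k.bits = k := by
  induction k using Nat.binaryRec' with
  | zero => simp [binVal]
  | bit b n h ih =>
    rw [Nat.bits_append_bit n b h, binVal, ih, Nat.bit_val]

/-- Digits are listed from the least significant one, so the last one is the leading digit. With
`bits_binVal`, this makes legality of an expansion a test of one letter. -/
theorem bits_canonical (k : ℕ) : k.bits = [] ∨ k.bits.getLast? = some true := by
  induction k using Nat.binaryRec' with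
  | zero => simp
  | bit b n h ih =>
    rw [Nat.bits_append_bit n b h]
    rcases ih with h' | h'
    · have : n = 0 := by rw [← binVal_bits n, h']; rfl
      rw [h', h this]
      simp
    · right
      rw [List.getLast?_cons, h']
      rfl

theorem bits_binVal {l : List Bool} (h : l = [] ∨ l.getLast? = some true) :
    (binVal l).bits = l := by
  induction l with
  | nil => simp [binVal]
  | cons b l ih =>
    have hl : l = [] ∨ l.getLast? = some true := by
      cases l with
      | nil => simp
      | cons c l => right; simpa using h
    have hb : binVal l = 0 → b = true := by
      intro h0
      have hnil := ih hl
      rw [h0, Nat.zero_bits] at hnil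
      subst hnil
      simpa using h
    have := Nat.bits_append_bit (binVal l) b hb
    rwa [ih hl, Nat.bit_val] at this

end SplitUIG

namespace SplitUIG

/-! ### The vertex cover oracle as a subroutine -/

/-- The bound `B` as an expression. -/
def boundE : Ex := .sum 21 (.c 1)

/-- The scratch area is large enough for a question about `n` vertices. -/
def guardE : Ex :=
  (Ex.lt boundE (.add (.mul 30 0 0) (.add (.v 0) (.c 2)))).not

/-- The cell with the index in the variable `20` of the code of the bipartite graph, or of the
graph without vertices. -/
def questionE : Ex :=
  .ite guardE
    (.ite (.eq (.v 20) (.c 0)) (.add (.mul 30 0 0) (.add (.v 0) (.c 1))) <|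
      (Ex.lt (.v 20) (.add (.v 0) (.c 1))).or <|
      .ex 22 <| .ex 23 <| (Ex.lt (.v 22) (.v 0)).and <| (Ex.lt (.v 23) (.v 0)).and <|
        (Ex.eq (.v 20) (.add (.add (.v 0) (.c 2)) (.add (.mul 30 22 0) (.v 23)))).and <|
        (bipE 22 23).or (bipE 23 22))
    (.ite (.eq (.v 20) (.c 0)) (.c 1) (.c 0))

/-- Ask the oracle for a minimum vertex cover. -/
def askCmd : Cmd := .ask 5 20 questionE

theorem T_guardE {B : ℕ} {f : ℕ → ℕ} {a : Fin 16 → ℕ → ℕ} :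
    guardE.T B f a ↔ f 0 * f 0 + f 0 + 2 ≤ B := by
  have h : boundE.eval B f a = B := by simp [boundE, Ex.eval]
  rw [guardE, Ex.T_not, Ex.T_lt, h]
  simp only [Ex.eval, Ex.eval_mul (show (0 : ℕ) ≠ 30 by norm_num) (show (0 : ℕ) ≠ 30 by norm_num)]
  rcases le_total (f 0) B with h' | h'
  · rw [min_eq_left h']
    omega
  -- For `f 0` at least B the product is truncated, but the summand `f 0 + 2` alone already exceeds
  -- B on both sides.
  · rw [min_eq_right h']
    have h1 : 0 ≤ B * f 0 := Nat.zero_le _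
    have h2 : 0 ≤ f 0 * f 0 := Nat.zero_le _
    omega

theorem eval_questionE_zero {B : ℕ} {f : ℕ → ℕ} {a : Fin 16 → ℕ → ℕ} :
    questionE.eval B (Function.update f 20 0) a =
      if f 0 * f 0 + f 0 + 2 ≤ B then f 0 * f 0 + f 0 + 1 else 1 := by
  classical
  have h0 : Function.update f 20 0 0 = f 0 := by simp
  rw [questionE, Ex.eval_ite]
  simp only [T_guardE, h0]
  refine if_ctx_congr Iff.rfl (fun h => ?_) fun _ => ?_
  · have hn : f 0 ≤ B := by have := Nat.zero_le (f 0 * f 0); omega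
    rw [Ex.eval_ite, if_pos (by rw [Ex.T_eq]; simp [Ex.eval])]
    simp only [Ex.eval, Ex.eval_mul (show (0 : ℕ) ≠ 30 by norm_num) (show (0 : ℕ) ≠ 30 by norm_num),
      h0, min_eq_left hn]
    omega
  · rw [Ex.eval_ite, if_pos (by rw [Ex.T_eq]; simp [Ex.eval])]
    rfl

theorem T_questionE {B t : ℕ} {f : ℕ → ℕ} {a : Fin 16 → ℕ → ℕ}
    (h : f 0 * f 0 + f 0 + 2 ≤ B) :
    questionE.eval B (Function.update f 20 (t + 1)) a ≠ 0 ↔ t < f 0 ∨ ∃ i < f 0, ∃ j < f 0,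
      t = f 0 + 1 + (i * f 0 + j) ∧ (BipR B f a i j ∨ BipR B f a j i) := by
  classical
  have hn : f 0 ≤ B := by have := Nat.zero_le (f 0 * f 0); omega
  have h0 : Function.update f 20 (t + 1) 0 = f 0 := by simp
  have hR : ∀ i j, BipR B (Function.update (Function.update (Function.update f 20 (t + 1)) 22 i)
      23 j) a = BipR B f a := fun i j => BipR.congr (by simp) rfl rfl rfl
  rw [questionE, Ex.eval_ite, if_pos (by rw [T_guardE, h0]; exact h), Ex.eval_ite,
    if_neg (by rw [Ex.T_eq]; simp [Ex.eval])]
  change Ex.T _ _ _ _ ↔ _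
  simp only [Ex.T_or, Ex.T_ex, Ex.T_and, Ex.T_lt, Ex.T_eq, T_bipE (show 22 ≠ 30 by norm_num),
    T_bipE (show 23 ≠ 30 by norm_num), hR, Ex.eval,
    Ex.eval_mul (show (22 : ℕ) ≠ 30 by norm_num) (show (0 : ℕ) ≠ 30 by norm_num)]
  simp only [Function.update_apply]
  norm_num
  refine or_congr_right ?_
  constructor
  · rintro ⟨i, -, j, -, hi, hj, ht, hb⟩
    rw [min_eq_left (by omega)] at ht
    exact ⟨i, hi, j, hj, by omega, hb⟩
  · rintro ⟨i, hi, j, hj, ht, hb⟩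
    refine ⟨i, by omega, j, by omega, hi, hj, ?_, hb⟩
    rw [min_eq_left (by omega)]
    omega

theorem readWord_questionE {B n : ℕ} {f : ℕ → ℕ} {a : Fin 16 → ℕ → ℕ} (hn : f 0 = n)
    (h : n * n + n + 2 ≤ B) :
    readWord (fun t => questionE.eval B (Function.update f 20 t) a) 0 =
      codeGraph (bipGraph n (AdjR B n (a 0)) (fun x => a 1 x ≠ 0) (fun x => a 4 x ≠ 0)) := by
  subst hn
  have hlen : questionE.eval B (Function.update f 20 0) a = f 0 * f 0 + f 0 + 1 := by
    rw [eval_questionE_zero, if_pos h]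
  have hget : ∀ t < f 0 * f 0 + f 0 + 1,
      (readWord (fun t => questionE.eval B (Function.update f 20 t) a) 0).getD t false = true ↔
        t < f 0 ∨ ∃ i < f 0, ∃ j < f 0,
          t = f 0 + 1 + (i * f 0 + j) ∧ (BipR B f a i j ∨ BipR B f a j i) := by
    intro t ht
    rw [readWord_getD _ _ _ (by rw [hlen]; exact ht), Nat.zero_add, Nat.add_comm 1 t]
    exact T_questionE h
  refine eq_codeGraph ?_ (fun t ht => ?_) ?_ fun i j => ?_
  · rw [length_readWord, hlen]
    omega
  · exact (hget t (by omega)).2 (.inl ht)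
  · rw [← Bool.not_eq_true, hget _ (by omega)]
    rintro (h | ⟨i, -, j, -, h, -⟩) <;> omega
  · have hij := mul_add_lt_sq i.2 j.2
    rw [hget _ (by omega)]
    have e : (bipGraph (f 0) (AdjR B (f 0) (a 0)) (fun x => a 1 x ≠ 0) fun x => a 4 x ≠ 0).Adj i j ↔
        BipR B f a i j ∨ BipR B f a j i := by
      simp [bipGraph, BipR, i.2, j.2]
    rw [e]
    constructor
    · rintro (h | ⟨i', hi, j', hj, h, hb⟩)
      · omega
      · have h' : (i : ℕ) * f 0 + j = i' * f 0 + j' := by omega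
        have hpos : 0 < f 0 := by omega
        have h1 : (i : ℕ) = i' := by
          have := congrArg (· / f 0) h'
          simpa [Nat.add_comm, Nat.add_mul_div_right _ _ hpos, Nat.div_eq_of_lt j.2,
            Nat.div_eq_of_lt hj] using this
        have h2 : (j : ℕ) = j' := by
          rw [h1] at h'
          omega
        rwa [h1, h2]
    · intro hb
      exact .inr ⟨i, i.2, j, j.2, rfl, hb⟩

/-- Safety concerns all states, also those whose graph is too large for the scratch area. For them
the guard substitutes the graph without vertices, whose code has one letter, so 2 ≤ B suffices.
Otherwise the question has n² + n + 1 letters and the answer n. -/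
theorem askCmd_safe {O : List Bool → List Bool} (hO : SolvesBipartiteVertexCover O) :
    askCmd.Safe O := by
  intro B hB f a
  have hlen : ∀ (m : ℕ) (H : SimpleGraph (Fin m)), H.IsBipartite →
      (O (codeGraph H)).length = m := by
    intro m H hH
    obtain ⟨X, -, hX⟩ := hO m H hH
    simp [hX, codeSet]
  by_cases h : f 0 * f 0 + f 0 + 2 ≤ B
  · rw [readWord_questionE rfl h, eval_questionE_zero, if_pos h, hlen _ _ (bipGraph_isBipartite _ _ _ _)]
    constructor <;> omega
  · have h0 : questionE.eval B (Function.update f 20 0) a = 1 := by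
      rw [eval_questionE_zero, if_neg h]
    have hread : readWord (fun t => questionE.eval B (Function.update f 20 t) a) 0 =
        codeGraph (⊥ : SimpleGraph (Fin 0)) := by
      refine eq_codeGraph (by rw [length_readWord, h0]) (fun t ht => by omega) ?_ fun i => i.elim0
      rw [← Bool.not_eq_true, readWord_getD _ _ _ (by rw [h0]; norm_num), not_not]
      classical
      rw [questionE, Ex.eval_ite, if_neg (by rw [T_guardE]; simpa using h), Ex.eval_ite,
        if_neg (by rw [Ex.T_eq]; simp [Ex.eval])]
      rfl
    rw [hread, h0, hlen _ _ ⟨SimpleGraph.Coloring.mk (fun v => v.elim0) fun {v} => v.elim0⟩]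
    constructor <;> omega

/-- Cell 0 of the answer is its length, which is the reason for the shift by one in `CoverSpec`. -/
theorem run_askCmd {O : List Bool → List Bool} (hO : SolvesBipartiteVertexCover O) {B : ℕ} (s : St)
    (hB : s.v 0 * s.v 0 + s.v 0 + 2 ≤ B) : CoverSpec B 1 s (askCmd.run O B s) := by
  refine ⟨fun _ _ => rfl, fun k h5 _ _ => ?_, rfl, ?_⟩
  · simp [askCmd, Cmd.run, h5]
  · obtain ⟨X, hX, hans⟩ := hO _ (s.bipGraph B) (bipGraph_isBipartite _ _ _ _)
    refine ⟨X, hX, fun v => ?_⟩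
    have hv : (v : ℕ) + 1 < B := by
      have := v.2
      have := Nat.zero_le (s.v 0 * s.v 0)
      omega
    simp only [askCmd, Cmd.run, Function.update_self, if_pos hv]
    rw [readWord_questionE rfl hB]
    change _ ↔ writeWord _ 0 (O (codeGraph (s.bipGraph B))) _ ≠ 0
    rw [hans, writeWord_succ _ _ _ (by simp [codeSet])]
    simp [codeSet]

end SplitUIG

namespace SplitUIG

/-! ### Reading the input -/

/-- Put the number of vertices into the variable `0`. -/
def parseCmd : Cmd :=
  .setv 0 (.find 24 20 (.eq (.ar 0 (.add (.v 20) (.c 1))) (.c 0)))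

/-- The state after the number `n` of vertices has been read off the input `w`. -/
def parsedSt (n : ℕ) (w : List Bool) : St :=
  ⟨Function.update (fun _ => 0) 0 n, (inputSt w).a, 0⟩

theorem inputSt_a_zero (w : List Bool) : (inputSt w).a 0 = cells w := by
  simp [inputSt, cells]

theorem parsedSt_a_zero (n : ℕ) (w : List Bool) : (parsedSt n w).a 0 = cells w :=
  inputSt_a_zero w

theorem exists_unary_prefix (w : List Bool) :
    ∃ n, (∀ t < n, w.getD t false = true) ∧ w.getD n false = false := by
  have h : ∃ n, w.getD n false = false := ⟨w.length, List.getD_eq_default _ _ le_rfl⟩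
  exact ⟨Nat.find h, fun t ht => by simpa using Nat.find_min h ht, Nat.find_spec h⟩

theorem le_length_of_unary_prefix {w : List Bool} {n : ℕ}
    (h : ∀ t < n, w.getD t false = true) : n ≤ w.length := by
  by_contra hn
  have := h w.length (by omega)
  rw [List.getD_eq_default _ _ le_rfl] at this
  exact Bool.false_ne_true this

theorem run_parseCmd (O : List Bool → List Bool) {w : List Bool} {n : ℕ}
    (h1 : ∀ t < n, w.getD t false = true) (h2 : w.getD n false = false) :
    parseCmd.run O (w.length + 2) (inputSt w) = parsedSt n w := by
  have hn := le_length_of_unary_prefix h1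
  obtain ⟨-, k2, k3⟩ := Ex.find_spec (B := w.length + 2) (f := (inputSt w).v) (a := (inputSt w).a)
    (x := 24) (y := 20) (e := .eq (.ar 0 (.add (.v 20) (.c 1))) (.c 0))
    (R := fun j => ¬ w.getD j false = true) (by
      intro i _ j _
      rw [Ex.T_eq, ← cells_succ_ne_zero]
      simp [Ex.eval, inputSt_a_zero]) (by norm_num)
  simp only [parseCmd, Cmd.run]
  set m := (Ex.find 24 20 (.eq (.ar 0 (.add (.v 20) (.c 1))) (.c 0))).eval (w.length + 2)
    (inputSt w).v (inputSt w).a with hm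
  have : m = n := by
    rcases lt_trichotomy m n with h | h | h
    · exact absurd (h1 m h) (k2 (by omega))
    · exact h
    · exact absurd (by rw [h2]; exact Bool.false_ne_true) (k3 n h)
  rw [this]
  rfl

theorem adjR_cells {B n i j : ℕ} (w : List Bool) (hi : i ≤ B) :
    AdjR B n (cells w) i j ↔ w.getD (n + 1 + (i * n + j)) false = true := by
  rw [AdjR, min_eq_left hi, ← cells_succ_ne_zero]
  have : n + 2 + (i * n + j) = n + 1 + (i * n + j) + 1 := by omega
  rw [this]

section code

variable {n : ℕ} (G : SimpleGraph (Fin n)) (r : List Bool)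

theorem codeGraph_append_getD :
    (∀ t < n, (codeGraph G ++ r).getD t false = true) ∧ (codeGraph G ++ r).getD n false = false ∧
      ∀ i j : Fin n, (codeGraph G ++ r).getD (n + 1 + (i * n + j)) false = true ↔ G.Adj i j := by
  obtain ⟨h1, h2, h3⟩ := codeGraph_getD G
  have hl := length_codeGraph G
  refine ⟨fun t ht => ?_, ?_, fun i j => ?_⟩
  · rw [List.getD_append _ _ _ _ (by omega), h1 t ht]
  · rw [List.getD_append _ _ _ _ (by omega), h2]
  · have := mul_add_lt_sq i.2 j.2
    rw [List.getD_append _ _ _ _ (by omega), h3]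

theorem length_codeGraph_append : (codeGraph G ++ r).length = n + 1 + n * n + r.length := by
  rw [List.length_append, length_codeGraph]

theorem adjR_codeGraph {B : ℕ} (hB : n ≤ B) (u v : Fin n) :
    G.Adj u v ↔ AdjR B n (cells (codeGraph G ++ r)) u v := by
  rw [adjR_cells _ (by omega), (codeGraph_append_getD G r).2.2]

end code

theorem IsSplit.exists_prefixOK {n : ℕ} {G : SimpleGraph (Fin n)} {E : ℕ → ℕ → Prop}
    (hE : ∀ u v : Fin n, G.Adj u v ↔ E u v) (h : IsSplit G) : ∃ C, PrefixOK E n C := by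
  obtain ⟨C, I, hs⟩ := h
  refine ⟨fun x => ∃ h : x < n, (⟨x, h⟩ : Fin n) ∈ C, fun u hu v hv huv => ?_⟩
  have hne : (⟨u, hu⟩ : Fin n) ≠ ⟨v, hv⟩ := fun h => huv (Fin.mk.inj h)
  have hadj := hE ⟨u, hu⟩ ⟨v, hv⟩
  simp only at hadj
  rw [← hadj]
  refine ⟨fun ⟨_, h1⟩ ⟨_, h2⟩ => hs.2.1 h1 h2 hne, fun h1 h2 => hs.2.2 ?_ ?_ hne⟩
  · exact (hs.mem_right_iff _).2 fun h => h1 ⟨hu, h⟩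
  · exact (hs.mem_right_iff _).2 fun h => h2 ⟨hv, h⟩

theorem PrefixOK.isSplit {n : ℕ} {G : SimpleGraph (Fin n)} {E : ℕ → ℕ → Prop}
    (hE : ∀ u v : Fin n, G.Adj u v ↔ E u v) {C : ℕ → Prop} (h : PrefixOK E n C) : IsSplit G := by
  refine ⟨{u | C u}, {u | C u}ᶜ, isCompl_compl, fun u hu v hv huv => ?_, fun u hu v hv huv => ?_⟩
  · exact (hE u v).2 ((h u u.2 v v.2 fun e => huv (Fin.ext e)).1 hu hv)
  · exact fun hadj => (h u u.2 v v.2 fun e => huv (Fin.ext e)).2 hu hv ((hE u v).1 hadj)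

/-! ### Computing a minimum solution -/

section search

variable {O : List Bool → List Bool} {δ n : ℕ} {V : Cmd} {G : SimpleGraph (Fin n)}

/-- The search started with a split partition. -/
theorem run_searchCmd_of_prefixOK
    (hV : ∀ {B : ℕ} (s : St), s.v 0 * s.v 0 + s.v 0 + 2 ≤ B → CoverSpec B δ s (V.run O B s))
    {r : List Bool} {B : ℕ} (hB : n * n + n + 2 ≤ B) {s s' : St} (hn : s.v 0 = n)
    (h0 : s.a 0 = cells (codeGraph G ++ r))
    (h1 : PrefixOK (AdjR B n (s.a 0)) n fun x => s.a 1 x ≠ 0)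
    (hs' : (searchCmd V).run O B s = s') :
    s'.v 0 = n ∧ s'.a 0 = s.a 0 ∧ s'.a 1 = s.a 1 ∧
      s'.calls = s.calls + (n + 1) * ((n + 1) * ((n + 2) * δ)) ∧
      ∃ S : Finset (Fin n), IsMinSolution G S ∧ S.card = s'.v 4 ∧
        ∀ v : Fin n, v ∈ S ↔ s'.a 9 v ≠ 0 := by
  have hE : ∀ u v : Fin n, G.Adj u v ↔ AdjR B n (s.a 0) u v := by
    rw [h0]
    exact adjR_codeGraph G r (by have := Nat.zero_le (n * n); omega)
  refine run_searchCmd O (fun s hs => hV s hs) hB hn hE (fun u v hu hv hadj => ?_)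
    (fun u v hu hv huv => ?_) hs'
  · exact (h1 u u.2 v v.2 fun e => hadj.ne (Fin.ext e)).2 hu hv ((hE u v).1 hadj)
  · exact (hE u v).2 ((h1 u u.2 v v.2 fun e => huv (Fin.ext e)).1 hu hv)

/-- Find a minimum solution for a split graph. -/
def solveCmd (V : Cmd) : Cmd := .seq parseCmd (.seq splitCmd (searchCmd V))

/-- The cells of the code of the solution. -/
def solutionE : Ex := .ite (.eq (.v 20) (.c 0)) (.v 0) (.ar 9 (.sub (.v 20) (.c 1)))

/-- The code of a graph has n + 1 + n² letters, so B is large enough for the auction and for the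
questions to the oracle. -/
theorem run_solveCmd
    (hV : ∀ {B : ℕ} (s : St), s.v 0 * s.v 0 + s.v 0 + 2 ≤ B → CoverSpec B δ s (V.run O B s))
    (hG : IsSplit G) {s' : St}
    (hs' : (solveCmd V).run O ((codeGraph G).length + 2) (inputSt (codeGraph G)) = s') :
    s'.v 0 = n ∧ s'.calls = (n + 1) * ((n + 1) * ((n + 2) * δ)) ∧
      ∃ S : Finset (Fin n), IsMinSolution G S ∧ ∀ v : Fin n, v ∈ S ↔ s'.a 9 v ≠ 0 := by
  obtain ⟨g1, g2, -⟩ := codeGraph_getD G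
  have hl := length_codeGraph G
  rw [solveCmd, Cmd.run, run_parseCmd O g1 g2, Cmd.run] at hs'
  set B := (codeGraph G).length + 2 with hB
  have hn2 := Nat.zero_le (n * n)
  have hv : (parsedSt n (codeGraph G)).v 0 = n := by simp [parsedSt]
  have ha : (parsedSt n (codeGraph G)).a 0 = cells (codeGraph G ++ []) := by
    rw [List.append_nil]
    exact parsedSt_a_zero _ _
  obtain ⟨⟨hv', ha', hc'⟩, hp⟩ := run_splitCmd O (B := B) (parsedSt n (codeGraph G)) (by omega)
  rw [hv] at hv' hp
  obtain ⟨C, hC⟩ := hG.exists_prefixOK (E := AdjR B n ((parsedSt n (codeGraph G)).a 0)) (by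
    rw [ha]; exact adjR_codeGraph G [] (by omega))
  have ha0 := ha' 0 (by decide)
  obtain ⟨k1, -, -, k4, S, hS, -, hmem⟩ := run_searchCmd_of_prefixOK (G := G) (r := []) hV
    (B := B) (by omega) hv' (ha0.trans ha) (by rw [ha0]; exact hp C hC) hs'
  refine ⟨k1, ?_, S, hS, hmem⟩
  rw [k4, hc']
  simp [parsedSt]

theorem readWord_solutionE {B : ℕ} {s : St} {S : Finset (Fin n)} (hn : s.v 0 = n)
    (hS : ∀ v : Fin n, v ∈ S ↔ s.a 9 v ≠ 0) :
    solutionE.eval B (Function.update s.v 20 0) s.a = n ∧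
      readWord (fun i => solutionE.eval B (Function.update s.v 20 i) s.a) 0 = codeSet S := by
  classical
  have h0 : solutionE.eval B (Function.update s.v 20 0) s.a = n := by
    rw [solutionE, Ex.eval_ite, if_pos (by rw [Ex.T_eq]; simp [Ex.eval])]
    simp [Ex.eval, hn]
  have h1 : ∀ i, solutionE.eval B (Function.update s.v 20 (i + 1)) s.a = s.a 9 i := by
    intro i
    rw [solutionE, Ex.eval_ite, if_neg (by rw [Ex.T_eq]; simp [Ex.eval])]
    simp [Ex.eval]
  refine ⟨h0, List.ext_getElem (by simp [length_readWord, h0, codeSet]) fun i hi hi' => ?_⟩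
  have hin : i < n := by simpa [length_readWord, h0] using hi
  have e : 0 + 1 + i = i + 1 := by omega
  simp only [readWord, codeSet, List.getElem_map, List.getElem_range, List.getElem_finRange, e, h1]
  rw [decide_eq_decide]
  exact (hS ⟨i, hin⟩).symm

end search

theorem searchCmd_safe {O : List Bool → List Bool} (V : Cmd) :
    (searchCmd V).Safe O ↔ V.Safe O := by
  simp [searchCmd, guessCmd, keepCmd, Cmd.Safe]

theorem splitCmd_safe {O : List Bool → List Bool} : splitCmd.Safe O := by
  simp [splitCmd, Cmd.Safe]

theorem solveCmd_safe {O : List Bool → List Bool} (V : Cmd) :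
    (solveCmd V).Safe O ↔ V.Safe O := by
  simp [solveCmd, parseCmd, Cmd.Safe, searchCmd_safe, splitCmd_safe]

/-- The solver as a program. -/
theorem outputs_solveCmd (V : Cmd) : ∃ P : Polynomial ℕ, ∀ (O : List Bool → List Bool) (δ : ℕ),
    V.Safe O →
    (∀ {B : ℕ} (s : St), s.v 0 * s.v 0 + s.v 0 + 2 ≤ B → CoverSpec B δ s (V.run O B s)) →
    ∀ (n : ℕ) (G : SimpleGraph (Fin n)), IsSplit G → ∃ S : Finset (Fin n), IsMinSolution G S ∧
      Outputs O ((solveCmd V).fullProg 20 solutionE) (codeGraph G) (codeSet S)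
        (P.eval (codeGraph G).length) ((n + 1) * ((n + 1) * ((n + 2) * δ))) := by
  obtain ⟨P, hP⟩ := (solveCmd V).outputs_fullProg 20 solutionE
  refine ⟨P, fun O δ hsafe hV n G hG => ?_⟩
  obtain ⟨hn, hc, S, hS, hmem⟩ := run_solveCmd hV hG rfl
  obtain ⟨h0, hread⟩ := readWord_solutionE (B := (codeGraph G).length + 2) hn hmem
  have := hP O (codeGraph G) _ ((solveCmd_safe V).2 hsafe) rfl (by
    rw [h0, length_codeGraph]; omega)
  rw [hread, hc] at this
  exact ⟨S, hS, this⟩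

theorem auctionCmd_safe (O : List Bool → List Bool) : auctionCmd.Safe O := by
  simp [auctionCmd, bidCmd, Cmd.Safe]

end SplitUIG

namespace SplitUIG

/-! ### The decision version -/

/-- The length of the code of a graph. -/
def sizeE : Ex := .add (.add (.v 0) (.c 1)) (.mul 30 0 0)

/-- The input is a code of a graph, followed by the binary digits of a number. -/
def validE : Ex :=
  (Ex.lt (.ar 0 (.c 0)) sizeE).not.and <|
  ((Ex.eq (.ar 0 (.c 0)) sizeE).or (.ar 0 (.ar 0 (.c 0)))).and <|
  Ex.all 20 <| Ex.all 21 <| (Ex.lt (.v 20) (.v 0)).not.or <| (Ex.lt (.v 21) (.v 0)).not.or <|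
    ((Ex.eq (.v 20) (.v 21)).not.or (adjE 20 21).not).and ((adjE 20 21).not.or (adjE 21 20))

/-- The array `1` is a split partition. -/
def partitionE : Ex :=
  .all 21 <| .all 22 <| (Ex.lt (.v 21) (.v 0)).not.or <| (Ex.lt (.v 22) (.v 0)).not.or <|
    (Ex.eq (.v 21) (.v 22)).or <|
    ((Ex.ar 1 (.v 21)).not.or <| (Ex.ar 1 (.v 22)).not.or (adjE 21 22)).and
      ((Ex.ar 1 (.v 21)).or <| (Ex.ar 1 (.v 22)).or (adjE 21 22).not)

/-- Read the number after the code of the graph into the variable `7`. -/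
def numberCmd : Cmd :=
  .seq (.setv 7 (.c 0)) <| .loop 6 boundE <| .seq (.setv 8 (.sub (.ar 0 (.c 0)) (.v 6))) <|
  .ite (.lt sizeE (.v 8)) (.setv 7 (.add (.add (.v 7) (.v 7)) (.ar 0 (.v 8)))) (.setv 7 (.v 7))

/-- Decide the decision version; the answer is in the variable `9`. -/
def decisionCmd : Cmd :=
  .seq parseCmd <| .ite validE
    (.seq splitCmd <| .ite partitionE
      (.seq (searchCmd auctionCmd) <| .seq numberCmd <| .setv 9 (Ex.lt (.v 7) (.v 4)).not)
      (.setv 9 (.c 0)))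
    (.setv 9 (.c 0))

/-- The cells of the answer. -/
def answerE : Ex := .ite (.eq (.v 20) (.c 0)) (.c 1) (.v 9)

theorem eval_sizeE {B : ℕ} {f : ℕ → ℕ} {a : Fin 16 → ℕ → ℕ} (h : f 0 ≤ B) :
    sizeE.eval B f a = f 0 + 1 + f 0 * f 0 := by
  simp only [sizeE, Ex.eval, Ex.eval_mul (show (0 : ℕ) ≠ 30 by norm_num)
    (show (0 : ℕ) ≠ 30 by norm_num), min_eq_left h]

theorem T_validE {B n : ℕ} {f : ℕ → ℕ} {a : Fin 16 → ℕ → ℕ} {w : List Bool} (hn : f 0 = n)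
    (ha : a 0 = cells w) (h : n ≤ B) :
    validE.T B f a ↔ n + 1 + n * n ≤ w.length ∧
      (w.length = n + 1 + n * n ∨ cells w w.length ≠ 0) ∧
      ∀ i < n, ∀ j < n, (i = j → ¬ AdjR B n (cells w) i j) ∧
        (AdjR B n (cells w) i j → AdjR B n (cells w) j i) := by
  subst hn
  simp only [validE, Ex.T_and, Ex.T_all, Ex.T_or, Ex.T_not, Ex.T_lt, Ex.T_eq, Ex.T_ar,
    T_adjE (show 20 ≠ 30 by norm_num), T_adjE (show 21 ≠ 30 by norm_num), eval_sizeE h, Ex.eval,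
    ha, cells_zero, Function.update_apply]
  norm_num
  intro _ _
  constructor
  · intro H i hi j hj
    have := H i (by omega) j (by omega)
    grind
  · intro H i _ j _
    have := H i
    by_cases hi : i < f 0
    · by_cases hj : j < f 0
      · have := H i hi j hj
        grind
      · exact .inr (.inl (by omega))
    · exact .inl (by omega)

theorem T_partitionE {B n : ℕ} {f : ℕ → ℕ} {a : Fin 16 → ℕ → ℕ} (hn : f 0 = n) (h : n ≤ B) :
    partitionE.T B f a ↔ PrefixOK (AdjR B n (a 0)) n fun x => a 1 x ≠ 0 := by
  subst hn
  simp only [partitionE, Ex.T_and, Ex.T_all, Ex.T_or, Ex.T_not, Ex.T_lt, Ex.T_eq, Ex.T_ar,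
    T_adjE (show 21 ≠ 30 by norm_num), Ex.eval, Function.update_apply, PrefixOK]
  norm_num
  constructor
  · intro H u hu v hv huv
    have := H u (by omega) v (by omega)
    grind
  · intro H u _ v _
    by_cases hu : u < f 0
    · by_cases hv : v < f 0
      · have := H u hu v hv
        grind
      · exact .inr (.inl (by omega))
    · exact .inl (by omega)

/-- Horner's rule, starting from the last letter, which is the leading digit. Rounds that reach back
into the code of the graph do nothing; this is the maximum in the loop invariant. -/
theorem run_numberCmd (O : List Bool → List Bool) {n : ℕ} {w : List Bool} {s : St}
    (hn : s.v 0 = n) (h0 : s.a 0 = cells w) (h : n + 1 + n * n ≤ w.length) :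
    (numberCmd.run O (w.length + 2) s).v 7 = binVal (w.drop (n + 1 + n * n)) ∧
      (numberCmd.run O (w.length + 2) s).v 4 = s.v 4 ∧
      (numberCmd.run O (w.length + 2) s).calls = s.calls := by
  classical
  have hn2 := Nat.zero_le (n * n)
  rw [numberCmd, Cmd.run]
  set s1 : St := (Cmd.setv 7 (.c 0)).run O (w.length + 2) s with hs1
  rw [Cmd.run]
  have hm : min (boundE.eval (w.length + 2) s1.v s1.a) (w.length + 2) = w.length + 2 := by
    simp [boundE, Ex.eval]
  rw [hm]
  have hloop := iter_induction (f := fun j s => ((Cmd.setv 8 (.sub (.ar 0 (.c 0)) (.v 6))).seq <|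
      .ite (.lt sizeE (.v 8)) (.setv 7 (.add (.add (.v 7) (.v 7)) (.ar 0 (.v 8))))
        (.setv 7 (.v 7))).run O (w.length + 2) ⟨Function.update s.v 6 j, s.a, s.calls⟩)
    (fun j s' => s'.v 0 = n ∧ s'.a 0 = cells w ∧ s'.v 4 = s.v 4 ∧ s'.calls = s.calls ∧
      s'.v 7 = binVal (w.drop (max (w.length - j) (n + 1 + n * n))))
    (m := w.length + 2) (s := s1) ?_ ?_
  · obtain ⟨-, -, h4, hc, h7⟩ := hloop
    refine ⟨?_, h4, hc⟩
    rw [h7, max_eq_right (by omega)]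
  · refine ⟨by simp [hs1, Cmd.run, hn], h0, by simp [hs1, Cmd.run], rfl, ?_⟩
    rw [Nat.sub_zero, max_eq_left h, List.drop_length]
    simp [hs1, Cmd.run, Ex.eval, binVal]
  · rintro j - s' ⟨k0, ka, k4, kc, k7⟩
    rw [Cmd.run]
    set s2 : St := (Cmd.setv 8 (.sub (.ar 0 (.c 0)) (.v 6))).run O (w.length + 2)
      ⟨Function.update s'.v 6 j, s'.a, s'.calls⟩ with hs2
    have e0 : s2.v 0 = n := by simp [hs2, Cmd.run, k0]
    have e4 : s2.v 4 = s.v 4 := by simp [hs2, Cmd.run, k4]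
    have e7 : s2.v 7 = s'.v 7 := by simp [hs2, Cmd.run]
    have e8 : s2.v 8 = w.length - j := by simp [hs2, Cmd.run, Ex.eval, ka, cells_zero]
    have ea : s2.a 0 = cells w := ka
    have hT : (Ex.lt sizeE (.v 8)).T (w.length + 2) s2.v s2.a ↔ n + 1 + n * n < w.length - j := by
      rw [Ex.T_lt, eval_sizeE (by omega), e0]
      simp [Ex.eval, e8]
    by_cases hlt : n + 1 + n * n < w.length - j
    · rw [Cmd.run_ite_pos (hT.2 hlt)]
      refine ⟨by simp [Cmd.run, e0], ea, by simp [Cmd.run, e4], kc, ?_⟩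
      obtain ⟨q, hq⟩ : ∃ q, w.length - j = q + 1 := ⟨w.length - j - 1, by omega⟩
      have hq' : w.length - (j + 1) = q := by omega
      rw [hq', max_eq_left (by omega), List.drop_eq_getElem_cons (by omega : q < w.length), binVal]
      rw [hq, max_eq_left (by omega)] at k7
      simp only [Cmd.run, Ex.eval, Function.update_self, e7, e8, ea, hq, cells_succ, k7]
      rw [List.getD_eq_getElem _ _ (by omega : q < w.length)]
      omega
    · rw [Cmd.run_ite_neg fun h => hlt (hT.1 h)]
      refine ⟨by simp [Cmd.run, e0], ea, by simp [Cmd.run, e4], kc, ?_⟩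
      rw [max_eq_right (by omega)] at k7 ⊢
      simp [Cmd.run, Ex.eval, e7, k7]

/-- Symmetry and the empty diagonal make the matrix a graph, and the test of the last letter makes
the suffix an expansion without superfluous leading zeros. -/
theorem exists_code_of_validE {n : ℕ} {w : List Bool} (h1 : ∀ t < n, w.getD t false = true)
    (h2 : w.getD n false = false)
    (h : validE.T (w.length + 2) (parsedSt n w).v (parsedSt n w).a) :
    ∃ (G : SimpleGraph (Fin n)) (k : ℕ), w = codeGraph G ++ k.bits := by
  have hn := le_length_of_unary_prefix h1
  rw [T_validE (n := n) (w := w) (by simp [parsedSt]) (parsedSt_a_zero n w) (by omega)] at h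
  obtain ⟨hle, hlast, hadj⟩ := h
  set M := n + 1 + n * n with hM
  let G : SimpleGraph (Fin n) :=
    { Adj := fun i j => AdjR (w.length + 2) n (cells w) i j
      symm := ⟨fun i j h => (hadj i i.2 j j.2).2 h⟩
      loopless := ⟨fun i h => (hadj i i.2 i i.2).1 rfl h⟩ }
  have htake : ∀ t < M, (w.take M).getD t false = w.getD t false := by
    intro t ht
    rw [List.getD_eq_getElem _ _ (by rw [List.length_take]; omega),
      List.getD_eq_getElem _ _ (by omega), List.getElem_take]
  have hcode : w.take M = codeGraph G := by
    refine eq_codeGraph (by rw [List.length_take]; omega) (fun t ht => ?_) ?_ fun i j => ?_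
    · rw [htake t (by omega), h1 t ht]
    · rw [htake n (by omega), h2]
    · have := mul_add_lt_sq i.2 j.2
      rw [htake _ (by omega)]
      exact (adjR_cells w (by omega)).symm
  refine ⟨G, binVal (w.drop M), ?_⟩
  rw [bits_binVal, ← hcode, List.take_append_drop]
  by_cases hlen : w.length = M
  · left
    rw [← hlen, List.drop_length]
  · right
    have hc := hlast.resolve_left hlen
    obtain ⟨q, hq⟩ : ∃ q, w.length = q + 1 := ⟨w.length - 1, by omega⟩
    rw [hq, cells_succ_ne_zero, List.getD_eq_getElem _ _ (by omega)] at hc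
    rw [List.getLast?_drop, if_neg (by omega), List.getLast?_eq_getElem?, hq, Nat.add_sub_cancel,
      List.getElem?_eq_getElem (by omega), hc]

theorem validE_of_code {n : ℕ} (G : SimpleGraph (Fin n)) (k : ℕ) :
    validE.T ((codeGraph G ++ k.bits).length + 2) (parsedSt n (codeGraph G ++ k.bits)).v
      (parsedSt n (codeGraph G ++ k.bits)).a := by
  have hl := length_codeGraph_append G k.bits
  have hn2 := Nat.zero_le (n * n)
  have hA := adjR_codeGraph G k.bits (B := (codeGraph G ++ k.bits).length + 2) (by omega)
  rw [T_validE (n := n) (by simp [parsedSt]) (parsedSt_a_zero n _) (by omega)]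
  refine ⟨by omega, ?_, fun i hi j hj => ⟨?_, fun h => ?_⟩⟩
  · rcases bits_canonical k with h | h
    · left
      rw [hl, h, List.length_nil, Nat.add_zero]
    · right
      obtain ⟨q, hq⟩ : ∃ q, (codeGraph G ++ k.bits).length = q + 1 :=
        ⟨(codeGraph G ++ k.bits).length - 1, by omega⟩
      have hlast : (codeGraph G ++ k.bits).getLast? = some true := by
        rw [List.getLast?_append, h]
        rfl
      rw [List.getLast?_eq_getElem?, hq, Nat.add_sub_cancel] at hlast
      rw [hq, cells_succ_ne_zero, List.getD_eq_getElem?_getD, hlast]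
      rfl
  · rintro rfl h
    exact G.irrefl ((hA ⟨i, hi⟩ ⟨i, hi⟩).2 h)
  · exact (hA ⟨j, hj⟩ ⟨i, hi⟩).1 (((hA ⟨i, hi⟩ ⟨j, hj⟩).2 h).symm)

theorem unary_prefix_unique {w : List Bool} {m n : ℕ} (h1 : ∀ t < n, w.getD t false = true)
    (h2 : w.getD n false = false) (h3 : ∀ t < m, w.getD t false = true)
    (h4 : w.getD m false = false) : m = n := by
  rcases lt_trichotomy m n with h | h | h
  · rw [h1 m h] at h4
    exact absurd h4.symm Bool.false_ne_true
  · exact h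
  · rw [h3 n h] at h2
    exact absurd h2.symm Bool.false_ne_true

/-- The unary prefix determines the number of vertices, and this the length of the code, so a word
splits into code and suffix in only one way. Hence membership in the language can be tested on the
instance that was read. -/
theorem codeGraph_append_inj {m n : ℕ} {G : SimpleGraph (Fin n)} {H : SimpleGraph (Fin m)}
    {r r' : List Bool} (h : codeGraph G ++ r = codeGraph H ++ r') :
    ∃ e : m = n, e ▸ H = G ∧ r' = r := by
  obtain ⟨g1, g2, g3⟩ := codeGraph_append_getD G r
  obtain ⟨k1, k2, k3⟩ := codeGraph_append_getD H r'
  rw [← h] at k1 k2 k3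
  obtain rfl := unary_prefix_unique g1 g2 k1 k2
  refine ⟨rfl, ?_, ?_⟩
  · ext i j
    exact (k3 i j).symm.trans (g3 i j)
  · exact (List.append_inj h (by rw [length_codeGraph, length_codeGraph])).2.symm

theorem mem_decisionLanguage {n : ℕ} {G : SimpleGraph (Fin n)} {k : ℕ} :
    codeGraph G ++ k.bits ∈ decisionLanguage ↔
      IsSplit G ∧ ∃ S : Finset (Fin n), S.card ≤ k ∧ IsSolution G S := by
  constructor
  · rintro ⟨m, H, l, h, h'⟩
    obtain ⟨rfl, rfl, hb⟩ := codeGraph_append_inj h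
    have : l = k := by rw [← binVal_bits l, hb, binVal_bits]
    exact this ▸ h'
  · exact fun h => ⟨n, G, k, rfl, h⟩

/-- Each rejection is justified: an invalid word is no code, and a failed partition test means by
`run_splitCmd` that the graph is not split. In the remaining case the minimum size is compared with
k. -/
theorem run_decisionCmd (O : List Bool → List Bool) {w : List Bool} {s : St}
    (hs : decisionCmd.run O (w.length + 2) (inputSt w) = s) :
    s.calls = 0 ∧ (s.v 9 ≠ 0 ↔ w ∈ decisionLanguage) := by
  obtain ⟨n, h1, h2⟩ := exists_unary_prefix w
  rw [decisionCmd, Cmd.run, run_parseCmd O h1 h2] at hs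
  by_cases hvalid : validE.T (w.length + 2) (parsedSt n w).v (parsedSt n w).a
  · rw [Cmd.run_ite_pos hvalid, Cmd.run] at hs
    obtain ⟨G, k, hw⟩ := exists_code_of_validE h1 h2 hvalid
    have hl := length_codeGraph_append G k.bits
    rw [← hw] at hl
    have hn2 := Nat.zero_le (n * n)
    have hv : (parsedSt n w).v 0 = n := by simp [parsedSt]
    have ha : (parsedSt n w).a 0 = cells (codeGraph G ++ k.bits) := by
      rw [← hw]
      exact parsedSt_a_zero _ _
    have hE : ∀ u v : Fin n, G.Adj u v ↔ AdjR (w.length + 2) n ((parsedSt n w).a 0) u v := by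
      rw [ha]
      exact adjR_codeGraph G k.bits (by omega)
    obtain ⟨⟨hv', ha', hc'⟩, hp⟩ := run_splitCmd O (B := w.length + 2) (parsedSt n w) (by omega)
    set s1 := splitCmd.run O (w.length + 2) (parsedSt n w) with hs1
    rw [hv] at hv' hp
    have ha0 := ha' 0 (by decide)
    have hpart := T_partitionE (B := w.length + 2) (f := s1.v) (a := s1.a) hv' (by omega)
    rw [ha0] at hpart
    rw [hw, mem_decisionLanguage]
    by_cases hok : partitionE.T (w.length + 2) s1.v s1.a
    · rw [Cmd.run_ite_pos hok, Cmd.run, Cmd.run] at hs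
      have hok' := hpart.1 hok
      obtain ⟨k1, k2, -, k4, S, hS, hcard, -⟩ := run_searchCmd_of_prefixOK (O := O) (G := G)
        (r := k.bits) (fun s hB => run_auctionCmd O s hB) (B := w.length + 2) (by omega) hv'
        (ha0.trans ha) (by rw [ha0]; exact hok') rfl
      set s2 := (searchCmd auctionCmd).run O (w.length + 2) s1 with hs2
      obtain ⟨m7, m4, mc⟩ := run_numberCmd O (w := w) k1 (k2.trans (ha0.trans (hw ▸ ha))) (by omega)
      rw [hw, List.drop_left' (length_codeGraph G), binVal_bits, ← hw] at m7
      have h9 : s.v 9 ≠ 0 ↔ S.card ≤ k := by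
        rw [← hs]
        simp only [Cmd.run, Function.update_self]
        refine Ex.T_not.trans ?_
        rw [Ex.T_lt]
        simp only [Ex.eval, m7, m4, hcard, not_lt]
      refine ⟨?_, h9.trans ⟨fun h => ⟨hok'.isSplit hE, S, h, hS.1⟩, fun ⟨_, T, hT, hT'⟩ =>
        (hS.2 T hT').trans hT⟩⟩
      rw [← hs]
      refine mc.trans (k4.trans ?_)
      rw [hc']
      simp [parsedSt]
    · rw [Cmd.run_ite_neg hok] at hs
      subst hs
      refine ⟨hc', ?_⟩
      simp only [Cmd.run, Function.update_self, Ex.eval, ne_eq, not_true_eq_false, false_iff,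
        not_and]
      intro hG
      obtain ⟨C, hC⟩ := hG.exists_prefixOK hE
      exact absurd (hpart.2 (hp C hC)) hok
  · rw [Cmd.run_ite_neg hvalid] at hs
    subst hs
    refine ⟨rfl, ?_⟩
    simp only [Cmd.run, Function.update_self, Ex.eval, ne_eq, not_true_eq_false, false_iff]
    rintro ⟨m, G, k, rfl, -⟩
    obtain ⟨g1, g2, -⟩ := codeGraph_append_getD G k.bits
    obtain rfl := unary_prefix_unique h1 h2 g1 g2
    exact hvalid (validE_of_code G k)

open Classical in
theorem readWord_answerE {B : ℕ} {s : St} {p : Prop} (h : s.v 9 ≠ 0 ↔ p) :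
    answerE.eval B (Function.update s.v 20 0) s.a = 1 ∧
      readWord (fun i => answerE.eval B (Function.update s.v 20 i) s.a) 0 = [decide p] := by
  have h0 : answerE.eval B (Function.update s.v 20 0) s.a = 1 := by
    rw [answerE, Ex.eval_ite, if_pos (by rw [Ex.T_eq]; simp [Ex.eval])]
    rfl
  have h1 : answerE.eval B (Function.update s.v 20 1) s.a = s.v 9 := by
    rw [answerE, Ex.eval_ite, if_neg (by rw [Ex.T_eq]; simp [Ex.eval])]
    simp [Ex.eval]
  refine ⟨h0, ?_⟩
  simp [readWord, h0, h1, ← h]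

theorem decisionLanguage_inP : InP decisionLanguage := by
  obtain ⟨P, hP⟩ := decisionCmd.outputs_fullProg 20 answerE
  refine ⟨decisionCmd.fullProg 20 answerE, P, fun w => ?_⟩
  obtain ⟨hc, h9⟩ := run_decisionCmd (fun _ => []) (w := w) rfl
  obtain ⟨h0, hread⟩ := readWord_answerE (B := w.length + 2) h9
  have hsafe : decisionCmd.Safe fun _ => [] := by
    simp [decisionCmd, parseCmd, numberCmd, Cmd.Safe, searchCmd_safe, splitCmd_safe,
      auctionCmd_safe]
  have := hP _ w _ hsafe rfl (by rw [h0]; omega)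
  rwa [hread, hc] at this

end SplitUIG
-- The main theorem
theorem mainTheorem3 :
    -- a minimum solution is computed in polynomial time
    (∃ (p : SplitUIG.Prog) (P : Polynomial ℕ),
      ∀ (n : ℕ) (G : SimpleGraph (Fin n)), SplitUIG.IsSplit G →
        ∃ S : Finset (Fin n), SplitUIG.IsMinSolution G S ∧
          SplitUIG.OutputsPlain p (SplitUIG.codeGraph G) (SplitUIG.codeSet S)
            (P.eval (SplitUIG.codeGraph G).length)) ∧
    -- the decision version is in P
    SplitUIG.InP SplitUIG.decisionLanguage ∧
    -- polynomial time with at most `O(n ^ 3)` calls to bipartite vertex cover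
    (∃ (p : SplitUIG.Prog) (P : Polynomial ℕ) (K : ℕ),
      ∀ O : List Bool → List Bool, SplitUIG.SolvesBipartiteVertexCover O →
        ∀ (n : ℕ) (G : SimpleGraph (Fin n)), SplitUIG.IsSplit G →
          ∃ S : Finset (Fin n), SplitUIG.IsMinSolution G S ∧
            SplitUIG.Outputs O p (SplitUIG.codeGraph G) (SplitUIG.codeSet S)
              (P.eval (SplitUIG.codeGraph G).length) (K * (n + 1) ^ 3)) ∧
    -- the independent side of a connected split unit interval graph has at most three vertices
    (∀ (n : ℕ) (G : SimpleGraph (Fin n)) (C I : Set (Fin n)), G.Connected →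
      SplitUIG.IsSplitPartition G C I → SplitUIG.IsUnitInterval G → I.ncard ≤ 3) := by
  refine ⟨?_, SplitUIG.decisionLanguage_inP, ?_, fun n G C I hconn hs hG =>
    SplitUIG.ncard_right_le_three hconn hs hG⟩
  · obtain ⟨P, hP⟩ := SplitUIG.outputs_solveCmd SplitUIG.auctionCmd
    refine ⟨(SplitUIG.solveCmd SplitUIG.auctionCmd).fullProg 20 SplitUIG.solutionE, P, fun n G hG => ?_⟩
    -- The auction asks nothing, so with δ = 0 the bound on the calls is zero.
    obtain ⟨S, hS, h⟩ := hP (fun _ => []) 0 (SplitUIG.auctionCmd_safe _)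
      (fun s hs => SplitUIG.run_auctionCmd _ s hs) n G hG
    exact ⟨S, hS, h⟩
  · obtain ⟨P, hP⟩ := SplitUIG.outputs_solveCmd SplitUIG.askCmd
    -- One question per guess gives (n + 1)(n + 1)(n + 2) calls, at most twice (n + 1)³.
    refine ⟨(SplitUIG.solveCmd SplitUIG.askCmd).fullProg 20 SplitUIG.solutionE, P, 2, fun O hO n G hG => ?_⟩
    obtain ⟨S, hS, s, t, c, h1, h2, h3, h4⟩ := hP O 1 (SplitUIG.askCmd_safe hO)
      (fun s hs => SplitUIG.run_askCmd hO s hs) n G hG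
    refine ⟨S, hS, s, t, c, h1, h2, h3, h4.trans ?_⟩
    nlinarith [Nat.zero_le n, Nat.zero_le (n * (n + 1) ^ 2), pow_pos (Nat.succ_pos n) 2]
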